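/- Let $\mathbb K$ be a field of characteristic zero. Operads are symmetric $\mathbb K$-linear operads, viewed as positive linear species $\mathcal O$ (functors from finite sets and bijections to $\mathbb K$-vector spaces, zero on $\emptyset$) with a unit and partial compositions $\circ_*$. *The operad $\mathbf{SP}$.* Let $\mathbb K\mathbf G$ be the operad of simple graphs: $\mathbb K\mathbf G[V]$ is spanned by the simple graphs on the nonempty finite vertex set $V$, and $g_1\circ_* g_2$ is the sum of all graphs obtained from the disjoint union of $g_1$ and $g_2$ by deleting the vertex $*$ of $g_1$ and reconnecting every loose end to an arbitrary vertex of $g_2$. Let $P_{ab}$ be the graph on $\{a,b\}$ without edges and $S_{ab}$ the graph on $\{a,b\}$ with one edge, and let $\mathbf{SP}$ be the suboperad of $\mathbb K\mathbf G$ generated by them. *Its presentation and Koszul dual.* Let $G$ be the subspecies of $\mathbb K\mathbf G$ generated by $P_{ab}$ and $S_{ab}$, let $\mathbf{Free}_G$ be the free operad on $G$, and let $R\subset\mathbf{Free}_G$ be the subspecies generated by $$P_{c*}\circ_* P_{ab}-P_{a*}\circ_* P_{bc},\qquad S_{a*}\circ_* P_{bc}-P_{c*}\circ_* S_{ab}-P_{b*}\circ_*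 S_{ac}.$$ For a binary quadratic operad $\mathrm{Ope}(G,R)=\mathbf{Free}_G/(R)$ (that is, $G$ is concentrated in cardinality two and $R$ consists of combinations of trees with two internal nodes) the Koszul dual is $\mathrm{Ope}(G^\vee,R^\perp)$. Here $G^\vee$ is the linear dual of $G$ twisted by the sign: $G^\vee[V]$ is the space of families $(f_o)$ of linear forms on $G[V]$, indexed by the total orderings $o$ of $V$, that are multiplied by the sign of a permutation when the ordering is permuted. And $R^\perp$ is the orthogonal of $R$ for the pairing between the parts of $\mathbf{Free}_{G^\vee}[V]$ and $\mathbf{Free}_G[V]$ spanned by trees with two internal nodes, $|V|=3$, given by $\langle f_1\circ_* f_2,\,x_1\circ_* x_2\rangle=f_1(x_1)f_2(x_2)$ if $f_1,x_1$ have arity $\{*,a\}$ and $f_2,x_2$ have arity $\{b,c\}=V\setminus\{a\}$ for the same $a$, and $0$ if the vertices $a$ differ; $f_1$ and $f_2$ are evaluated along the orderings $(*,a)$ and $(b,c)$, where $(a,b,c)$ is a cyclic rotation of a fixed ordering of $V$. **Proposition.** The operad $\mathrm{Ope}(G,R)$ is binary and quadratic and is isomorphic to $\mathbf{SP}$. The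 Koszul dual $\mathbf{SP}^!=\mathrm{Ope}(G^\vee,R^\perp)$ has finite-dimensional components, and its Hilbert series $\mathcal H_{\mathbf{SP}^!}(x)=\sum_{n\ge 0}\dim\mathbf{SP}^![\{1,\dots,n\}]\,\frac{x^n}{n!}$ is $$\mathcal H_{\mathbf{SP}^!}(x)=\frac{(1-\log(1-x))^2-1}{2}$$ as a formal power series. Consequently $\dim\mathbf{SP}^![\{1,\dots,n+1\}]=n!\left(1+\sum_{k=1}^{n}\frac1k\right)$ for all $n\ge 0$ (OEIS A000774), and for arities $1,\dots,9$ the dimensions are $1, 2, 5, 17, 74, 394, 2484, 18108, 149904$. -/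

import Mathlib

open scoped TensorProduct

noncomputable section

/-! ### Linear species -/

/-- A positive linear species over `K`: a functor from finite sets and bijections to `K`-vector
spaces that vanishes on the empty set. -/
structure LinSpecies.{v, u} (K : Type v) [Field K] where
  obj : (V : Type) → [Finite V] → Type u
  [addCommGroup : ∀ (V : Type) [Finite V], AddCommGroup (obj V)]
  [module : ∀ (V : Type) [Finite V], Module K (obj V)]
  map : ∀ {V W : Type} [Finite V] [Finite W], (V ≃ W) → obj V →ₗ[K] obj W
  map_refl : ∀ {V : Type} [Finite V] (x : obj V), map (Equiv.refl V) x = x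
  map_trans : ∀ {U V W : Type} [Finite U] [Finite V] [Finite W] (σ : U ≃ V) (τ : V ≃ W)
    (x : obj U), map (σ.trans τ) x = map τ (map σ x)
  positive : ∀ (V : Type) [Finite V] [IsEmpty V], Subsingleton (obj V)

attribute [instance] LinSpecies.addCommGroup LinSpecies.module

namespace LinSpecies

/-- The Hilbert series `∑ dim S[[n]] xⁿ / n!`. -/
def hilbertSeries.{v, u} {K : Type v} [Field K] (S : LinSpecies.{v, u} K) : PowerSeries ℚ :=
  PowerSeries.mk fun n => (Module.finrank K (S.obj (Fin n)) : ℚ) / (n.factorial : ℚ)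

/-- A species concentrated in cardinality two. -/
def IsBinary.{v, u} {K : Type v} [Field K] (S : LinSpecies.{v, u} K) : Prop :=
  ∀ (V : Type) [Finite V], Nat.card V ≠ 2 → Subsingleton (S.obj V)

/-- A subspecies: a family of subspaces stable under relabelling. -/
structure Sub.{v, u} {K : Type v} [Field K] (S : LinSpecies.{v, u} K) where
  carrier : ∀ (V : Type) [Finite V], Submodule K (S.obj V)
  map_mem : ∀ {V W : Type} [Finite V] [Finite W] (σ : V ≃ W) {x : S.obj V},
    x ∈ carrier V → S.map σ x ∈ carrier W

/-- A subspecies, as a species. -/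
def Sub.toSpecies.{v, u} {K : Type v} [Field K] {S : LinSpecies.{v, u} K} (P : S.Sub) :
    LinSpecies.{v, u} K where
  obj V _ := P.carrier V
  map σ := (S.map σ).restrict fun _ hx => P.map_mem σ hx
  map_refl x := Subtype.ext (S.map_refl x.1)
  map_trans σ τ x := Subtype.ext (S.map_trans σ τ x.1)
  positive V _ _ :=
    ⟨fun x y => Subtype.ext ((S.positive V).elim x.1 y.1)⟩

/-- The smallest subspecies containing a given set of elements of arity `n`. -/
def generate.{v, u} {K : Type v} [Field K] (S : LinSpecies.{v, u} K) {n : ℕ}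
    (s : Set (S.obj (Fin n))) : S.Sub where
  carrier V _ := Submodule.span K {y | ∃ (σ : Fin n ≃ V), ∃ x ∈ s, S.map σ x = y}
  map_mem {V W} _ _ σ x hx := by
    have h : Submodule.span K {y | ∃ (σ : Fin n ≃ V), ∃ x ∈ s, S.map σ x = y} ≤
        (Submodule.span K {y | ∃ (σ : Fin n ≃ W), ∃ x ∈ s, S.map σ x = y}).comap (S.map σ) := by
      rw [Submodule.span_le]
      rintro _ ⟨τ, z, hz, rfl⟩
      exact Submodule.subset_span ⟨τ.trans σ, z, hz, S.map_trans _ _ _⟩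
    exact h hx

/-- The species `S^∨`, i.e. the linear dual twisted by the sign. An element of `S^∨[V]` assigns to
every total ordering `o : Fin n ≃ V` of `V` a linear form on `S[V]`, in such a way that permuting
the ordering multiplies the form by the sign of the permutation. Choosing an ordering identifies
`S^∨[V]` with the dual of `S[V]`, a permutation `σ` of `V` then acting by
`f ↦ sign(σ) • f ∘ S[σ⁻¹]`. -/
def dual.{v, u} {K : Type v} [Field K] (S : LinSpecies.{v, u} K) : LinSpecies.{v, max u v} K where
  obj V _ :=
    ({ carrier := {φ | ∀ (n : ℕ) (o : Fin n ≃ V) (τ : Equiv.Perm (Fin n)),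
          φ n (τ.trans o) = ((Equiv.Perm.sign τ : ℤ) : K) • φ n o}
       add_mem' := fun {φ ψ} hφ hψ n o τ => by simp [hφ n o τ, hψ n o τ]
       zero_mem' := fun n o τ => by simp
       smul_mem' := fun c φ hφ n o τ => by simp [hφ n o τ, smul_comm c] } :
      Submodule K ((n : ℕ) → (Fin n ≃ V) → Module.Dual K (S.obj V)))
  map {V W} _ _ σ :=
    { toFun := fun φ => ⟨fun n o => φ.1 n (o.trans σ.symm) ∘ₗ S.map σ.symm, fun n o τ => by
        have h := φ.2 n (o.trans σ.symm) τ
        change φ.1 n (Equiv.trans τ (o.trans σ.symm)) ∘ₗ S.map σ.symm = _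
        rw [h, LinearMap.smul_comp]⟩
      map_add' := fun φ ψ => by
        apply Subtype.ext; funext n o
        exact LinearMap.add_comp _ _ _
      map_smul' := fun c φ => by
        apply Subtype.ext; funext n o
        exact LinearMap.smul_comp _ _ _ }
  map_refl φ := by
    apply Subtype.ext; funext n o
    apply LinearMap.ext; intro x
    change φ.1 n (o.trans (Equiv.refl _).symm) (S.map (Equiv.refl _).symm x) = _
    rw [Equiv.refl_symm, Equiv.trans_refl, S.map_refl]
  map_trans σ τ φ := by
    apply Subtype.ext; funext n o
    apply LinearMap.ext; intro x
    change φ.1 n (o.trans (σ.trans τ).symm) (S.map (σ.trans τ).symm x) =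
      φ.1 n ((o.trans τ.symm).trans σ.symm) (S.map σ.symm (S.map τ.symm x))
    rw [← S.map_trans]
    rfl
  positive V _ _ := ⟨fun φ ψ => by
    apply Subtype.ext; funext n o
    apply LinearMap.ext; intro x
    have hx : x = 0 := (S.positive V).elim x 0
    rw [hx, map_zero, map_zero]⟩

end LinSpecies

/-! ### Operads -/

namespace Relabel

/-- The bijection `A ⊔ (B ⊔ {*}) ≃ (A ⊔ B) ⊔ {*}`. -/
def optionRight (A B : Type) : A ⊕ Option B ≃ Option (A ⊕ B) where
  toFun
    | .inl a => some (.inl a)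
    | .inr (some b) => some (.inr b)
    | .inr none => none
  invFun
    | some (.inl a) => .inl a
    | some (.inr b) => .inr (some b)
    | none => .inr none
  left_inv := by rintro (a | _ | b) <;> rfl
  right_inv := by rintro (_ | a | b) <;> rfl

/-- The bijection `(A ⊔ {*}) ⊔ B ≃ (A ⊔ B) ⊔ {*}`. -/
def optionLeft (A B : Type) : Option A ⊕ B ≃ Option (A ⊕ B) where
  toFun
    | .inl (some a) => some (.inl a)
    | .inl none => none
    | .inr b => some (.inr b)
  invFun
    | some (.inl a) => .inl (some a)
    | some (.inr b) => .inr b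
    | none => .inl none
  left_inv := by rintro ((_ | a) | b) <;> rfl
  right_inv := by rintro (_ | a | b) <;> rfl

/-- The exchange of the two adjoined points of `A ⊔ {*₂} ⊔ {*₁}`. -/
def swapPoints (A : Type) : Option (Option A) ≃ Option (Option A) where
  toFun
    | none => some none
    | some none => none
    | some (some a) => some (some a)
  invFun
    | none => some none
    | some none => none
    | some (some a) => some (some a)
  left_inv := by rintro (_ | _ | a) <;> rfl
  right_inv := by rintro (_ | _ | a) <;> rfl

/-- The bijection `(A ⊔ C) ⊔ B ≃ (A ⊔ B) ⊔ C`. -/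
def rightComm (A B C : Type) : (A ⊕ C) ⊕ B ≃ (A ⊕ B) ⊕ C where
  toFun
    | .inl (.inl a) => .inl (.inl a)
    | .inl (.inr c) => .inr c
    | .inr b => .inl (.inr b)
  invFun
    | .inl (.inl a) => .inl (.inl a)
    | .inl (.inr b) => .inr b
    | .inr c => .inl (.inr c)
  left_inv := by rintro ((a | c) | b) <;> rfl
  right_inv := by rintro ((a | b) | c) <;> rfl

/-- The bijection `A ⊔ {v} ≃ A ⊔ {*}`. -/
def addPoint (A : Type) : A ⊕ Unit ≃ Option A where
  toFun
    | .inl a => some a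
    | .inr _ => none
  invFun
    | some a => .inl a
    | none => .inr ()
  left_inv := by rintro (a | _) <;> rfl
  right_inv := by rintro (_ | a) <;> rfl

/-- The bijection `{v} ≃ ∅ ⊔ {*}`. -/
def point : Unit ≃ Option Empty where
  toFun _ := none
  invFun _ := ()
  left_inv := by rintro ⟨⟩; rfl
  right_inv := by rintro (_ | a); · rfl
                  · exact a.elim

/-- The bijection `0 ↦ *`, `1 ↦ v` between `Fin 2` and `{v} ⊔ {*}`. -/
def pair : Fin 2 ≃ Option Unit where
  toFun i := if i = 0 then none else some ()
  invFun
    | none => 0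
    | some _ => 1
  left_inv := by intro i; fin_cases i <;> rfl
  right_inv := by rintro (_ | ⟨⟩) <;> rfl

/-- Given an ordering `o` of a three element set and an index `i` (read modulo three), the
bijection from `{v} ⊔ {0, 1}` that sends `v` to `o i`, `0` to `o (i + 1)` and `1` to
`o (i + 2)`. -/
def slot {V : Type} (o : Fin 3 ≃ V) (i : Fin 3) : Unit ⊕ Fin 2 ≃ V :=
  Equiv.trans
    { toFun := fun x => match x with
        | .inl _ => i
        | .inr j => if j = 0 then i + 1 else i + 2
      invFun := fun k => if k = i then .inl () else if k = i + 1 then .inr 0 else .inr 1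
      left_inv := by revert i; decide
      right_inv := by revert i; decide } o

end Relabel

/-- A symmetric (linear) operad over `K`, in terms of partial compositions: for `x ∈ O[A ⊔ {*}]` and
`y ∈ O[B]`, `comp x y` is `x ∘_* y ∈ O[A ⊔ B]`. -/
structure Operad.{v, u} (K : Type v) [Field K] extends LinSpecies.{v, u} K where
  one : obj Unit
  comp : ∀ {A B : Type} [Finite A] [Finite B], obj (Option A) →ₗ[K] obj B →ₗ[K] obj (A ⊕ B)
  comp_map : ∀ {A A₁ B B₁ : Type} [Finite A] [Finite A₁] [Finite B] [Finite B₁]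
    (σ : A ≃ A₁) (τ : B ≃ B₁) (x : obj (Option A)) (y : obj B),
    comp (map (Equiv.optionCongr σ) x) (map τ y) = map (Equiv.sumCongr σ τ) (comp x y)
  /-- parallel composition, at two distinct points of `x` -/
  comp_par : ∀ {A B C : Type} [Finite A] [Finite B] [Finite C]
    (x : obj (Option (Option A))) (y : obj B) (z : obj C),
    comp (map (Relabel.optionLeft A B) (comp x y)) z =
      map (Relabel.rightComm A B C)
        (comp (map (Relabel.optionLeft A C) (comp (map (Relabel.swapPoints A) x) z)) y)
  /-- sequential composition -/
  comp_seq : ∀ {A B C : Type} [Finite A] [Finite B] [Finite C]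
    (x : obj (Option A)) (y : obj (Option B)) (z : obj C),
    map (Equiv.sumAssoc A B C) (comp (map (Relabel.optionRight A B) (comp x y)) z) =
      comp x (comp y z)
  comp_one : ∀ {A : Type} [Finite A] (x : obj (Option A)),
    map (Relabel.addPoint A) (comp x one) = x
  one_comp : ∀ {B : Type} [Finite B] (y : obj B),
    map (Equiv.emptySum Empty B) (comp (map Relabel.point one) y) = y

namespace Operad

/-- An isomorphism of operads. -/
structure Iso.{v, u, w} {K : Type v} [Field K] (O : Operad.{v, u} K) (P : Operad.{v, w} K) where
  equiv : ∀ (V : Type) [Finite V], O.obj V ≃ₗ[K] P.obj V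
  map_equiv : ∀ {V W : Type} [Finite V] [Finite W] (σ : V ≃ W) (x : O.obj V),
    equiv W (O.map σ x) = P.map σ (equiv V x)
  equiv_one : equiv Unit O.one = P.one
  equiv_comp : ∀ {A B : Type} [Finite A] [Finite B] (x : O.obj (Option A)) (y : O.obj B),
    equiv (A ⊕ B) (O.comp x y) = P.comp (equiv (Option A) x) (equiv B y)

/-- Membership in the suboperad generated by a subspecies. -/
inductive GenMem.{v, u} {K : Type v} [Field K] (O : Operad.{v, u} K) (G : O.toLinSpecies.Sub) :
    ∀ (V : Type) [Finite V], O.obj V → Prop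
  | of {V : Type} [Finite V] {x : O.obj V} : x ∈ G.carrier V → GenMem O G V x
  | one : GenMem O G Unit O.one
  | zero {V : Type} [Finite V] : GenMem O G V 0
  | add {V : Type} [Finite V] {x y : O.obj V} :
      GenMem O G V x → GenMem O G V y → GenMem O G V (x + y)
  | smul {V : Type} [Finite V] (c : K) {x : O.obj V} : GenMem O G V x → GenMem O G V (c • x)
  | map {V W : Type} [Finite V] [Finite W] (σ : V ≃ W) {x : O.obj V} :
      GenMem O G V x → GenMem O G W (O.map σ x)
  | comp {A B : Type} [Finite A] [Finite B] {x : O.obj (Option A)} {y : O.obj B} :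
      GenMem O G (Option A) x → GenMem O G B y → GenMem O G (A ⊕ B) (O.comp x y)

/-- The underlying subspecies of the suboperad generated by a subspecies. -/
def genSub.{v, u} {K : Type v} [Field K] (O : Operad.{v, u} K) (G : O.toLinSpecies.Sub) :
    O.toLinSpecies.Sub where
  carrier V _ :=
    { carrier := {x | GenMem O G V x}
      add_mem' := .add
      zero_mem' := .zero
      smul_mem' := fun c _ => .smul c }
  map_mem σ _ hx := .map σ hx

/-- The suboperad of `O` generated by a subspecies. -/
def suboperad.{v, u} {K : Type v} [Field K] (O : Operad.{v, u} K) (G : O.toLinSpecies.Sub) :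
    Operad.{v, u} K where
  toLinSpecies := (O.genSub G).toSpecies
  one := ⟨O.one, .one⟩
  comp := LinearMap.mk₂ K (fun x y => ⟨O.comp x.1 y.1, .comp x.2 y.2⟩)
    (fun x x₁ y => Subtype.ext (LinearMap.map_add₂ O.comp x.1 x₁.1 y.1))
    (fun c x y => Subtype.ext (LinearMap.map_smul₂ O.comp c x.1 y.1))
    (fun x y y₁ => Subtype.ext ((O.comp x.1).map_add y.1 y₁.1))
    (fun c x y => Subtype.ext ((O.comp x.1).map_smul c y.1))
  comp_map σ τ x y := Subtype.ext (O.comp_map σ τ x.1 y.1)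
  comp_par x y z := Subtype.ext (O.comp_par x.1 y.1 z.1)
  comp_seq x y z := Subtype.ext (O.comp_seq x.1 y.1 z.1)
  comp_one x := Subtype.ext (O.comp_one x.1)
  one_comp y := Subtype.ext (O.one_comp y.1)

/-- Membership in the operadic ideal generated by a subspecies. -/
inductive IdealMem.{v, u} {K : Type v} [Field K] (O : Operad.{v, u} K) (R : O.toLinSpecies.Sub) :
    ∀ (V : Type) [Finite V], O.obj V → Prop
  | of {V : Type} [Finite V] {x : O.obj V} : x ∈ R.carrier V → IdealMem O R V x
  | zero {V : Type} [Finite V] : IdealMem O R V 0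
  | add {V : Type} [Finite V] {x y : O.obj V} :
      IdealMem O R V x → IdealMem O R V y → IdealMem O R V (x + y)
  | smul {V : Type} [Finite V] (c : K) {x : O.obj V} :
      IdealMem O R V x → IdealMem O R V (c • x)
  | map {V W : Type} [Finite V] [Finite W] (σ : V ≃ W) {x : O.obj V} :
      IdealMem O R V x → IdealMem O R W (O.map σ x)
  | comp_left {A B : Type} [Finite A] [Finite B] {x : O.obj (Option A)} (y : O.obj B) :
      IdealMem O R (Option A) x → IdealMem O R (A ⊕ B) (O.comp x y)
  | comp_right {A B : Type} [Finite A] [Finite B] (x : O.obj (Option A)) {y : O.obj B} :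
      IdealMem O R B y → IdealMem O R (A ⊕ B) (O.comp x y)

/-- The ideal `(R)`: the smallest ideal of `O` containing the subspecies `R`. -/
def ideal.{v, u} {K : Type v} [Field K] (O : Operad.{v, u} K) (R : O.toLinSpecies.Sub) :
    O.toLinSpecies.Sub where
  carrier V _ :=
    { carrier := {x | IdealMem O R V x}
      add_mem' := .add
      zero_mem' := .zero
      smul_mem' := fun c _ => .smul c }
  map_mem σ _ hx := .map σ hx

/-- The quotient operad `O / (R)`. -/
def quotient.{v, u} {K : Type v} [Field K] (O : Operad.{v, u} K) (R : O.toLinSpecies.Sub) :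
    Operad.{v, u} K where
  obj V _ := O.obj V ⧸ (O.ideal R).carrier V
  map {V W} _ _ σ := Submodule.mapQ _ _ (O.map σ) fun _ hx => (O.ideal R).map_mem σ hx
  map_refl x := by
    induction x using Submodule.Quotient.induction_on with
    | H x => exact congrArg _ (O.map_refl x)
  map_trans σ τ x := by
    induction x using Submodule.Quotient.induction_on with
    | H x => exact congrArg _ (O.map_trans σ τ x)
  positive V _ _ := ⟨fun x y => by
    induction x using Submodule.Quotient.induction_on with
    | H x =>
      induction y using Submodule.Quotient.induction_on with
      | H y => rw [(O.positive V).elim x y]⟩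
  one := Submodule.Quotient.mk O.one
  comp {A B} _ _ :=
    Submodule.liftQ _
      (LinearMap.flip (Submodule.liftQ _
        (LinearMap.flip (LinearMap.compr₂ O.comp
          (Submodule.mkQ ((O.ideal R).carrier (A ⊕ B)))))
        (fun y hy => LinearMap.ext fun x =>
          (Submodule.Quotient.mk_eq_zero _).2 (IdealMem.comp_right x hy))))
      (fun x hx => LinearMap.ext fun y => by
        induction y using Submodule.Quotient.induction_on with
        | H y => exact (Submodule.Quotient.mk_eq_zero _).2 (IdealMem.comp_left y hx))
  comp_map σ τ x y := by
    induction x using Submodule.Quotient.induction_on with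
    | H x =>
      induction y using Submodule.Quotient.induction_on with
      | H y => exact congrArg _ (O.comp_map σ τ x y)
  comp_par x y z := by
    induction x using Submodule.Quotient.induction_on with
    | H x =>
      induction y using Submodule.Quotient.induction_on with
      | H y =>
        induction z using Submodule.Quotient.induction_on with
        | H z => exact congrArg _ (O.comp_par x y z)
  comp_seq x y z := by
    induction x using Submodule.Quotient.induction_on with
    | H x =>
      induction y using Submodule.Quotient.induction_on with
      | H y =>
        induction z using Submodule.Quotient.induction_on with
        | H z => exact congrArg _ (O.comp_seq x y z)
  comp_one x := by
    induction x using Submodule.Quotient.induction_on with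
    | H x => exact congrArg _ (O.comp_one x)
  one_comp y := by
    induction y using Submodule.Quotient.induction_on with
    | H y => exact congrArg _ (O.one_comp y)

end Operad

/-! ### The free operad -/

namespace FreeOperad

/-- Formal expressions in the operad operations with generators in `G`. -/
inductive Pre.{v, u} {K : Type v} [Field K] (G : LinSpecies.{v, u} K) : Type → Type (max 1 u v)
  | zero {V : Type} : Pre G V
  | add {V : Type} : Pre G V → Pre G V → Pre G V
  | smul {V : Type} : K → Pre G V → Pre G V
  | of {V : Type} [Finite V] : G.obj V → Pre G V
  | map {V W : Type} [Finite V] [Finite W] : (V ≃ W) → Pre G V → Pre G W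
  | one : Pre G Unit
  | comp {A B : Type} [Finite A] [Finite B] : Pre G (Option A) → Pre G B → Pre G (A ⊕ B)

/-- The congruence generated by the axioms of vector spaces, the axioms of operads, and the
requirement that the inclusion of `G` be a morphism of linear species. -/
inductive Rel.{v, u} {K : Type v} [Field K] (G : LinSpecies.{v, u} K) :
    ∀ {V : Type}, Pre G V → Pre G V → Prop
  | refl {V : Type} (x : Pre G V) : Rel G x x
  | symm {V : Type} {x y : Pre G V} : Rel G x y → Rel G y x
  | trans {V : Type} {x y z : Pre G V} : Rel G x y → Rel G y z → Rel G x z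
  | add_congr {V : Type} {x x₁ y y₁ : Pre G V} : Rel G x x₁ → Rel G y y₁ →
      Rel G (.add x y) (.add x₁ y₁)
  | smul_congr {V : Type} (c : K) {x x₁ : Pre G V} : Rel G x x₁ → Rel G (.smul c x) (.smul c x₁)
  | map_congr {V W : Type} [Finite V] [Finite W] (σ : V ≃ W) {x x₁ : Pre G V} : Rel G x x₁ →
      Rel G (.map σ x) (.map σ x₁)
  | comp_congr {A B : Type} [Finite A] [Finite B] {x x₁ : Pre G (Option A)} {y y₁ : Pre G B} :
      Rel G x x₁ → Rel G y y₁ → Rel G (.comp x y) (.comp x₁ y₁)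
  | add_assoc {V : Type} (x y z : Pre G V) : Rel G (.add (.add x y) z) (.add x (.add y z))
  | add_comm {V : Type} (x y : Pre G V) : Rel G (.add x y) (.add y x)
  | zero_add {V : Type} (x : Pre G V) : Rel G (.add .zero x) x
  | zero_smul {V : Type} (x : Pre G V) : Rel G (.smul 0 x) .zero
  | one_smul {V : Type} (x : Pre G V) : Rel G (.smul 1 x) x
  | mul_smul {V : Type} (c d : K) (x : Pre G V) : Rel G (.smul (c * d) x) (.smul c (.smul d x))
  | add_smul {V : Type} (c d : K) (x : Pre G V) :
      Rel G (.smul (c + d) x) (.add (.smul c x) (.smul d x))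
  | smul_add {V : Type} (c : K) (x y : Pre G V) :
      Rel G (.smul c (.add x y)) (.add (.smul c x) (.smul c y))
  | of_add {V : Type} [Finite V] (x y : G.obj V) : Rel G (.of (x + y)) (.add (.of x) (.of y))
  | of_smul {V : Type} [Finite V] (c : K) (x : G.obj V) : Rel G (.of (c • x)) (.smul c (.of x))
  | of_map {V W : Type} [Finite V] [Finite W] (σ : V ≃ W) (x : G.obj V) :
      Rel G (.of (G.map σ x)) (.map σ (.of x))
  | map_add {V W : Type} [Finite V] [Finite W] (σ : V ≃ W) (x y : Pre G V) :
      Rel G (.map σ (.add x y)) (.add (.map σ x) (.map σ y))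
  | map_smul {V W : Type} [Finite V] [Finite W] (σ : V ≃ W) (c : K) (x : Pre G V) :
      Rel G (.map σ (.smul c x)) (.smul c (.map σ x))
  | map_refl {V : Type} [Finite V] (x : Pre G V) : Rel G (.map (Equiv.refl V) x) x
  | map_trans {U V W : Type} [Finite U] [Finite V] [Finite W] (σ : U ≃ V) (τ : V ≃ W)
      (x : Pre G U) : Rel G (.map (σ.trans τ) x) (.map τ (.map σ x))
  | add_comp {A B : Type} [Finite A] [Finite B] (x x₁ : Pre G (Option A)) (y : Pre G B) :
      Rel G (.comp (.add x x₁) y) (.add (.comp x y) (.comp x₁ y))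
  | smul_comp {A B : Type} [Finite A] [Finite B] (c : K) (x : Pre G (Option A)) (y : Pre G B) :
      Rel G (.comp (.smul c x) y) (.smul c (.comp x y))
  | comp_add {A B : Type} [Finite A] [Finite B] (x : Pre G (Option A)) (y y₁ : Pre G B) :
      Rel G (.comp x (.add y y₁)) (.add (.comp x y) (.comp x y₁))
  | comp_smul {A B : Type} [Finite A] [Finite B] (c : K) (x : Pre G (Option A)) (y : Pre G B) :
      Rel G (.comp x (.smul c y)) (.smul c (.comp x y))
  | comp_map {A A₁ B B₁ : Type} [Finite A] [Finite A₁] [Finite B] [Finite B₁]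
      (σ : A ≃ A₁) (τ : B ≃ B₁) (x : Pre G (Option A)) (y : Pre G B) :
      Rel G (.comp (.map (Equiv.optionCongr σ) x) (.map τ y))
        (.map (Equiv.sumCongr σ τ) (.comp x y))
  | comp_par {A B C : Type} [Finite A] [Finite B] [Finite C]
      (x : Pre G (Option (Option A))) (y : Pre G B) (z : Pre G C) :
      Rel G (.comp (.map (Relabel.optionLeft A B) (.comp x y)) z)
        (.map (Relabel.rightComm A B C)
          (.comp (.map (Relabel.optionLeft A C) (.comp (.map (Relabel.swapPoints A) x) z)) y))
  | comp_seq {A B C : Type} [Finite A] [Finite B] [Finite C]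
      (x : Pre G (Option A)) (y : Pre G (Option B)) (z : Pre G C) :
      Rel G (.map (Equiv.sumAssoc A B C) (.comp (.map (Relabel.optionRight A B) (.comp x y)) z))
        (.comp x (.comp y z))
  | comp_one {A : Type} [Finite A] (x : Pre G (Option A)) :
      Rel G (.map (Relabel.addPoint A) (.comp x .one)) x
  | one_comp {B : Type} [Finite B] (y : Pre G B) :
      Rel G (.map (Equiv.emptySum Empty B) (.comp (.map Relabel.point .one) y)) y

/-- The space of arity `V` of the free operad on `G`. -/
def Carrier.{v, u} {K : Type v} [Field K] (G : LinSpecies.{v, u} K) (V : Type) :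
    Type (max 1 u v) := Quot (Rel G (V := V))

/-- The class of a formal expression in the free operad. -/
def mk.{v, u} {K : Type v} [Field K] (G : LinSpecies.{v, u} K) {V : Type} (x : Pre G V) :
    Carrier G V := Quot.mk _ x

instance instAdd.{v, u} {K : Type v} [Field K] (G : LinSpecies.{v, u} K) (V : Type) :
    Add (Carrier G V) where
  add := Quot.map₂ Pre.add (fun _ _ _ h => .add_congr (.refl _) h)
    (fun _ _ _ h => .add_congr h (.refl _))

instance instZero.{v, u} {K : Type v} [Field K] (G : LinSpecies.{v, u} K) (V : Type) :
    Zero (Carrier G V) where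
  zero := Quot.mk _ .zero

instance instNeg.{v, u} {K : Type v} [Field K] (G : LinSpecies.{v, u} K) (V : Type) :
    Neg (Carrier G V) where
  neg := Quot.map (Pre.smul (-1)) (fun _ _ h => .smul_congr _ h)

instance instAddCommGroup.{v, u} {K : Type v} [Field K] (G : LinSpecies.{v, u} K) (V : Type) :
    AddCommGroup (Carrier G V) where
  add_assoc := by rintro ⟨x⟩ ⟨y⟩ ⟨z⟩; exact Quot.sound (.add_assoc x y z)
  add_comm := by rintro ⟨x⟩ ⟨y⟩; exact Quot.sound (.add_comm x y)
  zero_add := by rintro ⟨x⟩; exact Quot.sound (.zero_add x)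
  add_zero := by rintro ⟨x⟩; exact Quot.sound (.trans (.add_comm _ _) (.zero_add x))
  neg_add_cancel := by
    rintro ⟨x⟩
    refine Quot.sound (.trans (.add_congr (.refl _) (.symm (.one_smul x))) ?_)
    refine .trans (.symm (.add_smul _ _ _)) ?_
    rw [neg_add_cancel]
    exact .zero_smul x
  nsmul := nsmulRec
  zsmul := zsmulRec

instance instModule.{v, u} {K : Type v} [Field K] (G : LinSpecies.{v, u} K) (V : Type) :
    Module K (Carrier G V) where
  smul c := Quot.map (Pre.smul c) (fun _ _ h => .smul_congr _ h)
  one_smul := by rintro ⟨x⟩; exact Quot.sound (.one_smul x)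
  mul_smul := by rintro c d ⟨x⟩; exact Quot.sound (.mul_smul c d x)
  smul_zero c := by
    refine Quot.sound (.trans (.smul_congr c (.symm (.zero_smul .zero))) ?_)
    refine .trans (.symm (.mul_smul _ _ _)) ?_
    rw [mul_zero]
    exact .zero_smul _
  smul_add := by rintro c ⟨x⟩ ⟨y⟩; exact Quot.sound (.smul_add c x y)
  add_smul := by rintro c d ⟨x⟩; exact Quot.sound (.add_smul c d x)
  zero_smul := by rintro ⟨x⟩; exact Quot.sound (.zero_smul x)

theorem mk_eq_zero.{v, u} {K : Type v} [Field K] (G : LinSpecies.{v, u} K) {V : Type} [IsEmpty V]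
    (x : Pre G V) : mk G x = 0 := by
  suffices h : ∀ (W : Type) (y : Pre G W), IsEmpty W → mk G y = 0 from
    h V x inferInstance
  intro W y
  induction y with
  | zero => intro _; rfl
  | add x y hx hy =>
    intro h
    change mk G x + mk G y = 0
    rw [hx h, hy h, add_zero]
  | smul c x hx =>
    intro h
    change c • mk G x = 0
    rw [hx h, smul_zero]
  | @of W _ x =>
    intro h
    have hx : x = (0 : K) • x := (G.positive W).elim _ _
    rw [hx]
    exact Quot.sound (.trans (.of_smul _ _) (.zero_smul _))
  | @map U W _ _ σ x hx =>
    intro h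
    have h0 := hx (σ.isEmpty_congr.2 h)
    have h1 := congrArg (Quot.map (Pre.map σ) (fun _ _ h => Rel.map_congr σ h)) h0
    refine (h1 : mk G (Pre.map σ x) = mk G (Pre.map σ .zero)).trans ?_
    exact Quot.sound (.trans (.map_congr σ (.symm (.zero_smul .zero)))
      (.trans (.map_smul _ _ _) (.zero_smul _)))
  | one => intro h; exact h.elim ()
  | @comp A B _ _ x y hx hy =>
    intro h
    have h0 := hy ⟨fun b => h.elim (.inr b)⟩
    have h1 := congrArg (Quot.map (Pre.comp x) (fun _ _ h => Rel.comp_congr (.refl x) h)) h0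
    refine (h1 : mk G (Pre.comp x y) = mk G (Pre.comp x .zero)).trans ?_
    exact Quot.sound (.trans (.comp_congr (.refl x) (.symm (.zero_smul .zero)))
      (.trans (.comp_smul _ _ _) (.zero_smul _)))

end FreeOperad

/-- The free operad on the species `G`. -/
def freeOperad.{v, u} {K : Type v} [Field K] (G : LinSpecies.{v, u} K) :
    Operad.{v, max 1 u v} K where
  obj V _ := FreeOperad.Carrier G V
  map σ :=
    { toFun := Quot.map (FreeOperad.Pre.map σ) (fun _ _ h => .map_congr σ h)
      map_add' := by rintro ⟨x⟩ ⟨y⟩; exact Quot.sound (.map_add σ x y)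
      map_smul' := by rintro c ⟨x⟩; exact Quot.sound (.map_smul σ c x) }
  map_refl := by rintro V _ ⟨x⟩; exact Quot.sound (.map_refl x)
  map_trans := by rintro U V W _ _ _ σ τ ⟨x⟩; exact Quot.sound (.map_trans σ τ x)
  positive V _ _ := ⟨by
    rintro ⟨x⟩ ⟨y⟩
    exact (FreeOperad.mk_eq_zero G x).trans (FreeOperad.mk_eq_zero G y).symm⟩
  one := Quot.mk _ .one
  comp := LinearMap.mk₂ K
    (Quot.map₂ FreeOperad.Pre.comp (fun _ _ _ h => .comp_congr (.refl _) h)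
      (fun _ _ _ h => .comp_congr h (.refl _)))
    (by rintro ⟨x⟩ ⟨x₁⟩ ⟨y⟩; exact Quot.sound (.add_comp x x₁ y))
    (by rintro c ⟨x⟩ ⟨y⟩; exact Quot.sound (.smul_comp c x y))
    (by rintro ⟨x⟩ ⟨y⟩ ⟨y₁⟩; exact Quot.sound (.comp_add x y y₁))
    (by rintro c ⟨x⟩ ⟨y⟩; exact Quot.sound (.comp_smul c x y))
  comp_map := by
    rintro A A₁ B B₁ _ _ _ _ σ τ ⟨x⟩ ⟨y⟩; exact Quot.sound (.comp_map σ τ x y)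
  comp_par := by rintro A B C _ _ _ ⟨x⟩ ⟨y⟩ ⟨z⟩; exact Quot.sound (.comp_par x y z)
  comp_seq := by rintro A B C _ _ _ ⟨x⟩ ⟨y⟩ ⟨z⟩; exact Quot.sound (.comp_seq x y z)
  comp_one := by rintro A _ ⟨x⟩; exact Quot.sound (.comp_one x)
  one_comp := by rintro B _ ⟨y⟩; exact Quot.sound (.one_comp y)

namespace FreeOperad

/-- The inclusion of the generators into the free operad. -/
def ι.{v, u} {K : Type v} [Field K] (G : LinSpecies.{v, u} K) (V : Type) [Finite V] :
    G.obj V →ₗ[K] (freeOperad G).obj V where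
  toFun x := Quot.mk _ (.of x)
  map_add' x y := Quot.sound (.of_add x y)
  map_smul' c x := Quot.sound (.of_smul c x)

/-- `IsTree G k V t`: the element `t` of the free operad is a tree with leaves `V` and exactly `k`
internal nodes, each decorated by an element of `G`. -/
inductive IsTree.{v, u} {K : Type v} [Field K] (G : LinSpecies.{v, u} K) :
    ℕ → ∀ (V : Type) [Finite V], (freeOperad G).obj V → Prop
  | one : IsTree G 0 Unit (freeOperad G).one
  | of {V : Type} [Finite V] (x : G.obj V) : IsTree G 1 V (ι G V x)
  | map {k : ℕ} {V W : Type} [Finite V] [Finite W] (σ : V ≃ W) {t : (freeOperad G).obj V} :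
      IsTree G k V t → IsTree G k W ((freeOperad G).map σ t)
  | comp {k l : ℕ} {A B : Type} [Finite A] [Finite B] {s : (freeOperad G).obj (Option A)}
      {t : (freeOperad G).obj B} : IsTree G k (Option A) s → IsTree G l B t →
      IsTree G (k + l) (A ⊕ B) ((freeOperad G).comp s t)

/-- The subspecies of the free operad spanned by the trees with exactly `k` internal nodes. -/
def weight.{v, u} {K : Type v} [Field K] (G : LinSpecies.{v, u} K) (k : ℕ) :
    (freeOperad G).toLinSpecies.Sub where
  carrier V _ := Submodule.span K {t | IsTree G k V t}
  map_mem {V W} _ _ σ x hx := by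
    have h : Submodule.span K {t | IsTree G k V t} ≤
        (Submodule.span K {t | IsTree G k W t}).comap ((freeOperad G).map σ) := by
      rw [Submodule.span_le]
      exact fun t ht => Submodule.subset_span (.map σ ht)
    exact h hx

end FreeOperad

/-- The operad `Ope(G, R) = Free_G / (R)`. -/
def Ope.{v, u} {K : Type v} [Field K] (G : LinSpecies.{v, u} K)
    (R : (freeOperad G).toLinSpecies.Sub) : Operad.{v, max 1 u v} K :=
  (freeOperad G).quotient R

/-- `Ope(G, R)` is quadratic: all relations in `R` are combinations of trees with two internal
nodes. -/
def IsQuadratic.{v, u} {K : Type v} [Field K] (G : LinSpecies.{v, u} K)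
    (R : (freeOperad G).toLinSpecies.Sub) : Prop :=
  ∀ (V : Type) [Finite V], R.carrier V ≤ (FreeOperad.weight G 2).carrier V

/-! ### Koszul duality for binary quadratic operads -/

namespace Koszul

/-- For binary `G` and a set `V = {a, b, c}` with an ordering, the quadratic trees in `Free_G[V]` are
`⨁ G[{*, a}] ⊗ G[{b, c}]`, the sum running over the three choices of `a ∈ V`; here the summand
of index `i` is the one with `a = o i`, `b = o (i + 1)`, `c = o (i + 2)`. -/
abbrev Quad.{v, u} {K : Type v} [Field K] (G : LinSpecies.{v, u} K) : Type u :=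
  Fin 3 → G.obj (Option Unit) ⊗[K] G.obj (Fin 2)

/-- The tree `x ∘_* y` with `x ∈ G[{*, a}]`, `y ∈ G[{b, c}]`, where `a = o i`, `b = o (i + 1)`,
`c = o (i + 2)`. -/
def tree.{v, u} {K : Type v} [Field K] (G : LinSpecies.{v, u} K) {V : Type} [Finite V]
    (o : Fin 3 ≃ V) (i : Fin 3) :
    G.obj (Option Unit) →ₗ[K] G.obj (Fin 2) →ₗ[K] (freeOperad G).obj V :=
  ((freeOperad G).comp.compl₁₂ (FreeOperad.ι G (Option Unit)) (FreeOperad.ι G (Fin 2))).compr₂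
    ((freeOperad G).map (Relabel.slot o i))

/-- The identification of `Quad G` with the quadratic trees on `V`. -/
def toFree.{v, u} {K : Type v} [Field K] (G : LinSpecies.{v, u} K) {V : Type} [Finite V]
    (o : Fin 3 ≃ V) : Quad G →ₗ[K] (freeOperad G).obj V :=
  ∑ i : Fin 3, TensorProduct.lift (tree G o i) ∘ₗ LinearMap.proj i

/-- Evaluation of an element of `G^∨[V]` with respect to an ordering of `V`. -/
def eval.{v, u} {K : Type v} [Field K] (G : LinSpecies.{v, u} K) {V : Type} [Finite V] {n : ℕ}
    (o : Fin n ≃ V) : G.dual.obj V →ₗ[K] Module.Dual K (G.obj V) where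
  toFun φ := φ.1 n o
  map_add' _ _ := rfl
  map_smul' _ _ := rfl

/-- The pairing `⟨f₁ ∘_* f₂, x₁ ∘_* x₂⟩ = f₁(x₁) f₂(x₂)`; trees in which the leaf attached to the
root differs are orthogonal. The forms `f₁ ∈ G^∨[{*, a}]` and `f₂ ∈ G^∨[{b, c}]` are evaluated
along the orderings `(*, a)` and `(b, c)`, where `(a, b, c)` is a cyclic rotation of the ordering
of `V`. (Another ordering of `V` changes the pairing at most by a global sign.) -/
def pairing.{v, u} {K : Type v} [Field K] (G : LinSpecies.{v, u} K) :
    Quad G.dual →ₗ[K] Module.Dual K (Quad G) :=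
  ∑ i : Fin 3, (LinearMap.lcomp K K (LinearMap.proj i)) ∘ₗ
    (TensorProduct.dualDistrib K (G.obj (Option Unit)) (G.obj (Fin 2))) ∘ₗ
    (TensorProduct.map (eval G Relabel.pair) (eval G (Equiv.refl (Fin 2)))) ∘ₗ
    (LinearMap.proj i)

/-- The quadratic trees on `V` decorated by `G^∨` that are orthogonal to `R[V]`. -/
def orthogonalAt.{v, u} {K : Type v} [Field K] (G : LinSpecies.{v, u} K)
    (R : (freeOperad G).toLinSpecies.Sub) {V : Type} [Finite V] (o : Fin 3 ≃ V) :
    Submodule K (Quad G.dual) where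
  carrier := {f | ∀ x : Quad G, toFree G o x ∈ R.carrier V → pairing G f x = 0}
  add_mem' hf hg x hx := by rw [map_add, LinearMap.add_apply, hf x hx, hg x hx, add_zero]
  zero_mem' x _ := by rw [map_zero, LinearMap.zero_apply]
  smul_mem' c f hf x hx := by rw [map_smul, LinearMap.smul_apply, hf x hx, smul_zero]

theorem map_toFree.{v, u} {K : Type v} [Field K] (G : LinSpecies.{v, u} K) {V W : Type} [Finite V]
    [Finite W] (o : Fin 3 ≃ V) (σ : V ≃ W) (x : Quad G) :
    (freeOperad G).map σ (toFree G o x) = toFree G (o.trans σ) x := by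
  have hi : ∀ i : Fin 3, (freeOperad G).map σ ∘ₗ TensorProduct.lift (tree G o i) =
      TensorProduct.lift (tree G (o.trans σ) i) := by
    intro i
    apply TensorProduct.ext'
    intro y z
    exact ((freeOperad G).map_trans (Relabel.slot o i) σ
      ((freeOperad G).comp (FreeOperad.ι G (Option Unit) y) (FreeOperad.ι G (Fin 2) z))).symm
  simp only [toFree, LinearMap.sum_apply, map_sum]
  exact Finset.sum_congr rfl fun i _ => LinearMap.congr_fun (hi i) (x i)

/-- The orthogonal `R^⊥` of `R`, a subspecies of the quadratic part of `Free_{G^∨}`. It is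
concentrated in cardinality three. -/
def orthogonal.{v, u} {K : Type v} [Field K] (G : LinSpecies.{v, u} K)
    (R : (freeOperad G).toLinSpecies.Sub) : (freeOperad G.dual).toLinSpecies.Sub where
  carrier V _ := ⨆ o : Fin 3 ≃ V, (orthogonalAt G R o).map (toFree G.dual o)
  map_mem {V W} _ _ σ x hx := by
    have h : (⨆ o : Fin 3 ≃ V, (orthogonalAt G R o).map (toFree G.dual o)) ≤
        (⨆ o : Fin 3 ≃ W, (orthogonalAt G R o).map (toFree G.dual o)).comap
          ((freeOperad G.dual).map σ) := by
      refine iSup_le fun o => ?_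
      rintro _ ⟨f, hf, rfl⟩
      refine Submodule.mem_iSup_of_mem (o.trans σ) ⟨f, fun x hx => hf x ?_, ?_⟩
      · have h := R.map_mem σ.symm hx
        rwa [map_toFree, Equiv.trans_assoc, Equiv.self_trans_symm, Equiv.trans_refl] at h
      · rw [map_toFree]
    exact h hx

end Koszul

/-- The Koszul dual `Ope(G^∨, R^⊥)` of the binary quadratic operad `Ope(G, R)`. -/
def koszulDual.{v, u} {K : Type v} [Field K] (G : LinSpecies.{v, u} K)
    (R : (freeOperad G).toLinSpecies.Sub) : Operad.{v, max 1 u v} K :=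
  Ope G.dual (Koszul.orthogonal G R)

/-! ### The operad of graphs -/

namespace GraphOperad

/-- The graph on `A ⊔ {*}` obtained from a graph on `A ⊔ B` by contracting `B` to the vertex `*`. -/
def contract {A B : Type} (h : SimpleGraph (A ⊕ B)) : SimpleGraph (Option A) where
  Adj
    | some a, some a' => h.Adj (.inl a) (.inl a')
    | some a, none => ∃ b, h.Adj (.inl a) (.inr b)
    | none, some a => ∃ b, h.Adj (.inl a) (.inr b)
    | none, none => False
  symm := ⟨by rintro (_ | a) (_ | a') hh <;> first | exact hh | exact SimpleGraph.Adj.symm hh⟩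
  loopless := ⟨by
    rintro (_ | a) hh
    · exact hh
    · exact SimpleGraph.irrefl h hh⟩

/-- Every vertex of `A` has at most one neighbour in `B`. -/
def AtMostOne {A B : Type} (h : SimpleGraph (A ⊕ B)) : Prop :=
  ∀ (a : A) (b b' : B), h.Adj (.inl a) (.inr b) → h.Adj (.inl a) (.inr b') → b = b'

/-- The linear species `𝕂G` of graphs on nonempty finite sets. Since `V` is finite, the vector space
spanned by the graphs on `V` is the space of all functions on the set of these graphs; the
function `f` stands for the linear combination `∑ f(g) g`. -/
def species.{v} (K : Type v) [Field K] : LinSpecies.{v, v} K where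
  obj V _ :=
    ({ carrier := {f | IsEmpty V → f = 0}
       add_mem' := fun hf hg h => by rw [hf h, hg h, add_zero]
       zero_mem' := fun _ => rfl
       smul_mem' := fun c f hf h => by rw [hf h, smul_zero] } : Submodule K (SimpleGraph V → K))
  map {V W} _ _ σ :=
    { toFun := fun f => ⟨fun g => f.1 (g.comap σ), fun h => by
        rw [f.2 (σ.isEmpty_congr.2 h)]; rfl⟩
      map_add' := fun _ _ => rfl
      map_smul' := fun _ _ => rfl }
  map_refl _ := rfl
  map_trans _ _ _ := rfl
  positive V _ h := ⟨fun f g => Subtype.ext ((f.2 h).trans (g.2 h).symm)⟩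

open Classical in
/-- The graph `g`, as an element of `𝕂G[V]`. -/
def basis.{v} (K : Type v) [Field K] {V : Type} [Finite V] [Nonempty V] (g : SimpleGraph V) :
    (species K).obj V :=
  ⟨Pi.single g 1, fun h => (not_isEmpty_of_nonempty V h).elim⟩

open Classical in
/-- The insertion of graphs. A graph `h` on `A ⊔ B` is a term of `g₁ ∘_* g₂` exactly if its
restriction to `B` is `g₂`, the contraction of `B` to the vertex `*` gives `g₁`, and no vertex of
`A` has two neighbours in `B`. See `comp_basis` for the formulation as the sum over all ways to
connect the loose ends. -/
def comp.{v} (K : Type v) [Field K] {A B : Type} [Finite A] [Finite B] :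
    (species K).obj (Option A) →ₗ[K] (species K).obj B →ₗ[K] (species K).obj (A ⊕ B) :=
  LinearMap.mk₂ K
    (fun x y => ⟨fun h => if AtMostOne h then x.1 (contract h) * y.1 (h.comap Sum.inr) else 0,
      fun he => by
        funext h
        have hy : y.1 = 0 := y.2 ⟨fun b => he.elim (.inr b)⟩
        simp [hy]⟩)
    (fun x x₁ y => by
      apply Subtype.ext; funext h
      change ite _ ((x.1 _ + x₁.1 _) * _) _ = ite _ _ _ + ite _ _ _
      split_ifs <;> ring)
    (fun c x y => by
      apply Subtype.ext; funext h
      change ite _ ((c * x.1 _) * _) _ = c * ite _ _ _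
      split_ifs <;> ring)
    (fun x y y₁ => by
      apply Subtype.ext; funext h
      change ite _ (_ * (y.1 _ + y₁.1 _)) _ = ite _ _ _ + ite _ _ _
      split_ifs <;> ring)
    (fun c x y => by
      apply Subtype.ext; funext h
      change ite _ (_ * (c * y.1 _)) _ = c * ite _ _ _
      split_ifs <;> ring)

open Classical in
theorem comp_apply.{v} (K : Type v) [Field K] {A B : Type} [Finite A] [Finite B]
    (x : (species K).obj (Option A)) (y : (species K).obj B) (h : SimpleGraph (A ⊕ B)) :
    (comp K x y).1 h =
      if AtMostOne h then x.1 (contract h) * y.1 (h.comap Sum.inr) else 0 := rfl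

/-- The coefficient of the graph `g`. -/
def coeff.{v} (K : Type v) [Field K] {V : Type} [Finite V] (g : SimpleGraph V) :
    (species K).obj V →ₗ[K] K where
  toFun f := f.1 g
  map_add' _ _ := rfl
  map_smul' _ _ := rfl

theorem map_apply.{v} (K : Type v) [Field K] {V W : Type} [Finite V] [Finite W] (σ : V ≃ W)
    (x : (species K).obj V) (g : SimpleGraph W) :
    ((species K).map σ x).1 g = x.1 (g.comap σ) := rfl

/-- The graph obtained from the disjoint union of `g₁` and `g₂` by removing the vertex `*` and
connecting the loose end of the edge between `a` and `*` to the vertex `f a` of `g₂`, for every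
neighbour `a` of `*`. -/
def insertion {A B : Type} (g₁ : SimpleGraph (Option A)) (g₂ : SimpleGraph B)
    (f : {a : A // g₁.Adj (some a) none} → B) : SimpleGraph (A ⊕ B) where
  Adj
    | .inl a, .inl a' => g₁.Adj (some a) (some a')
    | .inr b, .inr b' => g₂.Adj b b'
    | .inl a, .inr b => ∃ h : g₁.Adj (some a) none, f ⟨a, h⟩ = b
    | .inr b, .inl a => ∃ h : g₁.Adj (some a) none, f ⟨a, h⟩ = b
  symm := ⟨by
    rintro (a | b) (a' | b') hh <;> first | exact hh | exact SimpleGraph.Adj.symm hh⟩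
  loopless := ⟨by
    rintro (a | b) hh
    · exact SimpleGraph.irrefl g₁ hh
    · exact SimpleGraph.irrefl g₂ hh⟩

theorem exists_insertion_iff {A B : Type} (g₁ : SimpleGraph (Option A)) (g₂ : SimpleGraph B)
    (h : SimpleGraph (A ⊕ B)) :
    (∃ f, insertion g₁ g₂ f = h) ↔ AtMostOne h ∧ contract h = g₁ ∧ h.comap Sum.inr = g₂ := by
  constructor
  · rintro ⟨f, rfl⟩
    refine ⟨?_, ?_, ?_⟩
    · rintro a b b' ⟨_, hb⟩ ⟨_, hb'⟩
      exact hb.symm.trans hb'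
    · ext p q
      rcases p with _ | a <;> rcases q with _ | a'
      · exact ⟨fun hh => hh.elim, fun hh => (SimpleGraph.irrefl g₁ hh).elim⟩
      · exact ⟨fun ⟨_, hh, _⟩ => hh.symm, fun hh => ⟨_, hh.symm, rfl⟩⟩
      · exact ⟨fun ⟨_, hh, _⟩ => hh, fun hh => ⟨_, hh, rfl⟩⟩
      · exact Iff.rfl
    · ext b b'
      exact Iff.rfl
  · rintro ⟨hu, rfl, rfl⟩
    refine ⟨fun a => a.2.choose, ?_⟩
    have key : ∀ a b, (∃ hh : (contract h).Adj (some a) none,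
        Exists.choose (p := fun b => h.Adj (.inl a) (.inr b)) hh = b) ↔
          h.Adj (.inl a) (.inr b) := by
      intro a b
      constructor
      · rintro ⟨hh, rfl⟩
        exact Exists.choose_spec (p := fun b => h.Adj (.inl a) (.inr b)) hh
      · intro hb
        exact ⟨⟨b, hb⟩, hu a _ _
          (Exists.choose_spec (p := fun b => h.Adj (.inl a) (.inr b)) ⟨b, hb⟩) hb⟩
    ext p q
    rcases p with a | b <;> rcases q with a' | b'
    · exact Iff.rfl
    · exact key a b'
    · exact (key a' b).trans (SimpleGraph.adj_comm _ _ _)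
    · exact Iff.rfl

theorem insertion_injective {A B : Type} (g₁ : SimpleGraph (Option A)) (g₂ : SimpleGraph B) :
    Function.Injective (insertion g₁ g₂) := by
  intro f f₁ hf
  funext ⟨a, ha⟩
  have h : (insertion g₁ g₂ f).Adj (.inl a) (.inr (f ⟨a, ha⟩)) := ⟨ha, rfl⟩
  rw [hf] at h
  exact h.2.symm

open Classical in
/-- `g₁ ∘_* g₂` is the sum of all the graphs obtained by removing the vertex `*` and connecting each
loose end to any vertex of `g₂`. -/
theorem comp_basis.{v} (K : Type v) [Field K] {A B : Type} [Finite A] [Finite B] [Nonempty B]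
    (g₁ : SimpleGraph (Option A)) (g₂ : SimpleGraph B) :
    comp K (basis K g₁) (basis K g₂) =
      ∑ᶠ f : {a : A // g₁.Adj (some a) none} → B, basis K (insertion g₁ g₂ f) := by
  have := Fintype.ofFinite ({a : A // g₁.Adj (some a) none} → B)
  rw [finsum_eq_sum_of_fintype]
  apply Subtype.ext
  funext h
  have hs : (∑ f, basis K (insertion g₁ g₂ f)).1 h =
      ∑ f, if insertion g₁ g₂ f = h then (1 : K) else 0 := by
    change coeff K h (∑ f, basis K (insertion g₁ g₂ f)) = _
    rw [map_sum]
    refine Finset.sum_congr rfl fun f _ => ?_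
    change (Pi.single (insertion g₁ g₂ f) (1 : K) : SimpleGraph (A ⊕ B) → K) h = _
    rw [Pi.single_apply]
    simp only [eq_comm]
  rw [hs, comp_apply]
  by_cases hh : ∃ f, insertion g₁ g₂ f = h
  · obtain ⟨h1, h2, h3⟩ := (exists_insertion_iff g₁ g₂ h).1 hh
    obtain ⟨f, rfl⟩ := hh
    rw [if_pos h1, h2, h3]
    simp [basis, (insertion_injective g₁ g₂).eq_iff]
  · rw [Finset.sum_eq_zero fun f _ => if_neg fun hf => hh ⟨f, hf⟩]
    rw [exists_insertion_iff] at hh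
    by_cases h1 : AtMostOne h
    · rw [if_pos h1]
      by_cases h2 : contract h = g₁
      · have h3 : h.comap Sum.inr ≠ g₂ := fun h3 => hh ⟨h1, h2, h3⟩
        simp [basis, Pi.single_apply, h3]
      · simp [basis, Pi.single_apply, h2]
    · rw [if_neg h1]

theorem nested_left.{v} {K : Type v} [Field K] {p q : Prop} [Decidable p] [Decidable q] (a b : K) :
    (if p then (if q then a else 0) * b else 0) = if p ∧ q then a * b else 0 := by
  by_cases hp : p <;> by_cases hq : q <;> simp [hp, hq]

theorem nested_right.{v} {K : Type v} [Field K] {p q : Prop} [Decidable p] [Decidable q] (a b : K) :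
    (if p then a * (if q then b else 0) else 0) = if p ∧ q then a * b else 0 := by
  by_cases hp : p <;> by_cases hq : q <;> simp [hp, hq]

end GraphOperad

open GraphOperad in
/-- The operad `𝕂G` of graphs. -/
def graphOperad.{v} (K : Type v) [Field K] : Operad.{v, v} K where
  toLinSpecies := species K
  one := basis K ⊥
  comp := comp K
  comp_map {A A₁ B B₁} _ _ _ _ σ τ x y := by
    classical
    apply Subtype.ext; funext h
    rw [map_apply, comp_apply, comp_apply, map_apply, map_apply]
    have h1 : (contract h).comap (Equiv.optionCongr σ) =
        contract (h.comap (Equiv.sumCongr σ τ)) := by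
      have hc : ∀ a : A, (∃ b, h.Adj (.inl (σ a)) (.inr b)) ↔
          ∃ b, h.Adj (.inl (σ a)) (.inr (τ b)) := fun a =>
        ⟨fun ⟨b, hb⟩ => ⟨τ.symm b, by rwa [Equiv.apply_symm_apply]⟩, fun ⟨b, hb⟩ => ⟨_, hb⟩⟩
      ext p q
      rcases p with _ | a <;> rcases q with _ | a'
      · exact Iff.rfl
      · exact hc a'
      · exact hc a
      · exact Iff.rfl
    have h2 : AtMostOne h ↔ AtMostOne (h.comap (Equiv.sumCongr σ τ)) := by
      constructor
      · intro hu a b b' hb hb'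
        exact τ.injective (hu (σ a) _ _ hb hb')
      · intro hu a b b' hb hb'
        have := hu (σ.symm a) (τ.symm b) (τ.symm b') (by simpa using hb) (by simpa using hb')
        exact τ.symm.injective this
    rw [h1]
    exact if_congr h2 rfl rfl
  comp_par {A B C} _ _ _ x y z := by
    classical
    apply Subtype.ext; funext h
    rw [map_apply, comp_apply, comp_apply, map_apply, map_apply, comp_apply, comp_apply, map_apply]
    set g := (contract h).comap (Relabel.optionLeft A B) with hg
    set h' := h.comap (Relabel.rightComm A B C) with hh'
    set g' := (contract h').comap (Relabel.optionLeft A C) with hg'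
    have e1 : contract g = (contract g').comap (Relabel.swapPoints A) := by
      ext p q
      rcases p with _ | _ | a <;> rcases q with _ | _ | a'
      · exact Iff.rfl
      · exact ⟨fun ⟨b, c, hb⟩ => ⟨c, b, hb.symm⟩, fun ⟨c, b, hb⟩ => ⟨b, c, hb.symm⟩⟩
      · exact Iff.rfl
      · exact ⟨fun ⟨b, c, hb⟩ => ⟨c, b, hb.symm⟩, fun ⟨c, b, hb⟩ => ⟨b, c, hb.symm⟩⟩
      · exact ⟨fun hh => (SimpleGraph.irrefl _ hh).elim, fun hh => (SimpleGraph.irrefl _ hh).elim⟩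
      · exact Iff.rfl
      · exact Iff.rfl
      · exact Iff.rfl
      · exact Iff.rfl
    have e2 : g.comap Sum.inr = h'.comap Sum.inr := rfl
    have e3 : h.comap Sum.inr = g'.comap Sum.inr := rfl
    have e4 : (AtMostOne h ∧ AtMostOne g) ↔ (AtMostOne h' ∧ AtMostOne g') := by
      constructor
      · rintro ⟨u1, u2⟩
        refine ⟨?_, ?_⟩
        · rintro (a | c) b b' hb hb'
          · exact u2 (some a) b b' hb hb'
          · exact u2 none b b' ⟨c, hb.symm⟩ ⟨c, hb'.symm⟩
        · rintro (_ | a) c c' hc hc'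
          · obtain ⟨b, hb⟩ := hc
            obtain ⟨b', hb'⟩ := hc'
            obtain rfl := u2 none b b' ⟨c, hb.symm⟩ ⟨c', hb'.symm⟩
            exact u1 (.inr b) c c' hb.symm hb'.symm
          · exact u1 (.inl a) c c' hc hc'
      · rintro ⟨u1, u2⟩
        refine ⟨?_, ?_⟩
        · rintro (a | b) c c' hc hc'
          · exact u2 (some a) c c' hc hc'
          · exact u2 none c c' ⟨b, hc.symm⟩ ⟨b, hc'.symm⟩
        · rintro (_ | a) b b' hb hb'
          · obtain ⟨c, hc⟩ := hb
            obtain ⟨c', hc'⟩ := hb'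
            obtain rfl := u2 none c c' ⟨b, hc.symm⟩ ⟨b', hc'.symm⟩
            exact u1 (.inr c) b b' hc.symm hc'.symm
          · exact u1 (.inl a) b b' hb hb'
    rw [e1, e2, e3]
    rw [nested_left, nested_left]
    exact if_congr e4 (mul_right_comm _ _ _) rfl
  comp_seq {A B C} _ _ _ x y z := by
    classical
    apply Subtype.ext; funext h
    rw [map_apply, comp_apply, comp_apply, map_apply, comp_apply, comp_apply]
    set h' := h.comap (Equiv.sumAssoc A B C) with hh'
    set g := (contract h').comap (Relabel.optionRight A B) with hg
    set k := h.comap (Sum.inr : B ⊕ C → A ⊕ (B ⊕ C)) with hk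
    have e1 : contract g = contract h := by
      have hc : ∀ a : A, (∃ b : Option B, g.Adj (.inl a) (.inr b)) ↔
          ∃ b, h.Adj (.inl a) (.inr b) := by
        intro a
        constructor
        · rintro ⟨_ | b, hb⟩
          · obtain ⟨c, hc⟩ := hb
            exact ⟨.inr c, hc⟩
          · exact ⟨.inl b, hb⟩
        · rintro ⟨b | c, hb⟩
          · exact ⟨some b, hb⟩
          · exact ⟨none, c, hb⟩
      ext p q
      rcases p with _ | a <;> rcases q with _ | a'
      · exact Iff.rfl
      · exact hc a'
      · exact hc a
      · exact Iff.rfl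
    have e2 : g.comap Sum.inr = contract k := by
      ext p q
      rcases p with _ | a <;> rcases q with _ | a' <;> exact Iff.rfl
    have e3 : h'.comap Sum.inr = k.comap Sum.inr := rfl
    have e4 : (AtMostOne h' ∧ AtMostOne g) ↔ (AtMostOne h ∧ AtMostOne k) := by
      constructor
      · rintro ⟨u1, u2⟩
        refine ⟨?_, ?_⟩
        · rintro a (b | c) (b' | c') hb hb'
          · exact congrArg _ (Option.some.inj (u2 a (some b) (some b') hb hb'))
          · exact absurd (u2 a (some b) none hb ⟨c', hb'⟩) (Option.some_ne_none b)
          · exact absurd (u2 a (some b') none hb' ⟨c, hb⟩) (Option.some_ne_none b')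
          · exact congrArg _ (u1 (.inl a) c c' hb hb')
        · intro b c c' hc hc'
          exact u1 (.inr b) c c' hc hc'
      · rintro ⟨u1, u2⟩
        refine ⟨?_, ?_⟩
        · rintro (a | b) c c' hc hc'
          · exact Sum.inr_injective (u1 a (.inr c) (.inr c') hc hc')
          · exact u2 b c c' hc hc'
        · rintro a (_ | b) (_ | b') hb hb'
          · rfl
          · obtain ⟨c, hc⟩ := hb
            exact absurd (u1 a (.inr c) (.inl b') hc hb') Sum.inr_ne_inl
          · obtain ⟨c, hc⟩ := hb'
            exact absurd (u1 a (.inr c) (.inl b) hc hb) Sum.inr_ne_inl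
          · exact congrArg _ (Sum.inl_injective (u1 a (.inl b) (.inl b') hb hb'))
    rw [e1, e2, e3]
    rw [nested_left, nested_right]
    exact if_congr e4 (mul_assoc _ _ _) rfl
  comp_one {A} _ x := by
    classical
    apply Subtype.ext; funext h
    rw [map_apply, comp_apply]
    have e1 : AtMostOne (h.comap (Relabel.addPoint A)) := fun _ _ _ _ _ => rfl
    have e2 : contract (h.comap (Relabel.addPoint A)) = h := by
      ext p q
      rcases p with _ | a <;> rcases q with _ | a'
      · exact ⟨fun hh => hh.elim, fun hh => SimpleGraph.irrefl h hh⟩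
      · exact ⟨fun ⟨_, hh⟩ => hh.symm, fun hh => ⟨(), hh.symm⟩⟩
      · exact ⟨fun ⟨_, hh⟩ => hh, fun hh => ⟨(), hh⟩⟩
      · exact Iff.rfl
    rw [if_pos e1, e2, Subsingleton.elim ((h.comap (Relabel.addPoint A)).comap Sum.inr) ⊥]
    simp [basis]
  one_comp {B} _ y := by
    classical
    apply Subtype.ext; funext h
    rw [map_apply, comp_apply, map_apply]
    have e1 : AtMostOne (h.comap (Equiv.emptySum Empty B)) := fun a => a.elim
    rw [if_pos e1, Subsingleton.elim (SimpleGraph.comap _ (contract _)) ⊥]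
    simp only [basis, Pi.single_eq_same, one_mul]
    rfl

/-! ### The operad `SP` and its presentation -/

namespace SP

/-- The graph on `{0, 1}` without edges. -/
def points.{v} (K : Type v) [Field K] : (graphOperad K).obj (Fin 2) := GraphOperad.basis K ⊥

/-- The graph on `{0, 1}` with one edge. -/
def segment.{v} (K : Type v) [Field K] : (graphOperad K).obj (Fin 2) := GraphOperad.basis K ⊤

/-- The subspecies of `𝕂G` generated by the two graphs on two vertices. -/
def generators.{v} (K : Type v) [Field K] : (graphOperad K).toLinSpecies.Sub :=
  (graphOperad K).toLinSpecies.generate {points K, segment K}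

/-- The suboperad `SP` of `𝕂G` generated by the two graphs on two vertices. -/
def operad.{v} (K : Type v) [Field K] : Operad.{v, v} K :=
  (graphOperad K).suboperad (generators K)

/-- The species `G` of generators. -/
abbrev gens.{v} (K : Type v) [Field K] : LinSpecies.{v, v} K := (generators K).toSpecies

/-- The edgeless graph with vertex set `V ≃ {0, 1}`, as an element of `G[V]`. -/
def P.{v} (K : Type v) [Field K] {V : Type} [Finite V] (σ : Fin 2 ≃ V) : (gens K).obj V :=
  ⟨(graphOperad K).map σ (points K), Submodule.subset_span ⟨σ, points K, Or.inl rfl, rfl⟩⟩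

/-- The graph with one edge and vertex set `V ≃ {0, 1}`, as an element of `G[V]`. -/
def S.{v} (K : Type v) [Field K] {V : Type} [Finite V] (σ : Fin 2 ≃ V) : (gens K).obj V :=
  ⟨(graphOperad K).map σ (segment K), Submodule.subset_span ⟨σ, segment K, Or.inr rfl, rfl⟩⟩

/-- The tree `x ∘_* y` in `Free_G[{0, 1, 2}]`, where the root `x` has the leaves `*` and `i`, and `y`
has the two other leaves. -/
def tree.{v} (K : Type v) [Field K] (i : Fin 3) (x : (gens K).obj (Option Unit))
    (y : (gens K).obj (Fin 2)) : (freeOperad (gens K)).obj (Fin 3) :=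
  Koszul.tree (gens K) (Equiv.refl (Fin 3)) i x y

/-- With `a, b, c = 0, 1, 2`, the relation `P{c,*} ∘ P{a,b} - P{a,*} ∘ P{b,c}`. -/
def relation₁.{v} (K : Type v) [Field K] : (freeOperad (gens K)).obj (Fin 3) :=
  tree K 2 (P K Relabel.pair) (P K (Equiv.refl _)) -
    tree K 0 (P K Relabel.pair) (P K (Equiv.refl _))

/-- With `a, b, c = 0, 1, 2`, the relation
`S{a,*} ∘ P{b,c} - P{c,*} ∘ S{a,b} - P{b,*} ∘ S{a,c}`. -/
def relation₂.{v} (K : Type v) [Field K] : (freeOperad (gens K)).obj (Fin 3) :=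
  tree K 0 (S K Relabel.pair) (P K (Equiv.refl _)) -
    tree K 2 (P K Relabel.pair) (S K (Equiv.refl _)) -
    tree K 1 (P K Relabel.pair) (S K (Equiv.refl _))

/-- The subspecies `R` of `Free_G` generated by the two relations. -/
def relations.{v} (K : Type v) [Field K] : (freeOperad (gens K)).toLinSpecies.Sub :=
  (freeOperad (gens K)).toLinSpecies.generate {relation₁ K, relation₂ K}

/-- The Koszul dual of `SP`, formed from the presentation `Ope(G, R)` of `SP`. -/
def dual.{v} (K : Type v) [Field K] : Operad.{v, max 1 v} K :=
  koszulDual (gens K) (relations K)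

end SP

end

/-! Both halves take place in the twisted algebra of an operad `O`, the direct sum of the spaces
`O[B]` over the finite sets `B` of labels. There binary operations become bilinear products, and
quadratic relations become identities between triple products (`Operad.gmul_relation`).

Presentation. In `Ope(G, R)` the class of P is a commutative associative product and the class of S
is a commutative biderivation of it. Pushing S inside P shows that the products of S-trees, that is,
the forests of non-planar binary trees, span (`SP.forestSpan_eq_top`). The morphism to SP is onto
because SP is generated by the same two graphs. It is injective because the images of the forests in
`𝕂G` are independent. To see this, give every ordered pair of vertices a weight, and sum the weights
of the graphs in a linear combination. As a function of the weights this total determines the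
combination (`GraphOperad.eq_zero_of_total`). The total of a tree is the product over its nodes of
the sum of `w i j * w j i` across the node, and the total of a forest is the product over its trees.

The core is the independence of these products for trees on a fixed set of leaves
(`CTree.treesIndependent`). A tree containing `v` is a word of trees hung successively onto the leaf
`v`; let `c` be the coefficients of a linear relation, as a function on words. If the weights
between two parts of the other leaves are set to zero, the weight of a word factors, and by
induction `c` vanishes on proper shuffles. If `v` is linked to a single leaf `u`, the weights of
words become weights of trees without `v`, and by induction the sums of `c` over all ways of joining
an initial segment of a word starting with `u` vanish. By descending induction on the length, the
second condition makes `c` symmetric in the first two letters. A function that vanishes on proper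
shuffles and has this symmetry satisfies `r * c z = 0` for words `z` of length `r ≥ 2`, so it is
zero there in characteristic zero (`CTree.eq_zero_of_shuffleSum_of_joinSum`).

Koszul dual. Solving the orthogonality equations gives two antisymmetric operations: a Lie bracket
`ℓ`, and an operation `m` of which `ℓ` is a derivation and whose iterates `m (m a b) c` vanish
(`IsDualPair`). Hence everything is a combination of right-normed brackets `[w, v]` and of elements
`m([w, v], [w', c])`. These are independent, since they remain so in `L × (L ⊗ L)` for the free
associative algebra `L` with its commutator, where they are detected by words with a prescribed last
letter. In arity `n + 1` there are `n!` brackets, and `n! / k` elements of the second kind whose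
second factor has `k` arguments. So the dual has the size of Lie plus its exterior square, with
series `L + L² / 2` for `L = -log(1 - x)`. Koszulness plays no role. -/

noncomputable section

/-! ### Morphisms of operads -/

namespace Operad

/-- A morphism of operads. -/
structure Hom.{v, u, w} {K : Type v} [Field K] (O : Operad.{v, u} K) (P : Operad.{v, w} K) where
  app : ∀ (V : Type) [Finite V], O.obj V →ₗ[K] P.obj V
  app_map : ∀ {V W : Type} [Finite V] [Finite W] (σ : V ≃ W) (x : O.obj V),
    app W (O.map σ x) = P.map σ (app V x)
  app_one : app Unit O.one = P.one
  app_comp : ∀ {A B : Type} [Finite A] [Finite B] (x : O.obj (Option A)) (y : O.obj B),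
    app (A ⊕ B) (O.comp x y) = P.comp (app (Option A) x) (app B y)

variable {K : Type*} [Field K]

/-- The projection of an operad to its quotient by an ideal. -/
def quotientHom (O : Operad K) (R : O.toLinSpecies.Sub) : Hom O (O.quotient R) where
  app V _ := Submodule.mkQ ((O.ideal R).carrier V)
  app_map _ _ := rfl
  app_one := rfl
  app_comp _ _ := rfl

theorem quotientHom_surjective (O : Operad K) (R : O.toLinSpecies.Sub) (V : Type) [Finite V] :
    Function.Surjective ((O.quotientHom R).app V) :=
  Submodule.mkQ_surjective _

namespace Hom

/-- The kernel of a morphism contains the ideal generated by any subspecies that is sent to zero. -/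
theorem app_eq_zero_of_idealMem {O P : Operad K} (φ : Hom O P) (R : O.toLinSpecies.Sub)
    (hR : ∀ (V : Type) [Finite V], ∀ x ∈ R.carrier V, φ.app V x = 0) {V : Type} [Finite V]
    {x : O.obj V} (hx : IdealMem O R V x) : φ.app V x = 0 := by
  induction hx with
  | of h => exact hR _ _ h
  | zero => exact map_zero _
  | add _ _ h1 h2 => rw [map_add, h1, h2, add_zero]
  | smul c _ h => rw [map_smul, h, smul_zero]
  | map σ _ h => rw [φ.app_map, h, map_zero]
  | comp_left y _ h => rw [φ.app_comp, h, map_zero, LinearMap.zero_apply]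
  | comp_right x _ h => rw [φ.app_comp, h, map_zero]

/-- The morphism induced on a quotient operad. -/
def quotientLift {O P : Operad K} (φ : Hom O P) (R : O.toLinSpecies.Sub)
    (hR : ∀ (V : Type) [Finite V], ∀ x ∈ R.carrier V, φ.app V x = 0) :
    Hom (O.quotient R) P where
  app V _ := Submodule.liftQ _ (φ.app V) fun _ hx => φ.app_eq_zero_of_idealMem R hR hx
  app_map σ x := by
    induction x using Submodule.Quotient.induction_on with
    | H x => exact φ.app_map σ x
  app_one := φ.app_one
  app_comp x y := by
    induction x using Submodule.Quotient.induction_on with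
    | H x =>
      induction y using Submodule.Quotient.induction_on with
      | H y => exact φ.app_comp x y

end Hom

end Operad

namespace FreeOperad

variable {K : Type*} [Field K]

/-- The value of a formal expression under a family of linear maps on the generators. -/
def Pre.eval {G : LinSpecies K} (P : Operad K)
    (φ : ∀ (V : Type) [Finite V], G.obj V →ₗ[K] P.obj V) :
    ∀ {V : Type}, Pre G V → ∀ [Finite V], P.obj V
  | _, .zero, _ => 0
  | _, .add x y, _ => Pre.eval P φ x + Pre.eval P φ y
  | _, .smul c x, _ => c • Pre.eval P φ x
  | V, @Pre.of _ _ _ _ _ x, hV => @φ V hV x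
  | _, @Pre.map _ _ _ _ _ _ _ σ x, _ => P.map σ (Pre.eval P φ x)
  | _, .one, _ => P.one
  | _, @Pre.comp _ _ _ _ _ _ _ x y, _ => P.comp (Pre.eval P φ x) (Pre.eval P φ y)

/-- Every rule of the congruence is either an axiom that holds in `P` or the naturality `hφ`, so
values descend to the free operad. -/
theorem Rel.eval_eq {G : LinSpecies K} (P : Operad K)
    (φ : ∀ (V : Type) [Finite V], G.obj V →ₗ[K] P.obj V)
    (hφ : ∀ {V W : Type} [Finite V] [Finite W] (σ : V ≃ W) (x : G.obj V),
      φ W (G.map σ x) = P.map σ (φ V x))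
    {V : Type} {x y : Pre G V} (h : Rel G x y) [hV : Finite V] :
    Pre.eval P φ x = Pre.eval P φ y := by
  -- The index type of `Pre` carries no finiteness, so the instance has to vary along the induction.
  revert hV
  induction h with
  | refl x => intro; rfl
  | symm _ h => intro; exact h.symm
  | trans _ _ h1 h2 => intro; exact h1.trans h2
  | add_congr _ _ h1 h2 => intro; simp only [Pre.eval, h1, h2]
  | smul_congr c _ h => intro; simp only [Pre.eval, h]
  | map_congr σ _ h => intro; simp only [Pre.eval, h]
  | comp_congr _ _ h1 h2 => intro; simp only [Pre.eval, h1, h2]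
  | add_assoc x y z => intro; exact _root_.add_assoc _ _ _
  | add_comm x y => intro; exact _root_.add_comm _ _
  | zero_add x => intro; exact _root_.zero_add _
  | zero_smul x => intro; exact _root_.zero_smul _ _
  | one_smul x => intro; exact _root_.one_smul _ _
  | mul_smul c d x => intro; exact SemigroupAction.mul_smul _ _ _
  | add_smul c d x => intro; exact _root_.add_smul _ _ _
  | smul_add c x y => intro; exact _root_.smul_add _ _ _
  | of_add x y => intro; exact _root_.map_add _ _ _
  | of_smul c x => intro; exact _root_.map_smul _ _ _
  | of_map σ x => intro; exact hφ σ x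
  | map_add σ x y => intro; exact _root_.map_add _ _ _
  | map_smul σ c x => intro; exact _root_.map_smul _ _ _
  | map_refl x => intro; exact P.map_refl _
  | map_trans σ τ x => intro; exact P.map_trans _ _ _
  | add_comp x x₁ y => intro; exact LinearMap.map_add₂ P.comp _ _ _
  | smul_comp c x y => intro; exact LinearMap.map_smul₂ P.comp _ _ _
  | comp_add x y y₁ => intro; exact _root_.map_add _ _ _
  | comp_smul c x y => intro; exact _root_.map_smul _ _ _
  | comp_map σ τ x y => intro; exact P.comp_map _ _ _ _
  | comp_par x y z => intro; exact P.comp_par _ _ _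
  | comp_seq x y z => intro; exact P.comp_seq _ _ _
  | comp_one x => intro; exact P.comp_one _
  | one_comp y => intro; exact P.one_comp _

/-- The universal property of the free operad. -/
def lift {G : LinSpecies K} (P : Operad K)
    (φ : ∀ (V : Type) [Finite V], G.obj V →ₗ[K] P.obj V)
    (hφ : ∀ {V W : Type} [Finite V] [Finite W] (σ : V ≃ W) (x : G.obj V),
      φ W (G.map σ x) = P.map σ (φ V x)) : Operad.Hom (freeOperad G) P where
  app V _ :=
    { toFun := Quot.lift (fun x => Pre.eval P φ x) fun _ _ h => h.eval_eq P φ hφ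
      map_add' := by rintro ⟨x⟩ ⟨y⟩; rfl
      map_smul' := by rintro c ⟨x⟩; rfl }
  app_map := by rintro V W _ _ σ ⟨x⟩; rfl
  app_one := rfl
  app_comp := by rintro A B _ _ ⟨x⟩ ⟨y⟩; rfl

theorem map_ι {G : LinSpecies K} {V W : Type} [Finite V] [Finite W] (σ : V ≃ W) (x : G.obj V) :
    (freeOperad G).map σ (ι G V x) = ι G W (G.map σ x) :=
  (Quot.sound (Rel.of_map σ x)).symm

/-- Induction on the elements of the free operad. -/
theorem induction {G : LinSpecies K} {C : ∀ (V : Type) [Finite V], (freeOperad G).obj V → Prop}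
    (zero : ∀ (V : Type) [Finite V], C V 0)
    (add : ∀ {V : Type} [Finite V] {x y : (freeOperad G).obj V}, C V x → C V y → C V (x + y))
    (smul : ∀ {V : Type} [Finite V] (c : K) {x : (freeOperad G).obj V}, C V x → C V (c • x))
    (of : ∀ {V : Type} [Finite V] (x : G.obj V), C V (ι G V x))
    (map : ∀ {V W : Type} [Finite V] [Finite W] (σ : V ≃ W) {x : (freeOperad G).obj V}, C V x →
      C W ((freeOperad G).map σ x))
    (one : C Unit (freeOperad G).one)
    (comp : ∀ {A B : Type} [Finite A] [Finite B] {x : (freeOperad G).obj (Option A)}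
      {y : (freeOperad G).obj B}, C (Option A) x → C B y → C (A ⊕ B) ((freeOperad G).comp x y))
    {V : Type} [Finite V] (x : (freeOperad G).obj V) : C V x := by
  suffices h : ∀ (V : Type) (x : Pre G V) [Finite V], C V (Quot.mk _ x) by
    obtain ⟨x⟩ := x
    exact h V x
  intro V x
  induction x with
  | zero => intro _; exact zero _
  | add x y hx hy => intro _; exact add hx hy
  | smul c x hx => intro _; exact smul c hx
  | of x => intro _; exact of x
  | map σ x hx => intro _; exact map σ hx
  | one => intro _; exact one
  | comp x y hx hy => intro _; exact comp hx hy

end FreeOperad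

end

noncomputable section

/-! ### Binary compositions -/

namespace Relabel

/-- The bijection `{v} ⊔ A ≃ A ⊔ {*}`. -/
def leftPoint (A : Type) : Unit ⊕ A ≃ Option A where
  toFun
    | .inl _ => none
    | .inr a => some a
  invFun
    | none => .inl ()
    | some a => .inr a
  left_inv := by rintro (_ | a) <;> rfl
  right_inv := by rintro (_ | a) <;> rfl

/-- The bijection `0 ↦ inl`, `1 ↦ inr`. -/
def twoPoints : Fin 2 ≃ Unit ⊕ Unit where
  toFun i := if i = 0 then .inl () else .inr ()
  invFun
    | .inl _ => 0
    | .inr _ => 1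
  left_inv := by intro i; fin_cases i <;> rfl
  right_inv := by rintro (_ | _) <;> rfl

end Relabel

namespace Operad

variable {K : Type*} [Field K] (O : Operad K)

theorem map_map {U V W : Type} [Finite U] [Finite V] [Finite W] (σ : U ≃ V) (τ : V ≃ W)
    (x : O.obj U) : O.map τ (O.map σ x) = O.map (σ.trans τ) x :=
  (O.map_trans σ τ x).symm

theorem map_congr {V W : Type} [Finite V] [Finite W] {σ τ : V ≃ W} (h : ∀ v, σ v = τ v)
    (x : O.obj V) : O.map σ x = O.map τ x := by
  rw [Equiv.ext h]

theorem map_eq_self {V : Type} [Finite V] {σ : V ≃ V} (h : ∀ v, σ v = v)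
    (x : O.obj V) : O.map σ x = x := by
  rw [show σ = Equiv.refl V from Equiv.ext h, O.map_refl]

theorem comp_map_left {A A₁ B : Type} [Finite A] [Finite A₁] [Finite B] (σ : A ≃ A₁)
    (x : O.obj (Option A)) (y : O.obj B) :
    O.comp (O.map (Equiv.optionCongr σ) x) y =
      O.map (Equiv.sumCongr σ (Equiv.refl B)) (O.comp x y) := by
  rw [← O.comp_map, O.map_refl]

theorem comp_map_right {A B B₁ : Type} [Finite A] [Finite B] [Finite B₁] (τ : B ≃ B₁)
    (x : O.obj (Option A)) (y : O.obj B) :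
    O.comp x (O.map τ y) = O.map (Equiv.sumCongr (Equiv.refl A) τ) (O.comp x y) := by
  rw [← O.comp_map, O.map_eq_self]
  rintro (_ | a) <;> rfl

theorem comp_unit {A : Type} [Finite A] (x : O.obj (Option A)) :
    O.comp x O.one = O.map (Relabel.addPoint A).symm x := by
  rw [← O.comp_one x, O.map_map, O.map_eq_self, O.comp_one]
  simp

/-- The composition `μ(x, y)` of a binary operation with two operations. -/
def bin {A B : Type} [Finite A] [Finite B] :
    O.obj (Fin 2) →ₗ[K] O.obj A →ₗ[K] O.obj B →ₗ[K] O.obj (A ⊕ B) :=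
  ((O.comp ∘ₗ O.map Relabel.pair).compr₂ (O.map (Relabel.leftPoint A))).compr₂ O.comp

theorem bin_apply {A B : Type} [Finite A] [Finite B] (μ : O.obj (Fin 2)) (x : O.obj A)
    (y : O.obj B) : O.bin μ x y =
      O.comp (O.map (Relabel.leftPoint A) (O.comp (O.map Relabel.pair μ) x)) y := rfl

theorem bin_map {A A₁ B B₁ : Type} [Finite A] [Finite A₁] [Finite B] [Finite B₁]
    (μ : O.obj (Fin 2)) (σ : A ≃ A₁) (τ : B ≃ B₁) (x : O.obj A) (y : O.obj B) :
    O.bin μ (O.map σ x) (O.map τ y) = O.map (Equiv.sumCongr σ τ) (O.bin μ x y) := by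
  rw [bin_apply, bin_apply, ← O.comp_map, comp_map_right O σ, O.map_map, O.map_map]
  congr 2
  apply O.map_congr
  rintro (_ | a) <;> rfl

theorem bin_one_one (μ : O.obj (Fin 2)) : O.bin μ O.one O.one = O.map Relabel.twoPoints μ := by
  rw [bin_apply, comp_unit, comp_unit, O.map_map, O.map_map, O.map_map]
  apply O.map_congr
  intro i; fin_cases i <;> rfl

/-- This is parallel composition at two points when no other input remains, i.e. `comp_par` over the
empty set. -/
theorem bin_swap {A B : Type} [Finite A] [Finite B] (μ : O.obj (Fin 2)) (x : O.obj A)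
    (y : O.obj B) :
    O.bin (O.map (Equiv.swap 0 1) μ) x y = O.map (Equiv.sumComm B A) (O.bin μ y x) := by
  -- `key` rewrites `bin` so that both inputs are points adjoined to `Empty`, the shape required by
  -- `comp_par`.
  have key : ∀ (ν : O.obj (Fin 2)) {C D : Type} [Finite C] [Finite D] (c : O.obj C)
      (d : O.obj D), O.bin ν c d = O.map (Equiv.sumCongr (Equiv.emptySum Empty C) (Equiv.refl D))
        (O.comp (O.map (Relabel.optionLeft Empty C) (O.comp (O.map (Equiv.optionCongr Relabel.point)
          (O.map Relabel.pair ν)) c)) d) := by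
    intro ν C D _ _ c d
    rw [comp_map_left, O.map_map, ← O.comp_map, O.map_refl, O.map_map, bin_apply]
    congr 2
    apply O.map_congr
    rintro (_ | a) <;> rfl
  rw [key, key, O.comp_par, O.map_map, O.map_map, O.map_map, O.map_map, O.map_map]
  have h : ∀ i, ((Equiv.swap (0 : Fin 2) 1).trans (Relabel.pair.trans
      ((Equiv.optionCongr Relabel.point).trans (Relabel.swapPoints Empty)))) i =
      (Relabel.pair.trans (Equiv.optionCongr Relabel.point)) i := by
    intro i; fin_cases i <;> rfl
  rw [O.map_congr h, ← O.map_map Relabel.pair]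
  apply O.map_congr
  rintro ((a | b) | a)
  · exact a.elim
  · rfl
  · rfl

theorem bin_comp_right {A B C : Type} [Finite A] [Finite B] [Finite C] (μ : O.obj (Fin 2))
    (x : O.obj A) (y : O.obj (Option B)) (z : O.obj C) :
    O.comp (O.map (Relabel.optionRight A B) (O.bin μ x y)) z =
      O.map (Equiv.sumAssoc A B C).symm (O.bin μ x (O.comp y z)) := by
  rw [bin_apply, bin_apply, ← O.comp_seq, O.map_map, O.map_eq_self]
  simp

/-- The insertion of `z` is first moved past `y` by parallel composition, then under `μ` by
sequential composition. -/
theorem bin_comp_left {A B C : Type} [Finite A] [Finite B] [Finite C] (μ : O.obj (Fin 2))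
    (x : O.obj (Option A)) (y : O.obj B) (z : O.obj C) :
    O.comp (O.map (Relabel.optionLeft A B) (O.bin μ x y)) z =
      O.map (Relabel.rightComm A B C) (O.bin μ (O.comp x z) y) := by
  rw [bin_apply, bin_apply, O.comp_par, ← O.comp_seq, O.map_map, O.map_map]
  have h : ∀ v, ((Relabel.leftPoint (Option A)).trans (Relabel.swapPoints A)) v =
      ((Relabel.optionRight Unit A).trans (Equiv.optionCongr (Relabel.leftPoint A))) v := by
    rintro (_ | _ | a) <;> rfl
  rw [O.map_congr h, ← O.map_map, comp_map_left, O.map_map]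
  congr 3
  apply O.map_congr
  rintro ((_ | a) | a) <;> rfl

namespace Hom

variable {O} {P : Operad K} (φ : Hom O P)

theorem app_bin {A B : Type} [Finite A] [Finite B] (μ : O.obj (Fin 2)) (x : O.obj A)
    (y : O.obj B) :
    φ.app (A ⊕ B) (O.bin μ x y) = P.bin (φ.app (Fin 2) μ) (φ.app A x) (φ.app B y) := by
  rw [bin_apply, bin_apply, φ.app_comp, φ.app_map, φ.app_comp, φ.app_map]

end Hom

/-- The operations obtained from the unit by compositions `μ(x, y)` with `μ ∈ S`. -/
inductive BinMem (S : Set (O.obj (Fin 2))) : ∀ (V : Type) [Finite V], O.obj V → Prop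
  | one : BinMem S Unit O.one
  | zero {V : Type} [Finite V] : BinMem S V 0
  | add {V : Type} [Finite V] {x y : O.obj V} :
      BinMem S V x → BinMem S V y → BinMem S V (x + y)
  | smul {V : Type} [Finite V] (c : K) {x : O.obj V} : BinMem S V x → BinMem S V (c • x)
  | map {V W : Type} [Finite V] [Finite W] (σ : V ≃ W) {x : O.obj V} :
      BinMem S V x → BinMem S W (O.map σ x)
  | bin {μ : O.obj (Fin 2)} {A B : Type} [Finite A] [Finite B] {x : O.obj A} {y : O.obj B} :
      μ ∈ S → BinMem S A x → BinMem S B y → BinMem S (A ⊕ B) (O.bin μ x y)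

/-- A relabelling under which the distinguished input comes from the left block splits into
relabellings of the two blocks around the standard bijection. This brings an arbitrary relabelling
of `bin` into the form of `bin_comp_left`. -/
theorem exists_optionLeft {A₁ A₂ A : Type} (e : A₁ ⊕ A₂ ≃ Option A) (a : A₁)
    (ha : e (.inl a) = none) : ∃ (A' : Type) (e₁ : A₁ ≃ Option A') (e₂ : A' ⊕ A₂ ≃ A),
      e = (Equiv.sumCongr e₁ (Equiv.refl A₂)).trans
        ((Relabel.optionLeft A' A₂).trans (Equiv.optionCongr e₂)) := by
  classical
  let e₁ : A₁ ≃ Option {b // b ≠ a} := (Equiv.optionSubtypeNe a).symm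
  let f := ((Relabel.optionLeft _ A₂).symm.trans (Equiv.sumCongr e₁.symm (Equiv.refl A₂))).trans e
  have hf : f none = none := by
    change e (.inl (e₁.symm none)) = none
    rw [← ha]
    congr 2
  refine ⟨_, e₁, Equiv.removeNone f, ?_⟩
  have : Equiv.optionCongr (Equiv.removeNone f) = f := by
    ext x : 1
    rcases x with _ | x
    · rw [hf]; rfl
    · have h1 : ∃ y, f (some x) = some y := by
        rcases h : f (some x) with _ | y
        · exact absurd (f.injective (h.trans hf.symm)) (Option.some_ne_none x)
        · exact ⟨y, rfl⟩
      exact Equiv.removeNone_some f h1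
  rw [this]
  ext x : 1
  simp [f]

theorem exists_optionRight {A₁ A₂ A : Type} (e : A₁ ⊕ A₂ ≃ Option A) (a : A₂)
    (ha : e (.inr a) = none) : ∃ (A' : Type) (e₁ : A₂ ≃ Option A') (e₂ : A₁ ⊕ A' ≃ A),
      e = (Equiv.sumCongr (Equiv.refl A₁) e₁).trans
        ((Relabel.optionRight A₁ A').trans (Equiv.optionCongr e₂)) := by
  obtain ⟨A', e₁, e₂, h⟩ := exists_optionLeft ((Equiv.sumComm A₂ A₁).trans e) a ha
  refine ⟨A', e₁, (Equiv.sumComm A₁ A').trans e₂, ?_⟩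
  have h' : e = (Equiv.sumComm A₁ A₂).trans ((Equiv.sumComm A₂ A₁).trans e) := by
    ext x : 1; simp
  rw [h', h]
  ext x : 1
  rcases x with x | x
  · rfl
  · simp only [Equiv.trans_apply, Equiv.sumComm_apply, Sum.swap_inr, Equiv.sumCongr_apply,
      Sum.map_inl, Sum.map_inr]
    rcases e₁ x with _ | y <;> rfl

/-- An insertion into `μ(x₁, x₂)` is an insertion into whichever of `x₁`, `x₂` has the distinguished
input; hence closure under `bin` implies closure under all partial compositions. -/
theorem BinMem.comp {S : Set (O.obj (Fin 2))} {A B : Type} [Finite A] [Finite B]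
    {x : O.obj (Option A)} {y : O.obj B} (hx : BinMem O S (Option A) x) (hy : BinMem O S B y) :
    BinMem O S (A ⊕ B) (O.comp x y) := by
  -- The arity of `x` changes along the induction, so the distinguished input is marked by an
  -- arbitrary bijection with `Option A`.
  suffices h : ∀ (V : Type) [Finite V] (x : O.obj V), BinMem O S V x →
      ∀ (A : Type) [Finite A] (e : V ≃ Option A), BinMem O S (A ⊕ B) (O.comp (O.map e x) y) by
    simpa [O.map_refl] using h (Option A) x hx A (Equiv.refl _)
  intro V _ x hx
  induction hx with
  | one =>
    intro A _ e
    -- The unit has a single input, so nothing is left besides the distinguished one.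
    have hA : IsEmpty A := ⟨fun a => by
      have := e.symm.injective (Subsingleton.elim (e.symm none) (e.symm (some a)))
      exact Option.some_ne_none a this.symm⟩
    have h1 : O.map e O.one = O.map (Equiv.optionCongr (Equiv.equivOfIsEmpty Empty A))
        (O.map Relabel.point O.one) := by
      rw [O.map_map]
      apply O.map_congr
      intro v
      rcases h : e v with _ | a
      · rfl
      · exact isEmptyElim a
    have h2 := O.one_comp y
    rw [h1, comp_map_left]
    refine .map _ ?_
    have h3 : O.comp (O.map Relabel.point O.one) y = O.map (Equiv.emptySum Empty B).symm y := by
      rw [← h2, O.map_map, O.map_eq_self, h2]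
      simp
    rw [h3]
    exact .map _ hy
  | zero => intro A _ e; rw [map_zero, map_zero, LinearMap.zero_apply]; exact .zero
  | add _ _ h1 h2 =>
    intro A _ e; rw [map_add, map_add, LinearMap.add_apply]; exact .add (h1 A e) (h2 A e)
  | smul c _ h1 =>
    intro A _ e; rw [map_smul, map_smul, LinearMap.smul_apply]; exact .smul c (h1 A e)
  | map σ _ h1 => intro A _ e; rw [O.map_map]; exact h1 A _
  | @bin μ A₁ A₂ _ _ x₁ x₂ hμ h₁ h₂ ih₁ ih₂ =>
    intro A _ e
    rcases he : e.symm none with a | a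
    · obtain ⟨A', e₁, e₂, rfl⟩ := exists_optionLeft e a (by rw [← he, Equiv.apply_symm_apply])
      have := Finite.of_injective (fun x : A' => e₂ (.inl x))
        (e₂.injective.comp Sum.inl_injective)
      rw [← O.map_map, ← O.map_map, ← bin_map, comp_map_left, O.map_refl, bin_comp_left]
      exact .map _ (.map _ (.bin hμ (ih₁ A' e₁) h₂))
    · obtain ⟨A', e₁, e₂, rfl⟩ := exists_optionRight e a (by rw [← he, Equiv.apply_symm_apply])
      have := Finite.of_injective (fun x : A' => e₂ (.inr x))
        (e₂.injective.comp Sum.inr_injective)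
      rw [← O.map_map, ← O.map_map, ← bin_map, comp_map_left, O.map_refl, bin_comp_right]
      exact .map _ (.map _ (.bin hμ h₁ (ih₂ A' e₁)))

theorem BinMem.of_mem {S : Set (O.obj (Fin 2))} {μ : O.obj (Fin 2)} (hμ : μ ∈ S) :
    BinMem O S (Fin 2) μ := by
  have h := BinMem.map Relabel.twoPoints.symm (.bin hμ .one .one)
  rw [bin_one_one, O.map_map, O.map_eq_self] at h
  · exact h
  · simp

/-- If all generators are linear combinations of relabellings of elements of `S`, all elements of
`Ope(G, R)` are obtained from the unit by compositions `μ(x, y)` with `μ ∈ S`. -/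
theorem binMem_of_surjective {G : LinSpecies K} {O : Operad K} (φ : Hom (freeOperad G) O)
    (S : Set (O.obj (Fin 2)))
    (hS : ∀ (V : Type) [Finite V] (g : G.obj V), BinMem O S V (φ.app V (FreeOperad.ι G V g)))
    {V : Type} [Finite V] (hφ : Function.Surjective (φ.app V)) (x : O.obj V) :
    BinMem O S V x := by
  obtain ⟨x, rfl⟩ := hφ x
  clear hφ
  induction x using FreeOperad.induction with
  | zero V => rw [map_zero]; exact .zero
  | add h1 h2 => rw [map_add]; exact .add h1 h2
  | smul c h => rw [map_smul]; exact .smul c h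
  | of x => exact hS _ x
  | map σ h => rw [φ.app_map]; exact .map σ h
  | one => rw [φ.app_one]; exact .one
  | comp h1 h2 => rw [φ.app_comp]; exact .comp O h1 h2

end Operad

end

noncomputable section

/-! ### Ternary compositions -/

namespace Relabel

/-- The bijection `({v} ⊔ {*₁}) ⊔ A ≃ (A ⊔ {*₂}) ⊔ {*₁}`. -/
def secondPoint (A : Type) : Option Unit ⊕ A ≃ Option (Option A) :=
  (optionLeft Unit A).trans (Equiv.optionCongr (leftPoint A))

/-- The bijection `0 ↦ *₁`, `1 ↦ *₂`, `2 ↦ v`. -/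
def triple : Fin 3 ≃ Option (Option Unit) where
  toFun i := if i = 0 then none else if i = 1 then some none else some (some ())
  invFun
    | none => 0
    | some none => 1
    | some (some _) => 2
  left_inv := by intro i; fin_cases i <;> rfl
  right_inv := by rintro (_ | _ | _) <;> rfl

end Relabel

namespace Operad

variable {K : Type*} [Field K] (O : Operad K)

/-- The composition of a ternary operation with three operations. -/
def ins₃ {A B C : Type} [Finite A] [Finite B] [Finite C] (r : O.obj (Option (Option Unit)))
    (x : O.obj A) (y : O.obj B) (z : O.obj C) : O.obj ((A ⊕ B) ⊕ C) :=
  O.comp (O.map (Relabel.optionLeft A B) (O.comp (O.map (Relabel.secondPoint A) (O.comp r x)) y)) z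

theorem ins₃_add {A B C : Type} [Finite A] [Finite B] [Finite C]
    (r s : O.obj (Option (Option Unit))) (x : O.obj A) (y : O.obj B) (z : O.obj C) :
    O.ins₃ (r + s) x y z = O.ins₃ r x y z + O.ins₃ s x y z := by
  simp only [ins₃, map_add, LinearMap.add_apply]

theorem ins₃_zero {A B C : Type} [Finite A] [Finite B] [Finite C]
    (x : O.obj A) (y : O.obj B) (z : O.obj C) :
    O.ins₃ 0 x y z = 0 := by
  simp only [ins₃, map_zero, LinearMap.zero_apply]

/-- The last two insertions commute by `comp_par`. Together with `ins₃_swap_left` this gives all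
permutations of the three inputs. -/
theorem ins₃_swap_right {A B C : Type} [Finite A] [Finite B] [Finite C]
    (r : O.obj (Option (Option Unit))) (x : O.obj A) (y : O.obj B) (z : O.obj C) :
    O.ins₃ (O.map (Equiv.optionCongr (Equiv.swap none (some ()))) r) x y z =
      O.map (Relabel.rightComm A B C) (O.ins₃ r x z y) := by
  rw [ins₃, comp_map_left, O.map_map, ins₃]
  have h : ∀ v, ((Equiv.sumCongr (Equiv.swap none (some ())) (Equiv.refl A)).trans
      (Relabel.secondPoint A)) v =
        ((Relabel.secondPoint A).trans (Relabel.swapPoints A)) v := by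
    rintro ((_ | _) | a) <;> rfl
  rw [O.map_congr h, ← O.map_map, O.comp_par, O.map_map, O.map_eq_self]
  rintro (_ | _ | a) <;> rfl

theorem ins₃_swap_left {A B C : Type} [Finite A] [Finite B] [Finite C]
    (r : O.obj (Option (Option Unit))) (x : O.obj A) (y : O.obj B) (z : O.obj C) :
    O.ins₃ (O.map (Relabel.swapPoints Unit) r) x y z =
      O.map (Equiv.sumCongr (Equiv.sumComm B A) (Equiv.refl C)) (O.ins₃ r y x z) := by
  have h : ∀ {A' B' : Type} [Finite A'] [Finite B'] (s : O.obj (Option (Option Unit)))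
      (a : O.obj A') (b : O.obj B'), O.comp (O.map (Relabel.secondPoint A') (O.comp s a)) b =
        O.map (Equiv.sumCongr (Relabel.leftPoint A') (Equiv.refl B'))
          (O.comp (O.map (Relabel.optionLeft Unit A') (O.comp s a)) b) := by
    intro A' B' _ _ s a b
    rw [Relabel.secondPoint, ← O.map_map, comp_map_left]
  rw [ins₃, h, O.comp_par, ins₃, h, O.map_map, O.map_map, O.map_map, O.map_map, O.map_eq_self,
    ← comp_map_left, O.map_map]
  · congr 2
    apply O.map_congr
    rintro ((_ | a) | b) <;> rfl
  · rintro (_ | _ | a) <;> rfl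

/-- The tree `μ(ν(0, 1), 2)`. -/
def tri (μ ν : O.obj (Fin 2)) : O.obj (Option (Option Unit)) :=
  O.map Relabel.triple (O.map (Relabel.slot (Equiv.refl _) 2) (O.comp (O.map Relabel.pair μ) ν))

/-- Sequential composition is applied twice: `x`, and then `y`, are inserted into the upper node
`ν`. -/
theorem ins₃_tri {A B C : Type} [Finite A] [Finite B] [Finite C] (μ ν : O.obj (Fin 2))
    (x : O.obj A) (y : O.obj B) (z : O.obj C) :
    O.ins₃ (O.tri μ ν) x y z = O.bin μ (O.bin ν x y) z := by
  -- The tree is rewritten with its free inputs as adjoined points, so that `comp_seq` applies.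
  have h1 : O.tri μ ν = O.map (Equiv.optionCongr (Relabel.addPoint Unit))
      (O.map (Relabel.optionRight Unit Unit) (O.comp (O.map Relabel.pair μ)
        (O.map Relabel.pair ν))) := by
    rw [tri, comp_map_right, O.map_map, O.map_map, O.map_map]
    apply O.map_congr
    rintro (_ | i)
    · rfl
    · fin_cases i <;> rfl
  have h2 : ∀ (α : O.obj (Option Unit)) (β : O.obj (Option Unit)),
      O.comp (O.map (Relabel.optionRight Unit Unit) (O.comp α β)) x =
        O.map (Equiv.sumAssoc Unit Unit A).symm (O.comp α (O.comp β x)) := by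
    intro α β
    rw [← O.comp_seq, O.map_map, O.map_eq_self]
    simp
  have h3 : ∀ (α : O.obj (Option Unit)) (β : O.obj (Option A)),
      O.comp (O.map (Relabel.optionRight Unit A) (O.comp α β)) y =
        O.map (Equiv.sumAssoc Unit A B).symm (O.comp α (O.comp β y)) := by
    intro α β
    rw [← O.comp_seq, O.map_map, O.map_eq_self]
    simp
  have h4 : O.comp (O.map Relabel.pair ν) x = O.map (Relabel.leftPoint A).symm
      (O.map (Relabel.leftPoint A) (O.comp (O.map Relabel.pair ν) x)) := by
    rw [O.map_map, O.map_eq_self]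
    simp
  rw [ins₃, h1, comp_map_left, h2, h4, comp_map_right, O.map_map, O.map_map, O.map_map]
  rw [show O.map _ (O.comp (O.map Relabel.pair μ) (O.map (Relabel.leftPoint A)
    (O.comp (O.map Relabel.pair ν) x))) = O.map (Equiv.optionCongr (Relabel.leftPoint A))
    (O.map (Relabel.optionRight Unit A) (O.comp (O.map Relabel.pair μ) (O.map (Relabel.leftPoint A)
    (O.comp (O.map Relabel.pair ν) x)))) from ?_]
  · rw [comp_map_left, h3, ← bin_apply, O.map_map, O.map_map, bin_apply O μ]
    congr 2
    apply O.map_congr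
    rintro (_ | _ | a) <;> rfl
  · rw [O.map_map]
    apply O.map_congr
    rintro (_ | _ | a) <;> rfl

/-! ### The twisted algebra of an operad -/

variable (V : Type) [DecidableEq V]

/-- The direct sum of the spaces `O[B]` over the finite subsets `B` of `V`. -/
abbrev Twisted : Type _ := DirectSum (Finset V) fun B => O.obj B

variable {V}

/-- The element of the twisted algebra given by an operation on `B`. -/
def hom (B : Finset V) : O.obj B →ₗ[K] O.Twisted V :=
  DirectSum.lof K (Finset V) (fun B => O.obj B) B

/-- An element of the twisted algebra depends only on the labels in `V` of its inputs. Equalities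
between different spaces `O[B]` and `O[C]` are thereby checked pointwise, without transport along `B
= C`. -/
theorem hom_congr {U : Type} [Finite U] {B C : Finset V} (σ : U ≃ B) (τ : U ≃ C)
    (h : ∀ u, (σ u : V) = τ u) (x : O.obj U) : O.hom B (O.map σ x) = O.hom C (O.map τ x) := by
  have hBC : B = C := by
    ext v
    constructor
    · intro hv
      have := h (σ.symm ⟨v, hv⟩)
      rw [Equiv.apply_symm_apply] at this
      rw [show v = _ from this]
      exact (τ _).2
    · intro hv
      have := h (τ.symm ⟨v, hv⟩)
      rw [Equiv.apply_symm_apply] at this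
      rw [show v = _ from this.symm]
      exact (σ _).2
  subst hBC
  rw [O.map_congr fun u => Subtype.ext (h u)]

/-- The bilinear operation on the twisted algebra induced by a binary operation. It is the union of
disjoint sets on labels, and zero if the sets of labels meet. -/
def gmul (μ : O.obj (Fin 2)) : O.Twisted V →ₗ[K] O.Twisted V →ₗ[K] O.Twisted V :=
  DirectSum.toModule K _ _ fun B => LinearMap.flip (DirectSum.toModule K _ _ fun C =>
    if h : Disjoint B C then
      LinearMap.flip ((O.bin μ).compr₂ (O.hom (B ∪ C) ∘ₗ O.map (Equiv.Finset.union B C h)))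
    else 0)

theorem gmul_hom_hom (μ : O.obj (Fin 2)) {B C : Finset V} (x : O.obj B) (y : O.obj C) :
    O.gmul μ (O.hom B x) (O.hom C y) =
      if h : Disjoint B C then O.hom (B ∪ C) (O.map (Equiv.Finset.union B C h) (O.bin μ x y))
      else 0 := by
  rw [gmul, hom, hom, DirectSum.toModule_lof, LinearMap.flip_apply, DirectSum.toModule_lof]
  split_ifs <;> rfl

theorem gmul_hom_hom_of_disjoint (μ : O.obj (Fin 2)) {B C : Finset V} (h : Disjoint B C)
    (x : O.obj B) (y : O.obj C) : O.gmul μ (O.hom B x) (O.hom C y) =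
      O.hom (B ∪ C) (O.map (Equiv.Finset.union B C h) (O.bin μ x y)) := by
  rw [gmul_hom_hom, dif_pos h]

theorem gmul_hom_hom_of_not_disjoint (μ : O.obj (Fin 2)) {B C : Finset V} (h : ¬Disjoint B C)
    (x : O.obj B) (y : O.obj C) : O.gmul μ (O.hom B x) (O.hom C y) = 0 := by
  rw [gmul_hom_hom, dif_neg h]

theorem Twisted.induction {C : O.Twisted V → Prop} (h0 : C 0)
    (hom : ∀ (B : Finset V) (x : O.obj B), C (O.hom B x))
    (add : ∀ a b, C a → C b → C (a + b)) (a : O.Twisted V) : C a :=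
  DirectSum.induction_on a h0 hom add

theorem gmul_swap (μ : O.obj (Fin 2)) (a b : O.Twisted V) :
    O.gmul (O.map (Equiv.swap 0 1) μ) a b = O.gmul μ b a := by
  induction a using Twisted.induction with
  | h0 => simp
  | add a a' h h' => rw [map_add, LinearMap.add_apply, h, h', map_add]
  | hom B x =>
    induction b using Twisted.induction with
    | h0 => simp
    | add a a' h h' => rw [map_add, h, h', map_add, LinearMap.add_apply]
    | hom C y =>
      by_cases h : Disjoint B C
      · rw [gmul_hom_hom_of_disjoint _ _ h, gmul_hom_hom_of_disjoint _ _ h.symm, bin_swap,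
          O.map_map]
        apply O.hom_congr
        rintro (u | u) <;> rfl
      · rw [gmul_hom_hom_of_not_disjoint _ _ h, gmul_hom_hom_of_not_disjoint _ _
          (fun h' => h h'.symm)]

/-- The composition of a ternary operation with three homogeneous elements. -/
def hom₃ (A B C : Finset V) (h₁ : Disjoint A B) (h₂ : Disjoint (A ∪ B) C)
    (r : O.obj (Option (Option Unit))) (x : O.obj A) (y : O.obj B) (z : O.obj C) : O.Twisted V :=
  O.hom (A ∪ B ∪ C) (O.map ((Equiv.sumCongr (Equiv.Finset.union A B h₁) (Equiv.refl C)).trans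
    (Equiv.Finset.union (A ∪ B) C h₂)) (O.ins₃ r x y z))

theorem hom₃_tri {A B C : Finset V} (h₁ : Disjoint A B) (h₂ : Disjoint (A ∪ B) C)
    (μ ν : O.obj (Fin 2)) (x : O.obj A) (y : O.obj B) (z : O.obj C) :
    O.hom₃ A B C h₁ h₂ (O.tri μ ν) x y z =
      O.gmul μ (O.gmul ν (O.hom A x) (O.hom B y)) (O.hom C z) := by
  rw [gmul_hom_hom_of_disjoint _ _ h₁, gmul_hom_hom_of_disjoint _ _ h₂, hom₃, ins₃_tri,
    ← O.map_map, ← bin_map, O.map_refl]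

theorem hom₃_swap_left {A B C : Finset V} (h₁ : Disjoint A B) (h₂ : Disjoint (A ∪ B) C)
    (h₁' : Disjoint B A) (h₂' : Disjoint (B ∪ A) C)
    (r : O.obj (Option (Option Unit))) (x : O.obj A) (y : O.obj B) (z : O.obj C) :
    O.hom₃ A B C h₁ h₂ (O.map (Relabel.swapPoints Unit) r) x y z =
      O.hom₃ B A C h₁' h₂' r y x z := by
  rw [hom₃, ins₃_swap_left, O.map_map]
  apply O.hom_congr
  rintro ((u | u) | u) <;> rfl

theorem hom₃_swap_right {A B C : Finset V} (h₁ : Disjoint A B) (h₂ : Disjoint (A ∪ B) C)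
    (h₁' : Disjoint A C) (h₂' : Disjoint (A ∪ C) B)
    (r : O.obj (Option (Option Unit))) (x : O.obj A) (y : O.obj B) (z : O.obj C) :
    O.hom₃ A B C h₁ h₂ (O.map (Equiv.optionCongr (Equiv.swap none (some ()))) r) x y z =
      O.hom₃ A C B h₁' h₂' r x z y := by
  rw [hom₃, ins₃_swap_right, O.map_map]
  apply O.hom_congr
  rintro ((u | u) | u) <;> rfl

theorem gmul_gmul_of_not_disjoint (μ ν : O.obj (Fin 2)) {A B C : Finset V}
    (h : ¬ (Disjoint A B ∧ Disjoint (A ∪ B) C)) (x : O.obj A) (y : O.obj B) (z : O.obj C) :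
    O.gmul μ (O.gmul ν (O.hom A x) (O.hom B y)) (O.hom C z) = 0 := by
  by_cases h₁ : Disjoint A B
  · rw [gmul_hom_hom_of_disjoint _ _ h₁, gmul_hom_hom_of_not_disjoint]
    exact fun h₂ => h ⟨h₁, h₂⟩
  · rw [gmul_hom_hom_of_not_disjoint _ _ h₁, map_zero, LinearMap.zero_apply]

/-- A relation between trees with two internal nodes gives an identity in the twisted algebra. -/
theorem gmul_relation (μ ν : Fin 3 → O.obj (Fin 2))
    (h : ∑ i, O.map (Relabel.slot (Equiv.refl _) i) (O.comp (O.map Relabel.pair (μ i)) (ν i)) = 0)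
    (a b c : O.Twisted V) :
    O.gmul (μ 2) (O.gmul (ν 2) a b) c + O.gmul (μ 0) (O.gmul (ν 0) b c) a +
      O.gmul (μ 1) (O.gmul (ν 1) c a) b = 0 := by
  -- The tree of index `2` is `tri` itself; those of index `0` and `1` differ from it by the two
  -- rotations of `0, 1, 2`, written as products of the adjacent transpositions handled by
  -- `hom₃_swap_left` and `hom₃_swap_right`.
  have key : O.tri (μ 2) (ν 2) + O.map (Relabel.swapPoints Unit)
      (O.map (Equiv.optionCongr (Equiv.swap none (some ()))) (O.tri (μ 0) (ν 0))) +
      O.map (Equiv.optionCongr (Equiv.swap none (some ())))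
        (O.map (Relabel.swapPoints Unit) (O.tri (μ 1) (ν 1))) = 0 := by
    have h' := congrArg (O.map Relabel.triple) h
    rw [map_zero, Fin.sum_univ_three, map_add, map_add, add_comm, ← add_assoc] at h'
    rw [← h']
    refine congrArg₂ _ (congrArg₂ _ rfl ?_) ?_
    · rw [tri, O.map_map, O.map_map, O.map_map, O.map_map]
      apply O.map_congr
      rintro (_ | i)
      · rfl
      · fin_cases i <;> rfl
    · rw [tri, O.map_map, O.map_map, O.map_map, O.map_map]
      apply O.map_congr
      rintro (_ | i)
      · rfl
      · fin_cases i <;> rfl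
  induction a using Twisted.induction with
  | h0 => simp
  | add a a' h h' =>
    simp only [map_add, LinearMap.add_apply]
    -- The right side is split as `0 + 0`, and each zero is replaced by the identity for one
    -- summand.
    rw [← add_zero (0 : O.Twisted V)]
    nth_rewrite 1 [← h]
    rw [← h']
    abel
  | hom A x =>
  induction b using Twisted.induction with
  | h0 => simp
  | add a a' h h' =>
    simp only [map_add, LinearMap.add_apply]
    rw [← add_zero (0 : O.Twisted V)]
    nth_rewrite 1 [← h]
    rw [← h']
    abel
  | hom B y =>
  induction c using Twisted.induction with
  | h0 => simp
  | add a a' h h' =>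
    simp only [map_add, LinearMap.add_apply]
    rw [← add_zero (0 : O.Twisted V)]
    nth_rewrite 1 [← h]
    rw [← h']
    abel
  | hom C z =>
    -- For pairwise disjoint labels the identity is the image of `key` under `hom₃`; otherwise all
    -- three products vanish separately.
    by_cases hd : Disjoint A B ∧ Disjoint A C ∧ Disjoint B C
    · obtain ⟨hAB, hAC, hBC⟩ := hd
      have h1 : Disjoint (A ∪ B) C := Finset.disjoint_union_left.2 ⟨hAC, hBC⟩
      have h2 : Disjoint (B ∪ C) A := Finset.disjoint_union_left.2 ⟨hAB.symm, hAC.symm⟩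
      have h3 : Disjoint (C ∪ A) B := Finset.disjoint_union_left.2 ⟨hBC.symm, hAB⟩
      have h4 : Disjoint (B ∪ A) C := Finset.disjoint_union_left.2 ⟨hBC, hAC⟩
      have h5 : Disjoint (A ∪ C) B := Finset.disjoint_union_left.2 ⟨hAB, hBC.symm⟩
      rw [← hom₃_tri O hAB h1, ← hom₃_tri O hBC h2, ← hom₃_tri O hAC.symm h3,
        ← hom₃_swap_right O hAB.symm h4, ← hom₃_swap_left O hAB h1,
        ← hom₃_swap_left O hAC h5, ← hom₃_swap_right O hAB h1]
      have := congrArg (fun r => O.hom₃ A B C hAB h1 r x y z) key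
      simpa only [hom₃, ins₃_add, ins₃_zero, map_add, map_zero] using this
    · have e1 : ¬ (Disjoint A B ∧ Disjoint (A ∪ B) C) := by
        rw [Finset.disjoint_union_left]; tauto
      have e2 : ¬ (Disjoint B C ∧ Disjoint (B ∪ C) A) := by
        rw [Finset.disjoint_union_left, disjoint_comm (a := B) (b := A),
          disjoint_comm (a := C) (b := A)]; tauto
      have e3 : ¬ (Disjoint C A ∧ Disjoint (C ∪ A) B) := by
        rw [Finset.disjoint_union_left, disjoint_comm (a := C) (b := A),
          disjoint_comm (a := C) (b := B)]; tauto
      rw [gmul_gmul_of_not_disjoint O _ _ e1, gmul_gmul_of_not_disjoint O _ _ e2,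
        gmul_gmul_of_not_disjoint O _ _ e3, add_zero, add_zero]

/-- The generator of the twisted algebra with label `v`. -/
def leaf (v : V) : O.Twisted V :=
  O.hom {v} (O.map ⟨fun _ => ⟨v, Finset.mem_singleton_self v⟩, fun _ => (), fun _ => rfl,
    fun w => Subtype.ext (Finset.mem_singleton.1 w.2).symm⟩ O.one)

/-- If an operad is generated by binary operations, so is its twisted algebra. -/
theorem Twisted.mem_of_binMem {S : Set (O.obj (Fin 2))} (N : Submodule K (O.Twisted V))
    (hleaf : ∀ v, O.leaf v ∈ N) (hmul : ∀ μ ∈ S, ∀ a ∈ N, ∀ b ∈ N, O.gmul μ a b ∈ N)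
    {U : Type} [Finite U] {x : O.obj U} (hx : BinMem O S U x) :
    ∀ (B : Finset V) (σ : U ≃ B), O.hom B (O.map σ x) ∈ N := by
  induction hx with
  | one =>
    intro B σ
    have h : O.hom B (O.map σ O.one) = O.leaf (σ () : V) := by
      rw [leaf]
      apply O.hom_congr
      rintro ⟨⟩
      rfl
    rw [h]
    exact hleaf _
  | zero => intro B σ; rw [map_zero, map_zero]; exact N.zero_mem
  | add _ _ h1 h2 => intro B σ; rw [map_add, map_add]; exact N.add_mem (h1 B σ) (h2 B σ)
  | smul c _ h => intro B σ; rw [map_smul, map_smul]; exact N.smul_mem c (h B σ)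
  | map τ _ h => intro B σ; rw [O.map_map]; exact h B _
  | @bin μ A₁ A₂ _ _ x₁ x₂ hμ h₁ h₂ ih₁ ih₂ =>
    intro B σ
    have := Fintype.ofFinite A₁
    have := Fintype.ofFinite A₂
    -- The labels `B` are split into the images of the two blocks under `σ`, so that `bin` becomes a
    -- product of elements with disjoint labels.
    let f₁ : A₁ ↪ V := ⟨fun a => σ (.inl a), fun a b hab =>
      Sum.inl_injective (σ.injective (Subtype.ext hab))⟩
    let f₂ : A₂ ↪ V := ⟨fun a => σ (.inr a), fun a b hab =>
      Sum.inr_injective (σ.injective (Subtype.ext hab))⟩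
    let B₁ : Finset V := Finset.univ.map f₁
    let B₂ : Finset V := Finset.univ.map f₂
    have hd : Disjoint B₁ B₂ := by
      rw [Finset.disjoint_left]
      intro v h1 h2
      obtain ⟨a, -, rfl⟩ := Finset.mem_map.1 h1
      obtain ⟨b, -, hb⟩ := Finset.mem_map.1 h2
      exact Sum.inr_ne_inl (σ.injective (Subtype.ext hb))
    let σ₁ : A₁ ≃ B₁ := Equiv.ofBijective
      (fun a => ⟨f₁ a, Finset.mem_map_of_mem f₁ (Finset.mem_univ a)⟩)
      ⟨fun a b hab => f₁.injective (a₁ := a) (a₂ := b) (congrArg (fun w : B₁ => (w : V)) hab),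
        fun ⟨v, hv⟩ => by
        obtain ⟨a, -, rfl⟩ := Finset.mem_map.1 hv
        exact ⟨a, rfl⟩⟩
    let σ₂ : A₂ ≃ B₂ := Equiv.ofBijective
      (fun a => ⟨f₂ a, Finset.mem_map_of_mem f₂ (Finset.mem_univ a)⟩)
      ⟨fun a b hab => f₂.injective (a₁ := a) (a₂ := b) (congrArg (fun w : B₂ => (w : V)) hab),
        fun ⟨v, hv⟩ => by
        obtain ⟨a, -, rfl⟩ := Finset.mem_map.1 hv
        exact ⟨a, rfl⟩⟩
    have key := hmul μ hμ _ (ih₁ B₁ σ₁) _ (ih₂ B₂ σ₂)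
    rw [gmul_hom_hom_of_disjoint _ _ hd, bin_map, O.map_map] at key
    convert key using 1
    apply O.hom_congr
    rintro (u | u) <;> rfl

theorem Twisted.eq_top_of_binMem {S : Set (O.obj (Fin 2))} (N : Submodule K (O.Twisted V))
    (hleaf : ∀ v, O.leaf v ∈ N) (hmul : ∀ μ ∈ S, ∀ a ∈ N, ∀ b ∈ N, O.gmul μ a b ∈ N)
    (hO : ∀ (U : Type) [Finite U] (x : O.obj U), BinMem O S U x) : N = ⊤ := by
  rw [eq_top_iff]
  rintro a -
  induction a using Twisted.induction with
  | h0 => exact N.zero_mem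
  | add a b ha hb => exact N.add_mem ha hb
  | hom B x =>
    have := Twisted.mem_of_binMem O N hleaf hmul (hO B x) B (Equiv.refl _)
    rwa [O.map_refl] at this

end Operad

end

noncomputable section

/-! ### Commutative binary trees -/

/-- Planar binary trees with labelled leaves. -/
inductive BTree (X : Type) : Type
  | leaf (x : X) : BTree X
  | node (l r : BTree X) : BTree X

namespace BTree

variable {X : Type}

/-- Equality of planar binary trees up to exchanging the two subtrees of any node. -/
def Equiv : BTree X → BTree X → Prop
  | leaf x, leaf y => x = y
  | node a b, node c d => (Equiv a c ∧ Equiv b d) ∨ (Equiv a d ∧ Equiv b c)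
  | leaf _, node _ _ => False
  | node _ _, leaf _ => False

theorem Equiv.refl (a : BTree X) : Equiv a a := by
  induction a with
  | leaf x => rfl
  | node l r hl hr => exact Or.inl ⟨hl, hr⟩

theorem Equiv.symm : ∀ {a b : BTree X}, Equiv a b → Equiv b a
  | leaf _, leaf _, h => Eq.symm (h : _ = _)
  | node _ _, node _ _, Or.inl ⟨h1, h2⟩ => Or.inl ⟨h1.symm, h2.symm⟩
  | node _ _, node _ _, Or.inr ⟨h1, h2⟩ => Or.inr ⟨h2.symm, h1.symm⟩

theorem Equiv.trans : ∀ {a b c : BTree X}, Equiv a b → Equiv b c → Equiv a c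
  | leaf _, leaf _, leaf _, h, h' => Eq.trans (h : _ = _) (h' : _ = _)
  | node _ _, node _ _, node _ _, Or.inl ⟨h1, h2⟩, Or.inl ⟨h3, h4⟩ =>
    Or.inl ⟨h1.trans h3, h2.trans h4⟩
  | node _ _, node _ _, node _ _, Or.inl ⟨h1, h2⟩, Or.inr ⟨h3, h4⟩ =>
    Or.inr ⟨h1.trans h3, h2.trans h4⟩
  | node _ _, node _ _, node _ _, Or.inr ⟨h1, h2⟩, Or.inl ⟨h3, h4⟩ =>
    Or.inr ⟨h1.trans h4, h2.trans h3⟩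
  | node _ _, node _ _, node _ _, Or.inr ⟨h1, h2⟩, Or.inr ⟨h3, h4⟩ =>
    Or.inl ⟨h1.trans h4, h2.trans h3⟩

/-- The setoid of planar binary trees up to `BTree.Equiv`. -/
def setoid (X : Type) : Setoid (BTree X) := ⟨Equiv, Equiv.refl, Equiv.symm, Equiv.trans⟩

/-- The value of a tree in a set with a constant for every label and a binary operation. -/
def fold {α : Type*} (f : X → α) (g : α → α → α) : BTree X → α
  | leaf x => f x
  | node l r => g (fold f g l) (fold f g r)

theorem fold_eq_of_equiv {α : Type*} (f : X → α) (g : α → α → α) (hg : ∀ a b, g a b = g b a) :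
    ∀ {a b : BTree X}, Equiv a b → fold f g a = fold f g b
  | leaf _, leaf _, h => congrArg f h
  | node _ _, node _ _, Or.inl ⟨h1, h2⟩ =>
    congrArg₂ g (fold_eq_of_equiv f g hg h1) (fold_eq_of_equiv f g hg h2)
  | node _ _, node _ _, Or.inr ⟨h1, h2⟩ =>
    (congrArg₂ g (fold_eq_of_equiv f g hg h1) (fold_eq_of_equiv f g hg h2)).trans (hg _ _)

end BTree

/-- Binary trees with labelled leaves, without an order on the subtrees of a node. -/
def CTree (X : Type) : Type := Quotient (BTree.setoid X)

namespace CTree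

variable {X : Type}

/-- The tree with one leaf. -/
def leaf (x : X) : CTree X := Quotient.mk _ (.leaf x)

/-- The tree whose root has the subtrees `a` and `b`. -/
def node (a b : CTree X) : CTree X :=
  Quotient.map₂ BTree.node (fun _ _ h _ _ h' => Or.inl ⟨h, h'⟩) a b

theorem node_comm (a b : CTree X) : node a b = node b a := by
  induction a using Quotient.inductionOn
  induction b using Quotient.inductionOn
  exact Quotient.sound (Or.inr ⟨BTree.Equiv.refl _, BTree.Equiv.refl _⟩)

theorem leaf_ne_node (x : X) (a b : CTree X) : leaf x ≠ node a b := by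
  induction a using Quotient.inductionOn
  induction b using Quotient.inductionOn
  intro h
  exact (Quotient.exact h : False)

theorem node_eq_node {a b c d : CTree X} (h : node a b = node c d) :
    (a = c ∧ b = d) ∨ (a = d ∧ b = c) := by
  induction a using Quotient.inductionOn
  induction b using Quotient.inductionOn
  induction c using Quotient.inductionOn
  induction d using Quotient.inductionOn
  rcases Quotient.exact h with ⟨h1, h2⟩ | ⟨h1, h2⟩
  · exact Or.inl ⟨Quotient.sound h1, Quotient.sound h2⟩
  · exact Or.inr ⟨Quotient.sound h1, Quotient.sound h2⟩

theorem induction {C : CTree X → Prop} (leaf : ∀ x, C (leaf x))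
    (node : ∀ a b, C a → C b → C (node a b)) (a : CTree X) : C a := by
  induction a using Quotient.inductionOn with
  | h a =>
    induction a with
    | leaf x => exact leaf x
    | node l r hl hr => exact node _ _ hl hr

/-- The value of a tree in a set with a constant for every label and a commutative operation. -/
def fold {α : Type*} (f : X → α) (g : α → α → α) (hg : ∀ a b, g a b = g b a) (a : CTree X) : α :=
  Quotient.lift (BTree.fold f g) (fun _ _ h => BTree.fold_eq_of_equiv f g hg h) a

theorem fold_node {α : Type*} (f : X → α) (g : α → α → α) (hg : ∀ a b, g a b = g b a)
    (a b : CTree X) : fold f g hg (node a b) = g (fold f g hg a) (fold f g hg b) := by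
  induction a using Quotient.inductionOn
  induction b using Quotient.inductionOn
  rfl

/-- The multiset of labels of the leaves. -/
def leaves : CTree X → Multiset X := fold (fun x => {x}) (· + ·) add_comm

@[simp] theorem leaves_leaf (x : X) : (leaf x).leaves = {x} := rfl

@[simp] theorem leaves_node (a b : CTree X) : (node a b).leaves = a.leaves + b.leaves :=
  fold_node _ _ _ _ _

theorem leaves_ne_zero (a : CTree X) : a.leaves ≠ 0 := by
  induction a using CTree.induction with
  | leaf x => simp
  | node a b ha hb => simp [ha]

/-- The sum of the symmetrized weights between two multisets of vertices. -/
def cross {K : Type*} [Field K] (w : X → X → K) (A B : Multiset X) : K :=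
  (A.map fun i => (B.map fun j => w i j * w j i).sum).sum

section cross

variable {K : Type*} [Field K] (w : X → X → K)

theorem cross_comm (A B : Multiset X) : cross w A B = cross w B A := by
  unfold cross
  rw [Multiset.sum_map_sum_map]
  simp only [mul_comm]

theorem cross_add_left (A A' B : Multiset X) : cross w (A + A') B = cross w A B + cross w A' B := by
  simp [cross]

theorem cross_add_right (A B B' : Multiset X) :
    cross w A (B + B') = cross w A B + cross w A B' := by
  rw [cross_comm, cross_add_left, cross_comm w B, cross_comm w B']

theorem cross_congr {w w' : X → X → K} {A B : Multiset X}
    (h : ∀ i ∈ A, ∀ j ∈ B, w i j * w j i = w' i j * w' j i) : cross w A B = cross w' A B := by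
  unfold cross
  exact congrArg _ (Multiset.map_congr rfl fun i hi =>
    congrArg _ (Multiset.map_congr rfl fun j hj => h i hi j hj))

theorem cross_eq_zero {A B : Multiset X} (h : ∀ i ∈ A, ∀ j ∈ B, w i j * w j i = 0) :
    cross w A B = 0 := by
  rw [cross_congr (w' := fun _ _ => 0) (by simpa using h)]
  simp [cross]

/-- The product over all internal nodes of the sums of the weights between the leaves of the two
subtrees; the total weight of all graphs occurring in the value of the tree in `𝕂G`. -/
def weight (a : CTree X) : K :=
  (fold (fun x => (({x} : Multiset X), (1 : K)))
    (fun a b => (a.1 + b.1, cross w a.1 b.1 * (a.2 * b.2)))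
    (fun a b => by rw [add_comm, cross_comm, mul_comm a.2]) a).2

@[simp] theorem weight_leaf (x : X) : weight w (leaf x) = 1 := rfl

@[simp] theorem weight_node (a b : CTree X) :
    weight w (node a b) = cross w a.leaves b.leaves * (weight w a * weight w b) := by
  have h : ∀ a : CTree X, (fold (fun x => (({x} : Multiset X), (1 : K)))
      (fun a b => (a.1 + b.1, cross w a.1 b.1 * (a.2 * b.2)))
      (fun a b => by rw [add_comm, cross_comm, mul_comm a.2]) a).1 = a.leaves := by
    intro a
    induction a using CTree.induction with
    | leaf x => rfl
    | node a b ha hb => rw [fold_node, leaves_node, ← ha, ← hb]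
  rw [weight, fold_node, h, h]
  rfl

theorem weight_congr {w w' : X → X → K} (a : CTree X)
    (h : ∀ i ∈ a.leaves, ∀ j ∈ a.leaves, w i j * w j i = w' i j * w' j i) :
    weight w a = weight w' a := by
  induction a using CTree.induction with
  | leaf x => rfl
  | node a b ha hb =>
    simp only [leaves_node, Multiset.mem_add] at h
    rw [weight_node, weight_node, ha fun i hi j hj => h i (Or.inl hi) j (Or.inl hj),
      hb fun i hi j hj => h i (Or.inr hi) j (Or.inr hj),
      cross_congr fun i hi j hj => h i (Or.inl hi) j (Or.inr hj)]

/-- If all weights between two sets vanish, so does the weight of a tree with leaves in both. -/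
theorem weight_eq_zero (p : X → Prop) (hw : ∀ i j, p i → ¬ p j → w i j * w j i = 0)
    (a : CTree X) (h1 : ∃ i ∈ a.leaves, p i) (h2 : ∃ j ∈ a.leaves, ¬ p j) : weight w a = 0 := by
  induction a using CTree.induction with
  | leaf x =>
    obtain ⟨i, hi, h1⟩ := h1
    obtain ⟨j, hj, h2⟩ := h2
    rw [leaves_leaf, Multiset.mem_singleton] at hi hj
    exact absurd (hi ▸ h1) (hj ▸ h2)
  | node a b ha hb =>
    rw [weight_node]
    -- Either a subtree has leaves of both kinds, and its weight vanishes by induction, or both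
    -- subtrees are pure, of opposite kinds, and the factor of the root vanishes.
    by_cases ha1 : ∃ i ∈ a.leaves, p i <;> by_cases ha2 : ∃ i ∈ a.leaves, ¬ p i
    · rw [ha ha1 ha2]; ring
    · by_cases hb1 : ∃ i ∈ b.leaves, p i
      · by_cases hb2 : ∃ i ∈ b.leaves, ¬ p i
        · rw [hb hb1 hb2]; ring
        · simp only [leaves_node, Multiset.mem_add] at h2
          obtain ⟨j, hj | hj, h2⟩ := h2
          · exact absurd ⟨j, hj, h2⟩ ha2
          · exact absurd ⟨j, hj, h2⟩ hb2
      · push Not at ha2 hb1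
        rw [cross_eq_zero w fun i hi j hj => hw i j (ha2 i hi) (hb1 j hj), zero_mul]
    · by_cases hb1 : ∃ i ∈ b.leaves, p i
      · by_cases hb2 : ∃ i ∈ b.leaves, ¬ p i
        · rw [hb hb1 hb2]; ring
        · push Not at ha1 hb2
          rw [cross_eq_zero w fun i hi j hj => (mul_comm _ _).trans
            (hw j i (hb2 j hj) (ha1 i hi)), zero_mul]
      · simp only [leaves_node, Multiset.mem_add] at h1
        obtain ⟨j, hj | hj, h1⟩ := h1
        · exact absurd ⟨j, hj, h1⟩ ha1
        · exact absurd ⟨j, hj, h1⟩ hb1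
    · push Not at ha1 ha2
      obtain ⟨i, hi⟩ := Multiset.exists_mem_of_ne_zero a.leaves_ne_zero
      exact absurd (ha2 i hi) (ha1 i hi)

end cross

/-! ### Words of trees -/

/-- The tree obtained from `a` by successively joining the trees of a word. -/
def comb (a : CTree X) (z : List (CTree X)) : CTree X := z.foldl node a

@[simp] theorem comb_nil (a : CTree X) : comb a [] = a := rfl

@[simp] theorem comb_cons (a b : CTree X) (z : List (CTree X)) :
    comb a (b :: z) = comb (node a b) z := rfl

@[simp] theorem comb_concat (a b : CTree X) (z : List (CTree X)) :
    comb a (z ++ [b]) = node (comb a z) b := by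
  simp [comb]

/-- The multiset of labels of the leaves of the trees of a word. -/
def wordLeaves (z : List (CTree X)) : Multiset X := (z.map leaves).sum

@[simp] theorem wordLeaves_nil : wordLeaves ([] : List (CTree X)) = 0 := rfl

@[simp] theorem wordLeaves_cons (a : CTree X) (z : List (CTree X)) :
    wordLeaves (a :: z) = a.leaves + wordLeaves z := by simp [wordLeaves]

@[simp] theorem wordLeaves_append (y z : List (CTree X)) :
    wordLeaves (y ++ z) = wordLeaves y + wordLeaves z := by simp [wordLeaves]

theorem wordLeaves_perm {y z : List (CTree X)} (h : y.Perm z) : wordLeaves y = wordLeaves z :=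
  (h.map _).sum_eq

theorem mem_wordLeaves {z : List (CTree X)} {x : X} :
    x ∈ wordLeaves z ↔ ∃ a ∈ z, x ∈ a.leaves := by
  induction z with
  | nil => simp
  | cons a z h => simp [h]

theorem wordLeaves_ne_zero {z : List (CTree X)} (hz : z ≠ []) : wordLeaves z ≠ 0 := by
  cases z with
  | nil => exact absurd rfl hz
  | cons a z => simp [leaves_ne_zero]

@[simp] theorem leaves_comb (a : CTree X) (z : List (CTree X)) :
    (comb a z).leaves = a.leaves + wordLeaves z := by
  induction z generalizing a with
  | nil => simp
  | cons b z h => rw [comb_cons, h, leaves_node, wordLeaves_cons, add_assoc]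

theorem length_le_card_wordLeaves (z : List (CTree X)) : z.length ≤ (wordLeaves z).card := by
  induction z with
  | nil => simp
  | cons a z h =>
    have := Multiset.card_pos.2 a.leaves_ne_zero
    simp only [List.length_cons, wordLeaves_cons, Multiset.card_add]
    omega

/-- Any tree with a leaf labelled `u` is obtained from that leaf by successively joining the trees
of a word. -/
theorem exists_comb (a : CTree X) {u : X} (hu : u ∈ a.leaves) :
    ∃ z, a = comb (leaf u) z := by
  induction a using CTree.induction with
  | leaf x =>
    rw [leaves_leaf, Multiset.mem_singleton] at hu
    exact ⟨[], by rw [hu, comb_nil]⟩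
  | node a b ha hb =>
    rw [leaves_node, Multiset.mem_add] at hu
    rcases hu with hu | hu
    · obtain ⟨z, rfl⟩ := ha hu
      exact ⟨z ++ [b], by simp⟩
    · obtain ⟨z, rfl⟩ := hb hu
      exact ⟨z ++ [a], by simp [node_comm]⟩

/-- The branches along the path from a leaf `u` to the root form a well-determined word as long as
`u` does not occur in the branches removed. Comparing last letters, the exchanged case of
`node_eq_node` would put `u` into `z`. The lemma identifies the words that join to a given tree. -/
theorem eq_of_comb_eq_comb {u : X} {a : CTree X} (z y : List (CTree X))
    (hz : u ∉ wordLeaves z) (h : comb a z = comb (leaf u) y) :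
    ∃ j ≤ y.length, a = comb (leaf u) (y.take j) ∧ z = y.drop j := by
  induction z using List.reverseRecOn generalizing y with
  | nil => exact ⟨y.length, le_rfl, by simpa using h, by simp⟩
  | append_singleton z b ih =>
    rcases List.eq_nil_or_concat y with rfl | ⟨y, c, rfl⟩
    · rw [comb_concat, comb_nil] at h
      exact absurd h.symm (leaf_ne_node _ _ _)
    · rw [List.concat_eq_append, comb_concat, comb_concat] at h
      simp only [wordLeaves_append, wordLeaves_cons, wordLeaves_nil, add_zero, Multiset.mem_add,
        not_or] at hz
      rcases node_eq_node h with ⟨h1, h2⟩ | ⟨h1, h2⟩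
      · obtain ⟨j, hj, h3, h4⟩ := ih y hz.1 h1
        refine ⟨j, by simp; omega, ?_, ?_⟩
        · rw [List.concat_eq_append, List.take_append_of_le_length hj, h3]
        · rw [List.concat_eq_append, List.drop_append_of_le_length hj, h4, h2]
      · refine absurd ?_ hz.2
        rw [h2]
        simp

variable {K : Type*} [Field K]

/-- The factor by which the weight of a tree with leaves `M` is multiplied when the trees of a word
are joined successively. -/
def wordWeight (w : X → X → K) : Multiset X → List (CTree X) → K
  | _, [] => 1
  | M, a :: z => cross w M a.leaves * weight w a * wordWeight w (M + a.leaves) z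

theorem weight_comb (w : X → X → K) (a : CTree X) (z : List (CTree X)) :
    weight w (comb a z) = weight w a * wordWeight w a.leaves z := by
  induction z generalizing a with
  | nil => simp [wordWeight]
  | cons b z h =>
    rw [comb_cons, h, weight_node, leaves_node, wordWeight]
    ring

/-- The initial multiset matters only through its cross sums with the letters. This allows `v` to be
dropped from it once `v` has no weight with any of them. -/
theorem wordWeight_congr {w w' : X → X → K} (M M' : Multiset X) (z : List (CTree X))
    (h : ∀ i ∈ wordLeaves z, ∀ j ∈ wordLeaves z, w i j * w j i = w' i j * w' j i)
    (hM : ∀ a ∈ z, cross w M a.leaves = cross w' M' a.leaves) :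
    wordWeight w M z = wordWeight w' M' z := by
  induction z generalizing M M' with
  | nil => rfl
  | cons a z ih =>
    simp only [wordLeaves_cons, Multiset.mem_add] at h
    rw [wordWeight, wordWeight, hM a List.mem_cons_self,
      weight_congr a fun i hi j hj => h i (Or.inl hi) j (Or.inl hj),
      ih (M + a.leaves) (M' + a.leaves) fun i hi j hj => h i (Or.inr hi) j (Or.inr hj)]
    intro b hb
    rw [cross_add_left, cross_add_left, hM b (List.mem_cons_of_mem _ hb)]
    congr 1
    exact cross_congr fun i hi j hj => h i (Or.inl hi) j
      (Or.inr (mem_wordLeaves.2 ⟨b, hb, hj⟩))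

end CTree

end

noncomputable section

/-! ### Shuffles -/

/-- The sum of the values of a function on all shuffles of two words. -/
def shuffleSum {α K : Type*} [Field K] : (List α → K) → List α → List α → K
  | f, [], y => f y
  | f, a :: x, [] => f (a :: x)
  | f, a :: x, b :: y =>
    shuffleSum (fun z => f (a :: z)) x (b :: y) + shuffleSum (fun z => f (b :: z)) (a :: x) y
termination_by _ x y => x.length + y.length

namespace shuffleSum

variable {α K : Type*} [Field K]

@[simp] theorem nil_left (f : List α → K) (y : List α) : shuffleSum f [] y = f y := by
  rw [shuffleSum]

@[simp] theorem nil_right (f : List α → K) (x : List α) : shuffleSum f x [] = f x := by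
  cases x <;> rw [shuffleSum]

theorem cons_cons (f : List α → K) (a b : α) (x y : List α) :
    shuffleSum f (a :: x) (b :: y) =
      shuffleSum (fun z => f (a :: z)) x (b :: y) +
        shuffleSum (fun z => f (b :: z)) (a :: x) y := by
  rw [shuffleSum]

/-- All shuffles are rearrangements of `x ++ y`, so a function may be changed on words of other
lengths or with other leaves. -/
theorem congr {f g : List α → K} (x y : List α) (h : ∀ z, z.Perm (x ++ y) → f z = g z) :
    shuffleSum f x y = shuffleSum g x y := by
  match x, y with
  | [], y => simpa using h y (by simp)
  | a :: x, [] => simpa using h (a :: x) (by simp)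
  | a :: x, b :: y =>
    rw [cons_cons, cons_cons]
    congr 1
    · exact congr x (b :: y) fun z hz => h _ (hz.cons a)
    · refine congr (a :: x) y fun z hz => h _ ?_
      exact (hz.cons b).trans List.perm_middle.symm
termination_by x.length + y.length

theorem zero (x y : List α) : shuffleSum (fun _ => (0 : K)) x y = 0 := by
  match x, y with
  | [], y => simp
  | a :: x, [] => simp
  | a :: x, b :: y => rw [cons_cons, zero, zero, add_zero]
termination_by x.length + y.length

theorem add (f g : List α → K) (x y : List α) :
    shuffleSum (fun z => f z + g z) x y = shuffleSum f x y + shuffleSum g x y := by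
  match x, y with
  | [], y => simp
  | a :: x, [] => simp
  | a :: x, b :: y =>
    rw [cons_cons, cons_cons, cons_cons, add, add]
    ring
termination_by x.length + y.length

/-- Moving the letters in front of `x` behind it, for a function vanishing on proper shuffles. -/
theorem reverse_append {f : List α → K}
    (hf : ∀ x y : List α, x ≠ [] → y ≠ [] → shuffleSum f x y = 0) (u : List α) (x : α)
    (v : List α) :
    f (u.reverse ++ x :: v) = (-1) ^ u.length * shuffleSum (fun z => f (x :: z)) u v := by
  induction u generalizing x v with
  | nil => simp
  | cons a u ih =>
    -- Sorted by the first letter, the shuffles of `a :: u` and `x :: v` begin with `a` or with `x`;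
    -- the two partial sums are opposite, which accounts for one sign per letter moved.
    have h := hf (a :: u) (x :: v) (by simp) (by simp)
    rw [cons_cons] at h
    rw [List.reverse_cons, List.append_assoc, List.singleton_append, ih,
      eq_neg_of_add_eq_zero_left h, List.length_cons, pow_succ]
    ring

/-- Expand `reverse_append` for `a :: u` and `y :: v` by first letters. The shuffles then begin with
`x, a` or with `x, y`; the former are turned into `a, x` by symmetry and evaluated by induction, so
each letter of `u` raises the coefficient by one. -/
theorem cons_cons_of_symm {f : List α → K}
    (hf : ∀ x y : List α, x ≠ [] → y ≠ [] → shuffleSum f x y = 0)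
    (hs : ∀ a b r, f (a :: b :: r) = f (b :: a :: r)) (u : List α) (x y : α) (v : List α) :
    shuffleSum (fun z => f (x :: y :: z)) u v =
      (-1) ^ u.length * (u.length + 1) * f (u.reverse ++ x :: y :: v) := by
  induction u generalizing x y v with
  | nil => simp
  | cons a u ih =>
    have h1 := reverse_append hf (a :: u) x (y :: v)
    rw [cons_cons] at h1
    have h2 := ih a x (y :: v)
    simp only [hs a x] at h2
    rw [h2] at h1
    have h3 : (a :: u).reverse ++ x :: y :: v = u.reverse ++ a :: x :: y :: v := by simp
    have h4 : ((-1 : K) ^ u.length) * (-1) ^ u.length = 1 := by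
      rw [← mul_pow]; simp
    rw [h3] at h1 ⊢
    rw [List.length_cons, pow_succ] at h1 ⊢
    push_cast
    linear_combination (-1) ^ u.length * h1 -
      (shuffleSum (fun z ↦ f (x :: y :: z)) (a :: u) v) * h4 -
      (-1) ^ u.length * (u.length + 1) * f (u.reverse ++ a :: x :: y :: v) * h4

/-- A function on words that vanishes on proper shuffles and is symmetric in the first two letters
is zero on words with at least two letters. -/
theorem eq_zero_of_symm [CharZero K] {f : List α → K}
    (hf : ∀ x y : List α, x ≠ [] → y ≠ [] → shuffleSum f x y = 0)
    (hs : ∀ a b r, f (a :: b :: r) = f (b :: a :: r)) (z : List α) (hz : 2 ≤ z.length) :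
    f z = 0 := by
  obtain ⟨x, u, h⟩ : ∃ x u, z.reverse = x :: u := by
    rcases h : z.reverse with _ | ⟨x, u⟩
    · rw [List.reverse_eq_nil_iff] at h
      simp [h] at hz
    · exact ⟨x, u, rfl⟩
  obtain ⟨a, v, rfl⟩ : ∃ a v, u = a :: v := by
    rcases u with _ | ⟨a, v⟩
    · have := congrArg List.length h
      simp at this
      omega
    · exact ⟨a, v, rfl⟩
  have hz' : z = (a :: v).reverse ++ [x] := by
    rw [← List.reverse_reverse z, h]; simp
  -- The value at the word `a, x, v` is computed twice: as `(-1)^(|v| + 1) * f z` by the reversal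
  -- formula, and as `(-1)^|v| * (|v| + 1) * f z` by `cons_cons_of_symm`. The difference is `(|v| +
  -- 2) * f z = 0`, and here characteristic zero enters.
  have h1 := reverse_append hf (a :: v) x []
  rw [nil_right, hs] at h1
  have h2 := cons_cons_of_symm hf hs v a x []
  rw [nil_right] at h2
  have h3 : v.reverse ++ a :: x :: [] = (a :: v).reverse ++ [x] := by simp
  rw [h3, ← hz'] at h2
  rw [← hz', h2, List.length_cons, pow_succ] at h1
  have h4 : ((-1 : K) ^ v.length) * (-1) ^ v.length = 1 := by
    rw [← mul_pow]; simp
  have h5 : ((v.length : K) + 2) * f z = 0 := by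
    linear_combination h1 - (v.length + 1) * f z * h4
  have h6 : ((v.length : K) + 2) ≠ 0 := by exact_mod_cast (by omega : v.length + 2 ≠ 0)
  exact (mul_eq_zero.1 h5).resolve_left h6

open Classical in
/-- A sum over shuffles of words in disjoint alphabets as a sum over a fibre. -/
theorem eq_sum (p q : α → Prop) (hpq : ∀ a, p a → ¬ q a) (c : List α →₀ K) (x y : List α)
    (hx : ∀ a ∈ x, p a) (hy : ∀ a ∈ y, q a) :
    shuffleSum (⇑c) x y = c.sum fun z k =>
      if (∀ a ∈ z, p a ∨ q a) ∧ z.filter (fun a => decide (p a)) = x ∧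
        z.filter (fun a => decide (q a)) = y then k else 0 := by
  -- By linearity `c` is concentrated on one word. In disjoint alphabets this word is a shuffle of
  -- `x` and `y` exactly if its two subwords are `x` and `y`, and then in only one way.
  induction c using Finsupp.induction_linear with
  | zero => rw [Finsupp.sum_zero_index]; exact zero x y
  | add f g hf hg =>
    rw [Finsupp.sum_add_index' (fun _ => by simp) (fun _ b₁ b₂ => by split_ifs <;> simp),
      ← hf, ← hg, ← add]
    rfl
  | single z k =>
    rw [Finsupp.sum_single_index (by simp)]
    -- Fixing the first letter of the shuffle removes the first letter of the word carrying the
    -- coefficient, if the two agree.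
    have hcons : ∀ (a : α) (z : List α), (fun z' => (Finsupp.single z k) (a :: z')) =
        match z with
        | [] => fun _ => 0
        | b :: z => if b = a then ⇑(Finsupp.single z k) else fun _ => 0 := by
      intro a z
      funext z'
      cases z with
      | nil => simp
      | cons b z =>
        by_cases h : b = a
        · simp [Finsupp.single_apply, h]
        · simp [h]
    induction z generalizing x y with
    | nil =>
      match x, y with
      | [], [] => simp
      | [], b :: y => simp
      | a :: x, [] => simp
      | a :: x, b :: y => rw [cons_cons, hcons, hcons, zero, zero]; simp
    | cons s z ih =>
      match x, y with
      | [], y =>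
        rw [nil_left, Finsupp.single_apply]
        congr 1
        rw [eq_iff_iff]
        constructor
        · intro h
          rw [h]
          refine ⟨fun a ha => Or.inr (hy a ha), ?_, ?_⟩
          · rw [List.filter_eq_nil_iff]
            intro a ha hp
            exact hpq a (by simpa using hp) (hy a ha)
          · rw [List.filter_eq_self]
            intro a ha
            simpa using hy a ha
        · rintro ⟨h1, h2, h3⟩
          rw [← h3, eq_comm, List.filter_eq_self]
          intro a ha
          rw [List.filter_eq_nil_iff] at h2
          have := h2 a ha
          have := h1 a ha
          simp_all
      | a :: x, [] =>
        rw [nil_right, Finsupp.single_apply]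
        congr 1
        rw [eq_iff_iff]
        constructor
        · intro h
          rw [h]
          refine ⟨fun a ha => Or.inl (hx a ha), ?_, ?_⟩
          · rw [List.filter_eq_self]
            intro a ha
            simpa using hx a ha
          · rw [List.filter_eq_nil_iff]
            intro a ha hp
            exact hpq a (hx a ha) (by simpa using hp)
        · rintro ⟨h1, h2, h3⟩
          rw [← h2, eq_comm, List.filter_eq_self]
          intro a ha
          rw [List.filter_eq_nil_iff] at h3
          have := h3 a ha
          have := h1 a ha
          simp_all
      | a :: x, b :: y =>
        have ha : p a := hx a List.mem_cons_self
        have hb : q b := hy b List.mem_cons_self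
        have hx' : ∀ a ∈ x, p a := fun c hc => hx c (List.mem_cons_of_mem _ hc)
        have hy' : ∀ a ∈ y, q a := fun c hc => hy c (List.mem_cons_of_mem _ hc)
        rw [cons_cons, hcons, hcons]
        by_cases h1 : s = a
        · subst h1
          have h2 : s ≠ b := fun h => hpq s ha (h ▸ hb)
          simp only [if_true, if_neg h2, zero, add_zero]
          rw [ih x (b :: y) hx' hy]
          congr 1
          simp [ha, hpq s ha]
        · by_cases h2 : s = b
          · subst h2
            have h3 : ¬ p s := fun h => hpq s h hb
            simp only [if_true, if_neg h1, zero, zero_add]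
            rw [ih (a :: x) y hx hy']
            congr 1
            simp [hb, h3]
          · simp only [if_neg h1, if_neg h2, zero, zero_add]
            rw [if_neg]
            rintro ⟨h3, h4, h5⟩
            rcases h3 s List.mem_cons_self with h | h
            · rw [List.filter_cons_of_pos (by simpa using h)] at h4
              exact h1 (List.cons.inj h4).1
            · rw [List.filter_cons_of_pos (by simpa using h)] at h5
              exact h2 (List.cons.inj h5).1

end shuffleSum

namespace CTree

variable {X : Type} {K : Type*} [Field K]

/-- The sum of the values of a function on all words arising from `s, y₁, …, yₘ` by replacing
an initial segment by the tree obtained by joining its trees. -/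
def joinSum (f : List (CTree X) → K) (s : CTree X) (y : List (CTree X)) : K :=
  ∑ j ∈ Finset.range (y.length + 1), f (comb s (y.take j) :: y.drop j)

@[simp] theorem joinSum_nil (f : List (CTree X) → K) (s : CTree X) : joinSum f s [] = f [s] := by
  simp [joinSum]

theorem joinSum_cons (f : List (CTree X) → K) (s b : CTree X) (y : List (CTree X)) :
    joinSum f s (b :: y) = f (s :: b :: y) + joinSum f (node s b) y := by
  rw [joinSum, Finset.sum_range_succ', add_comm]
  rfl

/-- The terms in which only a proper initial part of `x` has been joined are values of `f` on words
that are too long. In this way the vanishing of `joinSum` passes from leaves to arbitrary first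
letters. -/
theorem joinSum_append {f : List (CTree X) → K} {y : List (CTree X)}
    (hf : ∀ z : List (CTree X), y.length + 1 < z.length → f z = 0) (s : CTree X)
    (x : List (CTree X)) : joinSum f s (x ++ y) = joinSum f (comb s x) y := by
  induction x generalizing s with
  | nil => rfl
  | cons a x ih =>
    rw [List.cons_append, joinSum_cons, ih, comb_cons, hf _ (by simp), zero_add]

/-- A function on words of trees that vanishes on proper shuffles and whose sums `joinSum`
starting from a leaf vanish is zero. -/
theorem eq_zero_of_shuffleSum_of_joinSum [CharZero K] (f : List (CTree X) → K) (N : ℕ)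
    (hN : ∀ z : List (CTree X), N < z.length → f z = 0) (h0 : f [] = 0)
    (h1 : ∀ x y : List (CTree X), x ≠ [] → y ≠ [] → shuffleSum f x y = 0)
    (h2 : ∀ (u : X) (y : List (CTree X)), joinSum f (leaf u) y = 0) (z : List (CTree X)) :
    f z = 0 := by
  -- Descending induction on the length: `f` vanishes on all words longer than `m`, starting from `m
  -- = N`.
  suffices h : ∀ k m, N ≤ m + k → ∀ z : List (CTree X), m < z.length → f z = 0 by
    rcases z with _ | ⟨a, z⟩
    · exact h0
    · exact h N 0 (by omega) _ (by simp)
  intro k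
  induction k with
  | zero => intro m hm z hz; exact hN z (by omega)
  | succ k ih =>
    intro m hm
    have ih' := ih (m + 1) (by omega)
    -- Any tree arises from one of its leaves by joining a word, and longer words contribute
    -- nothing, so the hypothesis on leaves extends to every first letter `s`.
    have hj : ∀ (s : CTree X) (y : List (CTree X)), y.length = m → joinSum f s y = 0 := by
      intro s y hy
      obtain ⟨u, hu⟩ := Multiset.exists_mem_of_ne_zero s.leaves_ne_zero
      obtain ⟨x, rfl⟩ := exists_comb s hu
      rw [← joinSum_append, h2]
      intro z hz
      exact ih' z (by omega)
    intro z hz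
    by_cases hz' : m + 1 < z.length
    · exact ih' z hz'
    have hz'' : z.length = m + 1 := by omega
    rcases m with _ | m
    · obtain ⟨s, rfl⟩ := List.length_eq_one_iff.1 hz''
      simpa using hj s [] rfl
    -- The join sums that start with `a, b` and with `b, a` agree after the first term because `node
    -- a b = node b a`; hence so do the first terms.
    · have hs : ∀ a b (r : List (CTree X)), r.length = m → f (a :: b :: r) = f (b :: a :: r) := by
        intro a b r hr
        have e1 := hj a (b :: r) (by simp [hr])
        have e2 := hj b (a :: r) (by simp [hr])
        rw [joinSum_cons] at e1 e2
        rw [node_comm] at e2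
        exact add_right_cancel (e1.trans e2.symm)
      -- Symmetry is known only at length `m + 2`, so `f` is cut off to this length.
      let g : List (CTree X) → K := fun z => if z.length = m + 2 then f z else 0
      have hg : g z = 0 := by
        refine shuffleSum.eq_zero_of_symm ?_ ?_ z (by omega)
        · intro x y hx hy
          by_cases hl : x.length + y.length = m + 2
          · rw [shuffleSum.congr (g := f), h1 x y hx hy]
            intro z hz
            exact if_pos (by rw [hz.length_eq, List.length_append, hl])
          · rw [shuffleSum.congr (g := fun _ => 0), shuffleSum.zero]
            intro z hz
            exact if_neg (by rw [hz.length_eq, List.length_append]; exact hl)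
        · intro a b r
          by_cases hr : r.length = m
          · simp only [g, List.length_cons, hr, hs a b r hr]
          · simp [g, hr]
      simpa [g, hz''] using hg

end CTree

end

noncomputable section

/-! ### Linear independence of the weights of trees -/

namespace CTree

variable {X : Type} {K : Type*} [Field K]

/-- The weight of a tree sees only the pairs of its own leaves, so the vanishing of weights is
needed only there. -/
theorem weight_eq_zero_of_mem (w : X → X → K) (p : X → Prop) (a : CTree X)
    (hw : ∀ i ∈ a.leaves, ∀ j ∈ a.leaves, p i → ¬ p j → w i j * w j i = 0)
    (h1 : ∃ i ∈ a.leaves, p i) (h2 : ∃ j ∈ a.leaves, ¬ p j) : weight w a = 0 := by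
  classical
  rw [weight_congr (w' := fun i j => if (p i ↔ p j) then w i j else 0)]
  · refine weight_eq_zero _ p (fun i j hi hj => ?_) a h1 h2
    simp [hi, hj]
  · intro i hi j hj
    by_cases hp : p i <;> by_cases hq : p j <;> simp only [hp, hq, iff_true, iff_false,
      not_true, if_true, if_false, mul_zero]
    · exact hw i hi j hj hp hq
    · exact (mul_comm _ _).trans (hw j hj i hi hq hp)

open Classical in
/-- A word of trees whose leaves lie in two sets without weights between them. -/
theorem wordWeight_eq_mul (w w₁ w₂ : X → X → K) (p q : X → Prop) (hpq : ∀ i, p i → ¬ q i)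
    (P Q : CTree X → Prop) (hP : ∀ a, P a ↔ ∀ i ∈ a.leaves, p i)
    (hQ : ∀ a, Q a ↔ ∀ i ∈ a.leaves, q i) (M M₁ M₂ : Multiset X)
    (h1 : ∀ i, p i ∨ i ∈ M → ∀ j, p j → w i j * w j i = w₁ i j * w₁ j i)
    (h2 : ∀ i, q i ∨ i ∈ M → ∀ j, q j → w i j * w j i = w₂ i j * w₂ j i)
    (h3 : ∀ i j, p i → q j → w i j * w j i = 0)
    (hM₁ : ∀ i ∈ M₁, p i) (hM₂ : ∀ i ∈ M₂, q i) (z : List (CTree X))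
    (hz : ∀ i ∈ wordLeaves z, p i ∨ q i) :
    wordWeight w (M + M₁ + M₂) z =
      if ∀ a ∈ z, P a ∨ Q a then
        wordWeight w₁ (M + M₁) (z.filter fun a => decide (P a)) *
          wordWeight w₂ (M + M₂) (z.filter fun a => decide (Q a))
      else 0 := by
  induction z generalizing M₁ M₂ with
  | nil => simp [wordWeight]
  | cons a z ih =>
    simp only [wordLeaves_cons, Multiset.mem_add] at hz
    obtain ⟨l, hl⟩ := Multiset.exists_mem_of_ne_zero a.leaves_ne_zero
    have hz' : ∀ i ∈ wordLeaves z, p i ∨ q i := fun i hi => hz i (Or.inr hi)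
    simp only [List.forall_mem_cons]
    -- `M₁` and `M₂` collect the leaves already joined on the two sides. A pure letter meets only
    -- `M` and its own side.
    by_cases hp' : P a
    · have hp := (hP a).1 hp'
      have hq' : ¬ Q a := fun hq => hpq l (hp l hl) ((hQ a).1 hq l hl)
      have e : M + M₁ + M₂ + a.leaves = M + (M₁ + a.leaves) + M₂ := by
        simp only [add_assoc, add_comm M₂]
      rw [wordWeight, e, ih (M₁ + a.leaves) M₂
        (fun i hi => (Multiset.mem_add.1 hi).elim (hM₁ i) (hp i)) hM₂ hz',
        List.filter_cons_of_pos (by simpa using hp'), List.filter_cons_of_neg (by simpa using hq'),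
        wordWeight, cross_add_left _ _ M₂, cross_eq_zero w (A := M₂) (fun i hi j hj =>
          (mul_comm _ _).trans (h3 j i (hp j hj) (hM₂ i hi))), add_zero,
        cross_congr (w' := w₁) (A := M + M₁) (fun i hi j hj => h1 i ((Multiset.mem_add.1 hi).elim
          Or.inr fun hi => Or.inl (hM₁ i hi)) j (hp j hj)),
        weight_congr (w' := w₁) a (fun i hi j hj => h1 i (Or.inl (hp i hi)) j (hp j hj)),
        add_assoc]
      simp only [hp', true_or, true_and]
      split_ifs <;> ring
    · by_cases hq' : Q a
      · have hq := (hQ a).1 hq'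
        have e : M + M₁ + M₂ + a.leaves = M + M₁ + (M₂ + a.leaves) := by
          simp only [add_assoc]
        rw [wordWeight, e, ih M₁ (M₂ + a.leaves) hM₁
          (fun i hi => (Multiset.mem_add.1 hi).elim (hM₂ i) (hq i)) hz',
          List.filter_cons_of_neg (by simpa using hp'), List.filter_cons_of_pos
              (by simpa using hq'),
          wordWeight, add_right_comm, cross_add_left _ _ M₁, cross_eq_zero w (A := M₁)
            (fun i hi j hj => h3 i j (hM₁ i hi) (hq j hj)), add_zero,
          cross_congr (w' := w₂) (A := M + M₂) (fun i hi j hj => h2 i ((Multiset.mem_add.1 hi).elim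
            Or.inr fun hi => Or.inl (hM₂ i hi)) j (hq j hj)),
          weight_congr (w' := w₂) a (fun i hi j hj => h2 i (Or.inl (hq i hi)) j (hq j hj)),
          add_assoc]
        simp only [hq', or_true, true_and]
        split_ifs <;> ring
      -- A letter with leaves on both sides has weight zero.
      · rw [if_neg (by tauto), wordWeight, weight_eq_zero_of_mem w p a]
        · ring
        · intro i hi j hj hpi hpj
          exact h3 i j hpi ((hz j (Or.inl hj)).resolve_left hpj)
        · rw [hQ] at hq'
          push Not at hq'
          obtain ⟨j, hj, hq⟩ := hq'
          exact ⟨j, hj, (hz j (Or.inl hj)).resolve_right hq⟩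
        · rw [hP] at hp'
          push Not at hp'
          exact hp'

/-- The weights of the words of trees with leaves `W` are linearly independent. -/
def WordsIndependent (K : Type*) [Field K] {X : Type} (v : X) (W : Multiset X) : Prop :=
  ∀ (ι : Type) (s : Finset ι) (z : ι → List (CTree X)) (k : ι → K),
    (∀ i ∈ s, wordLeaves (z i) = W) →
    (∀ w : X → X → K, ∑ i ∈ s, k i * wordWeight w {v} (z i) = 0) →
    ∀ f : List (CTree X) → K, ∑ i ∈ s, k i * f (z i) = 0

/-- The weights of the trees with leaves `V` are linearly independent. -/
def TreesIndependent (K : Type*) [Field K] {X : Type} (V : Multiset X) : Prop :=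
  ∀ (ι : Type) (s : Finset ι) (T : ι → CTree X) (k : ι → K),
    (∀ i ∈ s, (T i).leaves = V) →
    (∀ w : X → X → K, ∑ i ∈ s, k i * weight w (T i) = 0) →
    ∀ f : CTree X → K, ∑ i ∈ s, k i * f (T i) = 0

/-- Rooting every tree at its leaf `v` turns it into a word with the same weight. In both notions of
independence, testing on all functions `f` expresses that the total coefficient of each word or tree
vanishes. -/
theorem treesIndependent_of_wordsIndependent {v : X} {W : Multiset X}
    (h : WordsIndependent K v W) : TreesIndependent K (v ::ₘ W) := by
  intro ι s T k hT hw f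
  have hz : ∀ i, ∃ z, i ∈ s → T i = comb (leaf v) z := by
    intro i
    by_cases hi : i ∈ s
    · obtain ⟨z, hz⟩ := exists_comb (T i) (u := v) (by rw [hT i hi]; simp)
      exact ⟨z, fun _ => hz⟩
    · exact ⟨[], fun h => absurd h hi⟩
  choose z hz using hz
  rw [← h ι s z k ?_ ?_ (fun z => f (comb (leaf v) z))]
  · exact Finset.sum_congr rfl fun i hi => by rw [hz i hi]
  · intro i hi
    have := hT i hi
    rw [hz i hi, leaves_comb, leaves_leaf, Multiset.singleton_add] at this
    exact (Multiset.cons_inj_right v).1 this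
  · intro w
    rw [← hw w]
    exact Finset.sum_congr rfl fun i hi => by
      rw [hz i hi, weight_comb, weight_leaf, one_mul, leaves_leaf]

-- With no weights between `A` and `B`, the weight of a word is the product of the weights of its
-- `A`-part and its `B`-part. The independence for `A`, and then for `B`, extracts the coefficients
-- of the words with parts `x` and `y`, which are the shuffles of `x` and `y`.
open Classical in
theorem shuffleSum_eq_zero {v : X} {A B : Multiset X} (hn : (v ::ₘ (A + B)).Nodup)
    (hA : WordsIndependent K v A) (hB : WordsIndependent K v B)
    {ι : Type} (s : Finset ι) (z : ι → List (CTree X)) (k : ι → K)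
    (hz : ∀ i ∈ s, wordLeaves (z i) = A + B)
    (hw : ∀ w : X → X → K, ∑ i ∈ s, k i * wordWeight w {v} (z i) = 0)
    (x y : List (CTree X)) (hx : wordLeaves x = A) (hy : wordLeaves y = B) :
    shuffleSum (⇑(∑ i ∈ s, Finsupp.single (z i) (k i))) x y = 0 := by
  rw [Multiset.nodup_cons, Multiset.nodup_add] at hn
  obtain ⟨hv, hnA, hnB, hAB⟩ := hn
  rw [Multiset.mem_add, not_or] at hv
  rw [Multiset.disjoint_left] at hAB
  obtain ⟨p, hp⟩ : ∃ p : CTree X → Prop, ∀ a, p a ↔ ∀ i ∈ a.leaves, i ∈ A := ⟨_, fun _ => Iff.rfl⟩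
  obtain ⟨q, hq⟩ : ∃ q : CTree X → Prop, ∀ a, q a ↔ ∀ i ∈ a.leaves, i ∈ B := ⟨_, fun _ => Iff.rfl⟩
  have hpq : ∀ a, p a → ¬ q a := by
    intro a ha ha'
    obtain ⟨l, hl⟩ := Multiset.exists_mem_of_ne_zero a.leaves_ne_zero
    exact hAB ((hp a).1 ha l hl) ((hq a).1 ha' l hl)
  rw [shuffleSum.eq_sum p q hpq _ x y
    (fun a ha => (hp a).2 fun i hi => hx ▸ mem_wordLeaves.2 ⟨a, ha, hi⟩)
    (fun a ha => (hq a).2 fun i hi => hy ▸ mem_wordLeaves.2 ⟨a, ha, hi⟩),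
    ← Finsupp.sum_finsetSum_index (fun _ => by simp) (fun _ b₁ b₂ => by split_ifs <;> simp)]
  simp only [Finsupp.sum_single_index, ite_self]
  -- Words containing a tree with leaves in both sets have weight zero and drop out.
  let s' := s.filter fun i => ∀ a ∈ z i, p a ∨ q a
  have hsplit : ∀ z : List (CTree X), (∀ a ∈ z, p a ∨ q a) →
      wordLeaves z = wordLeaves (z.filter fun a => decide (p a)) +
        wordLeaves (z.filter fun a => decide (q a)) := by
    intro z hz
    induction z with
    | nil => simp
    | cons a z ih =>
      rw [List.forall_mem_cons] at hz
      have ih := ih hz.2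
      rcases hz.1 with h | h
      · rw [List.filter_cons_of_pos (by simpa using h),
          List.filter_cons_of_neg (by simpa using hpq a h), wordLeaves_cons, wordLeaves_cons, ih,
          add_assoc]
      · rw [List.filter_cons_of_neg (by simpa using fun h' => hpq a h' h),
          List.filter_cons_of_pos (by simpa using h), wordLeaves_cons, wordLeaves_cons, ih,
          add_left_comm]
  have hfA : ∀ (z : List (CTree X)) (j : X),
      j ∈ wordLeaves (z.filter fun a => decide (p a)) → j ∈ A := by
    intro z j hj
    obtain ⟨a, ha, hj⟩ := mem_wordLeaves.1 hj
    rw [List.mem_filter, decide_eq_true_iff] at ha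
    exact (hp a).1 ha.2 j hj
  have hfB : ∀ (z : List (CTree X)) (j : X),
      j ∈ wordLeaves (z.filter fun a => decide (q a)) → j ∈ B := by
    intro z j hj
    obtain ⟨a, ha, hj⟩ := mem_wordLeaves.1 hj
    rw [List.mem_filter, decide_eq_true_iff] at ha
    exact (hq a).1 ha.2 j hj
  -- Since the labels are distinct, the two parts of a word without mixed trees use exactly the
  -- leaves `A` and `B`.
  have hcount : ∀ i ∈ s', wordLeaves ((z i).filter fun a => decide (p a)) = A ∧
      wordLeaves ((z i).filter fun a => decide (q a)) = B := by
    intro i hi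
    rw [Finset.mem_filter] at hi
    have h := (hsplit (z i) hi.2).symm.trans (hz i hi.1)
    constructor
    · ext j
      have hc := congrArg (Multiset.count j) h
      rw [Multiset.count_add, Multiset.count_add] at hc
      by_cases hj : j ∈ A
      · rw [Multiset.count_eq_zero_of_notMem (s := B) (hAB hj),
          Multiset.count_eq_zero_of_notMem (fun h' => hAB hj (hfB _ _ h'))] at hc
        simpa using hc
      · rw [Multiset.count_eq_zero_of_notMem hj,
          Multiset.count_eq_zero_of_notMem fun h' => hj (hfA _ _ h')]
    · ext j
      have hc := congrArg (Multiset.count j) h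
      rw [Multiset.count_add, Multiset.count_add] at hc
      by_cases hj : j ∈ B
      · rw [Multiset.count_eq_zero_of_notMem (s := A) (fun h' => hAB h' hj),
          Multiset.count_eq_zero_of_notMem (fun h' => hAB (hfA _ _ h') hj)] at hc
        simpa using hc
      · rw [Multiset.count_eq_zero_of_notMem hj,
          Multiset.count_eq_zero_of_notMem fun h' => hj (hfB _ _ h')]
  have key : ∀ w₁ w₂ : X → X → K, ∑ i ∈ s',
      (k i * wordWeight w₂ {v} ((z i).filter fun a => decide (q a))) *
        wordWeight w₁ {v} ((z i).filter fun a => decide (p a)) = 0 := by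
    intro w₁ w₂
    -- The leaf `v` interacts with both sides: through `w₁` with `A` and through `w₂` with `B`.
    let w : X → X → K := fun i j =>
      if (i ∈ A ∨ i = v) ∧ (j ∈ A ∨ j = v) then w₁ i j else
        if (i ∈ B ∨ i = v) ∧ (j ∈ B ∨ j = v) then w₂ i j else 0
    rw [← hw w, Finset.sum_filter]
    refine Finset.sum_congr rfl fun i hi => ?_
    have h := wordWeight_eq_mul w w₁ w₂ (· ∈ A) (· ∈ B) (fun _ h1 h2 => hAB h1 h2) p q hp hq {v} 0 0
      ?_ ?_ ?_ (by simp) (by simp) (z i) (fun j hj => by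
        rw [hz i hi] at hj
        exact Multiset.mem_add.1 hj)
    · rw [add_zero, add_zero] at h
      rw [h]
      split_ifs <;> ring
    · intro i hi j hj
      rw [Multiset.mem_singleton] at hi
      simp [w, hi, hj]
    · intro i hi j hj
      rw [Multiset.mem_singleton] at hi
      have h1 : j ∉ A := fun h => hAB h hj
      have h2 : j ≠ v := fun h => hv.2 (h ▸ hj)
      simp [w, hi, hj, h1, h2]
    · intro i j hi hj
      have h1 : j ∉ A := fun h => hAB h hj
      have h2 : j ≠ v := fun h => hv.2 (h ▸ hj)
      have h3 : i ∉ B := fun h => hAB hi h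
      have h4 : i ≠ v := fun h => hv.1 (h ▸ hi)
      simp [w, h1, h2, h3, h4]
  -- Independence for `A`, with the factors of the `B`-parts absorbed into the coefficients, singles
  -- out the words with `A`-part `x`.
  have h1 : ∀ w₂ : X → X → K, ∑ i ∈ s', (k i * if ((z i).filter fun a => decide (p a)) = x then 1
      else 0) * wordWeight w₂ {v} ((z i).filter fun a => decide (q a)) = 0 := by
    intro w₂
    refine Eq.trans ?_ (hA ι s' (fun i => (z i).filter fun a => decide (p a))
      (fun i => k i * wordWeight w₂ {v} ((z i).filter fun a => decide (q a)))
      (fun i hi => (hcount i hi).1) (fun w₁ => key w₁ w₂) (fun t => if t = x then 1 else 0))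
    exact Finset.sum_congr rfl fun i _ => by ring
  refine Eq.trans ?_ (hB ι s' (fun i => (z i).filter fun a => decide (q a)) _
    (fun i hi => (hcount i hi).2) h1 (fun t => if t = y then 1 else 0))
  rw [Finset.sum_filter]
  refine Finset.sum_congr rfl fun i _ => ?_
  by_cases e1 : ∀ a ∈ z i, p a ∨ q a
  · rw [if_pos e1]
    by_cases e2 : (z i).filter (fun a => decide (p a)) = x <;>
      by_cases e3 : (z i).filter (fun a => decide (q a)) = y <;>
      simp only [e2, e3, and_self, and_true, and_false, if_true, if_false, mul_one, mul_zero]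
    exact if_pos e1
  · rw [if_neg e1, if_neg fun h => e1 h.1]

-- Let `v` have weight only with `u`. Only words whose first tree contains `u` survive, and the
-- weight of such a word is that of the tree on `W` obtained by joining all its letters.
-- Independence of trees on `W` extracts the coefficient of the tree `comb (leaf u) y`; the words
-- producing it are those summed in `joinSum`.
open Classical in
theorem joinSum_eq_zero {v u : X} {W : Multiset X} (hn : (v ::ₘ W).Nodup) (hu : u ∈ W)
    (hW : TreesIndependent K W)
    {ι : Type} (s : Finset ι) (z : ι → List (CTree X)) (k : ι → K)
    (hz : ∀ i ∈ s, wordLeaves (z i) = W)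
    (hw : ∀ w : X → X → K, ∑ i ∈ s, k i * wordWeight w {v} (z i) = 0)
    (y : List (CTree X)) :
    joinSum (⇑(∑ i ∈ s, Finsupp.single (z i) (k i))) (leaf u) y = 0 := by
  rw [Multiset.nodup_cons] at hn
  obtain ⟨hv, hn⟩ := hn
  -- The value at the empty word is irrelevant: as `u ∈ W`, the words that occur are nonempty.
  let T : List (CTree X) → CTree X := fun z => match z with
    | [] => leaf v
    | a :: r => comb a r
  let p : List (CTree X) → Prop := fun z => ∃ a r, z = a :: r ∧ u ∈ a.leaves
  let s' := s.filter fun i => p (z i)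
  have hT : ∀ i ∈ s', (T (z i)).leaves = W := by
    intro i hi
    rw [Finset.mem_filter] at hi
    obtain ⟨hi, a, r, h, -⟩ := hi
    rw [← hz i hi, h]
    simp [T]
  have key : ∀ w' : X → X → K, ∑ i ∈ s', k i * weight w' (T (z i)) = 0 := by
    intro w'
    let w : X → X → K := fun i j =>
      if i = v then (if j = u then 1 else 0) else if j = v then (if i = u then 1 else 0)
        else w' i j
    rw [← hw w, Finset.sum_filter]
    refine Finset.sum_congr rfl fun i hi => ?_
    have hi' := hz i hi
    rcases h : z i with _ | ⟨a, r⟩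
    · rw [h] at hi'
      rw [← hi'] at hu
      simp at hu
    rw [h, wordLeaves_cons] at hi'
    have hvm : ∀ j, j ∈ a.leaves ∨ j ∈ wordLeaves r → j ≠ v := by
      intro j hj e
      rw [← Multiset.mem_add, hi', e] at hj
      exact hv hj
    have hww : ∀ i ∈ W, ∀ j ∈ W, w i j = w' i j := by
      intro i hi j hj
      have h1 : i ≠ v := fun e => hv (e ▸ hi)
      have h2 : j ≠ v := fun e => hv (e ▸ hj)
      simp [w, h1, h2]
    have hcr : ∀ b : CTree X, (∀ j ∈ b.leaves, j ≠ v) → u ∉ b.leaves →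
        cross w {v} b.leaves = 0 := by
      intro b hb hub
      refine cross_eq_zero w fun i hi j hj => ?_
      rw [Multiset.mem_singleton] at hi
      have h1 : j ≠ u := fun e => hub (e ▸ hj)
      simp [w, hi, h1]
    by_cases hua : u ∈ a.leaves
    · rw [if_pos ⟨a, r, rfl, hua⟩]
      have hna : (a.leaves + wordLeaves r).Nodup := hi' ▸ hn
      rw [Multiset.nodup_add, Multiset.disjoint_left] at hna
      -- As `u` occurs once in `a`, joining `a` to `v` contributes the factor `1`.
      have h1 : cross w {v} a.leaves = 1 := by
        obtain ⟨m, hm⟩ := Multiset.exists_cons_of_mem hua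
        have hm' := hna.1
        rw [hm, Multiset.nodup_cons] at hm'
        have h2 : u ≠ v := hvm u (Or.inl hua)
        rw [hm, ← Multiset.singleton_add, cross_add_right, cross_eq_zero w (B := m), add_zero]
        · simp [cross, w, h2]
        · intro i hi j hj
          rw [Multiset.mem_singleton] at hi
          have h1 : j ≠ u := fun e => hm'.1 (e ▸ hj)
          simp [w, hi, h1]
      change k i * weight w' (comb a r) = _
      rw [weight_comb, wordWeight, h1, one_mul]
      rw [weight_congr (w := w) (w' := w') a, wordWeight_congr (w := w) (w' := w') _ a.leaves]
      · intro i hi j hj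
        rw [hww i (hi' ▸ by simp [hi]) j (hi' ▸ by simp [hj]),
          hww j (hi' ▸ by simp [hj]) i (hi' ▸ by simp [hi])]
      · intro b hb
        have hbr : ∀ j ∈ b.leaves, j ∈ wordLeaves r := fun j hj => mem_wordLeaves.2 ⟨b, hb, hj⟩
        rw [cross_add_left, hcr b (fun j hj => hvm j (Or.inr (hbr j hj)))
          (fun h => hna.2.2 hua (hbr u h)), zero_add]
        refine cross_congr fun i hi j hj => ?_
        have hj := hbr j hj
        rw [hww i (hi' ▸ by simp [hi]) j (hi' ▸ by simp [hj]),
          hww j (hi' ▸ by simp [hj]) i (hi' ▸ by simp [hi])]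
      · intro i hi j hj
        rw [hww i (hi' ▸ by simp [hi]) j (hi' ▸ by simp [hj]),
          hww j (hi' ▸ by simp [hj]) i (hi' ▸ by simp [hi])]
    · rw [if_neg, wordWeight, hcr a (fun j hj => hvm j (Or.inl hj)) hua]
      · ring
      · rintro ⟨a', r', h', hu'⟩
        exact hua ((List.cons.inj h').1 ▸ hu')
  -- For each index the contributions are compared: `z i` equals at most one of the words in
  -- `joinSum`, and it equals one precisely if it starts with a tree containing `u` and joins to
  -- `comb (leaf u) y`.
  rw [← hW ι s' (fun i => T (z i)) k hT key (fun t => if t = comb (leaf u) y then 1 else 0),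
    Finset.sum_filter, joinSum]
  simp only [Finsupp.coe_finsetSum, Finset.sum_apply]
  rw [Finset.sum_comm]
  refine Finset.sum_congr rfl fun i hi => ?_
  have hi' := hz i hi
  simp only [Finsupp.single_apply]
  by_cases hp : p (z i) ∧ T (z i) = comb (leaf u) y
  · obtain ⟨⟨a, r, h, hua⟩, h'⟩ := hp
    rw [h] at h' hi' ⊢
    have hur : u ∉ wordLeaves r := by
      have hna : (a.leaves + wordLeaves r).Nodup := by
        rw [← wordLeaves_cons, hi']; exact hn
      rw [Multiset.nodup_add, Multiset.disjoint_left] at hna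
      exact hna.2.2 hua
    obtain ⟨j, hj, rfl, rfl⟩ := eq_of_comb_eq_comb r y hur h'
    rw [if_pos ⟨_, _, rfl, hua⟩, Finset.sum_eq_single j]
    · simp [h']
    · intro j' hj' hne
      rw [if_neg]
      intro e
      have := congrArg List.length (List.cons.inj e).2
      rw [Finset.mem_range] at hj'
      simp at this
      omega
    · intro h
      rw [Finset.mem_range] at h
      omega
  · rw [Finset.sum_eq_zero]
    · split_ifs with h1 h2
      · exact absurd ⟨h1, h2⟩ hp
      · simp
      · rfl
    · intro j hj
      rw [if_neg]
      intro e
      refine hp ?_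
      rw [e]
      refine ⟨⟨_, _, rfl, by simp⟩, ?_⟩
      change comb (comb _ _) _ = _
      simp only [comb]
      rw [← List.foldl_append, List.take_append_drop]

-- The coefficients of a relation, collected in `c`, satisfy the shuffle and join conditions of
-- `eq_zero_of_shuffleSum_of_joinSum`: the former by independence on both parts of a splitting of
-- `W`, the latter by independence of trees on `W`. For words with other leaves both are vacuous.
open Classical in
theorem wordsIndependent_of_lt [CharZero K] {v : X} {W : Multiset X} (hn : (v ::ₘ W).Nodup)
    (h : ∀ A < W, WordsIndependent K v A) (hW : TreesIndependent K W ∨ W = 0) :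
    WordsIndependent K v W := by
  intro ι s z k hz hw f
  let c : List (CTree X) →₀ K := ∑ i ∈ s, Finsupp.single (z i) (k i)
  have hc : ∀ y, wordLeaves y ≠ W → c y = 0 := by
    intro y hy
    simp only [c, Finsupp.coe_finsetSum, Finset.sum_apply]
    refine Finset.sum_eq_zero fun i hi => ?_
    rw [Finsupp.single_apply, if_neg]
    rintro rfl
    exact hy (hz i hi)
  have h0 : c = 0 := by
    ext y
    refine eq_zero_of_shuffleSum_of_joinSum (⇑c) W.card ?_ ?_ ?_ ?_ y
    · intro y hy
      refine hc y ?_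
      rintro rfl
      exact absurd (length_le_card_wordLeaves y) (by omega)
    -- For `W = 0` only the empty word occurs, with weight `1` for any choice of weights, so the
    -- relation itself gives the claim.
    · by_cases h0 : W = 0
      · rw [← hw 0]
        simp only [c, Finsupp.coe_finsetSum, Finset.sum_apply]
        refine Finset.sum_congr rfl fun i hi => ?_
        have h1 : z i = [] := by
          by_contra h1
          exact wordLeaves_ne_zero h1 ((hz i hi).trans h0)
        simp [h1, wordWeight]
      · exact hc _ (fun e => h0 e.symm)
    · intro x y hx hy
      by_cases e : wordLeaves x + wordLeaves y = W
      · subst e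
        refine shuffleSum_eq_zero hn (h _ ?_) (h _ ?_) s z k hz hw x y rfl rfl
        · exact lt_add_of_pos_right _ (pos_iff_ne_zero.2 (wordLeaves_ne_zero hy))
        · exact lt_add_of_pos_left _ (pos_iff_ne_zero.2 (wordLeaves_ne_zero hx))
      · rw [shuffleSum.congr (g := fun _ => 0), shuffleSum.zero]
        intro t ht
        refine hc t ?_
        rwa [wordLeaves_perm ht, wordLeaves_append]
    · intro u y
      by_cases e : u ∈ W
      · refine joinSum_eq_zero hn e (hW.resolve_right ?_) s z k hz hw y
        rintro rfl
        simp at e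
      · refine Finset.sum_eq_zero fun j _ => hc _ ?_
        rintro rfl
        exact e (by simp)
  have h1 : c.sum (fun y a => a * f y) = ∑ i ∈ s, k i * f (z i) := by
    rw [← Finsupp.sum_finsetSum_index (fun _ => by simp) (fun _ b₁ b₂ => by ring)]
    simp
  rw [← h1, h0, Finsupp.sum_zero_index]

/-- Induction on the size of `W`. Trees on `W` are words over `W` without one of its elements,
rooted at that element, so the root `v` has to vary. -/
theorem wordsIndependent [CharZero K] {v : X} {W : Multiset X} (hn : (v ::ₘ W).Nodup) :
    WordsIndependent K v W := by
  obtain ⟨n, hW⟩ : ∃ n, W.card = n := ⟨_, rfl⟩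
  induction n using Nat.strong_induction_on generalizing v W with
  | _ n ih =>
    refine wordsIndependent_of_lt hn (fun A hA => ih A.card ?_ ?_ rfl) ?_
    · rw [← hW]; exact Multiset.card_lt_card hA
    · exact Multiset.nodup_of_le (Multiset.cons_le_cons v hA.le) hn
    · rcases W.empty_or_exists_mem with rfl | ⟨u, hu⟩
      · exact Or.inr rfl
      · obtain ⟨W, rfl⟩ := Multiset.exists_cons_of_mem hu
        rw [Multiset.card_cons] at hW
        exact Or.inl (treesIndependent_of_wordsIndependent
          (ih W.card (by omega) (Multiset.nodup_cons.1 hn).2 rfl))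

theorem treesIndependent [CharZero K] {V : Multiset X} (hn : V.Nodup) (h0 : V ≠ 0) :
    TreesIndependent K V := by
  obtain ⟨v, hv⟩ := Multiset.exists_mem_of_ne_zero h0
  obtain ⟨W, rfl⟩ := Multiset.exists_cons_of_mem hv
  exact treesIndependent_of_wordsIndependent (wordsIndependent hn)

end CTree

end

/-! ### Linear independence of the weights of forests -/

noncomputable section

namespace CTree

variable {X : Type} {K : Type*} [Field K]

/-- Linear relations may be tested on functions of two variables that are products. -/
theorem sum_eq_zero_of_mul {ι α β : Type} (s : Finset ι) (a : ι → α) (b : ι → β) (k : ι → K)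
    (h : ∀ (g : α → K) (f : β → K), ∑ i ∈ s, k i * (g (a i) * f (b i)) = 0) (f : α → β → K) :
    ∑ i ∈ s, k i * f (a i) (b i) = 0 := by
  classical
  rw [← Finset.sum_fiberwise_of_maps_to (t := s.image a) fun i hi => Finset.mem_image_of_mem a hi]
  refine Finset.sum_eq_zero fun x _ => ?_
  -- Taking for `g` the indicator of the value `x` of `a` isolates one fibre.
  rw [← h (fun y => if y = x then 1 else 0) (f x), Finset.sum_filter]
  refine Finset.sum_congr rfl fun i _ => ?_
  split_ifs with hi
  · rw [hi, one_mul]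
  · ring

/-- A linear relation between the values of functions on a family, tested on scalar functions. -/
theorem sum_smul_eq_zero {ι α : Type} {E : Type*} [AddCommGroup E] [Module K E] (s : Finset ι)
    (a : ι → α) (k : ι → K) (h : ∀ g : α → K, ∑ i ∈ s, k i * g (a i) = 0) (f : α → E) :
    ∑ i ∈ s, k i • f (a i) = 0 := by
  classical
  rw [← Finset.sum_fiberwise_of_maps_to (t := s.image a) fun i hi => Finset.mem_image_of_mem a hi]
  refine Finset.sum_eq_zero fun x _ => ?_
  have h1 := h fun y => if y = x then 1 else 0
  simp only [mul_ite, mul_one, mul_zero] at h1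
  rw [← Finset.sum_filter] at h1
  calc _ = ∑ i ∈ s with a i = x, k i • f x :=
        Finset.sum_congr rfl fun i hi => by rw [(Finset.mem_filter.1 hi).2]
    _ = 0 := by rw [← Finset.sum_smul, h1, zero_smul]

/-- The multiset of labels of the leaves of a forest. -/
def forestLeaves (F : Multiset (CTree X)) : Multiset X := (F.map leaves).sum

/-- The product of the weights of the trees of a forest. -/
def forestWeight (w : X → X → K) (F : Multiset (CTree X)) : K := (F.map (weight w)).prod

@[simp] theorem forestLeaves_zero : forestLeaves (0 : Multiset (CTree X)) = 0 := rfl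

@[simp] theorem forestLeaves_cons (a : CTree X) (F : Multiset (CTree X)) :
    forestLeaves (a ::ₘ F) = a.leaves + forestLeaves F := by simp [forestLeaves]

@[simp] theorem forestWeight_zero (w : X → X → K) :
    forestWeight w (0 : Multiset (CTree X)) = 1 := by simp [forestWeight]

@[simp] theorem forestWeight_cons (w : X → X → K) (a : CTree X) (F : Multiset (CTree X)) :
    forestWeight w (a ::ₘ F) = weight w a * forestWeight w F := by simp [forestWeight]

theorem mem_forestLeaves {F : Multiset (CTree X)} {x : X} :
    x ∈ forestLeaves F ↔ ∃ a ∈ F, x ∈ a.leaves := by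
  induction F using Multiset.induction with
  | empty => simp
  | cons a F h => simp [h]

theorem forestWeight_congr {w w' : X → X → K} (F : Multiset (CTree X))
    (h : ∀ i ∈ forestLeaves F, ∀ j ∈ forestLeaves F, w i j * w j i = w' i j * w' j i) :
    forestWeight w F = forestWeight w' F := by
  unfold forestWeight
  congr 1
  refine Multiset.map_congr rfl fun a ha => weight_congr a fun i hi j hj => ?_
  exact h i (mem_forestLeaves.2 ⟨a, ha, hi⟩) j (mem_forestLeaves.2 ⟨a, ha, hj⟩)

/-- The weights of the forests with leaves `V` are linearly independent. -/
theorem forestsIndependent [CharZero K] {V : Multiset X} (hn : V.Nodup) (ι : Type) (s : Finset ι)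
    (F : ι → Multiset (CTree X)) (k : ι → K) (hF : ∀ i ∈ s, forestLeaves (F i) = V)
    (hw : ∀ w : X → X → K, ∑ i ∈ s, k i * forestWeight w (F i) = 0)
    (f : Multiset (CTree X) → K) : ∑ i ∈ s, k i * f (F i) = 0 := by
  classical
  obtain ⟨n, hV⟩ : ∃ n, V.card = n := ⟨_, rfl⟩
  induction n using Nat.strong_induction_on generalizing V s F k f with
  | _ n ih =>
    rcases V.empty_or_exists_mem with rfl | ⟨v, hv⟩
    · have h0 : ∀ i ∈ s, F i = 0 := by
        intro i hi
        by_contra hne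
        obtain ⟨a, ha⟩ := Multiset.exists_mem_of_ne_zero hne
        obtain ⟨x, hx⟩ := Multiset.exists_mem_of_ne_zero a.leaves_ne_zero
        have := mem_forestLeaves.2 ⟨a, ha, hx⟩
        rw [hF i hi] at this
        simp at this
      have h1 := hw 0
      rw [Finset.sum_congr rfl fun i hi => by rw [h0 i hi, forestWeight_zero, mul_one]] at h1
      rw [Finset.sum_congr rfl fun i hi => by rw [h0 i hi], ← Finset.sum_mul, h1, zero_mul]
    -- In every forest, `T` is the tree containing the chosen label `v`, and `F'` is the rest.
    have hT : ∀ i, ∃ T F', i ∈ s → F i = T ::ₘ F' ∧ v ∈ T.leaves := by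
      intro i
      by_cases hi : i ∈ s
      · rw [← hF i hi, mem_forestLeaves] at hv
        obtain ⟨T, hT, hv⟩ := hv
        obtain ⟨F', hF'⟩ := Multiset.exists_cons_of_mem hT
        exact ⟨T, F', fun _ => ⟨hF', hv⟩⟩
      · exact ⟨leaf v, 0, fun h => absurd h hi⟩
    choose T F' hT using hT
    have hsum : ∀ i ∈ s, (T i).leaves + forestLeaves (F' i) = V := by
      intro i hi
      rw [← forestLeaves_cons, ← (hT i hi).1, hF i hi]
    -- The forests are separated by the set `U` of leaves of the tree containing `v`, by induction
    -- on its size and for all test functions at once.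
    have main : ∀ m (U : Multiset X), U.card = m → U ≤ V → v ∈ U →
        ∀ f : Multiset (CTree X) → K, ∑ i ∈ s with (T i).leaves = U, k i * f (F i) = 0 := by
      intro m
      induction m using Nat.strong_induction_on with
      | _ m ihm =>
        intro U hU hUV hvU f
        obtain ⟨U', rfl⟩ := Multiset.le_iff_exists_add.1 hUV
        rw [Multiset.nodup_add, Multiset.disjoint_left] at hn
        obtain ⟨hnU, hnU', hdis⟩ := hn
        have hcard : U'.card < n := by
          have := Multiset.card_pos_iff_exists_mem.2 ⟨v, hvU⟩
          rw [Multiset.card_add] at hV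
          omega
        have hmem : ∀ i ∈ s.filter (fun i => (T i).leaves = U),
            i ∈ s ∧ (T i).leaves = U ∧ forestLeaves (F' i) = U' := by
          intro i hi
          rw [Finset.mem_filter] at hi
          refine ⟨hi.1, hi.2, ?_⟩
          have := hsum i hi.1
          rw [hi.2] at this
          exact add_left_cancel this
        have key : ∀ w₁ w₂ : X → X → K, ∑ i ∈ s with (T i).leaves = U,
            (k i * forestWeight w₂ (F' i)) * weight w₁ (T i) = 0 := by
          intro w₁ w₂
          -- No weights connect `U` with its complement `U'`, so the weights inside the two sets can
          -- be chosen freely.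
          let w : X → X → K := fun i j =>
            if i ∈ U ∧ j ∈ U then w₁ i j else if i ∈ U' ∧ j ∈ U' then w₂ i j else 0
          have hw12 : ∀ i ∈ s.filter (fun i => (T i).leaves = U),
              (k i * forestWeight w₂ (F' i)) * weight w₁ (T i) = k i * forestWeight w (F i) := by
            intro i hi
            obtain ⟨hi, h1, h2⟩ := hmem i hi
            rw [(hT i hi).1, forestWeight_cons, weight_congr (w := w) (w' := w₁),
              forestWeight_congr (w := w) (w' := w₂)]
            · ring
            · intro i hi j hj
              rw [h2] at hi hj
              have e1 : i ∉ U := fun h => hdis h hi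
              simp [w, e1, hi, hj]
            · intro i hi j hj
              rw [h1] at hi hj
              simp [w, hi, hj]
          rw [Finset.sum_congr rfl hw12]
          have hw := hw w
          rw [← Finset.sum_filter_add_sum_filter_not s (fun i => (T i).leaves = U)] at hw
          refine (eq_neg_of_add_eq_zero_left hw).trans (neg_eq_zero.2 ?_)
          rw [← Finset.sum_fiberwise_of_maps_to (t := s.image fun i => (T i).leaves)
            fun i hi => Finset.mem_image_of_mem _ (Finset.mem_filter.1 hi).1]
          refine Finset.sum_eq_zero fun U₁ hU₁ => ?_
          rw [Finset.filter_filter]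
          -- If the leaves `U₁` of the tree containing `v` form a proper subset of `U`, the part
          -- vanishes by induction; if they leave `U`, that tree has leaves on both sides and weight
          -- zero.
          by_cases hlt : U₁ < U
          · obtain ⟨i₀, hi₀, rfl⟩ := Finset.mem_image.1 hU₁
            have hm := ihm _ (by rw [← hU]; exact Multiset.card_lt_card hlt) _ rfl
              (hlt.le.trans hUV) (hT i₀ hi₀).2 (forestWeight w)
            refine Eq.trans ?_ hm
            refine Finset.sum_congr (Finset.filter_congr fun i _ => ?_) fun _ _ => rfl
            exact ⟨fun h => h.2, fun h => ⟨fun h' => hlt.ne (h.symm.trans h'), h⟩⟩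
          · refine Finset.sum_eq_zero fun i hi => ?_
            rw [Finset.mem_filter] at hi
            obtain ⟨hi, hne, rfl⟩ := hi
            rw [(hT i hi).1, forestWeight_cons, weight_eq_zero_of_mem w (· ∈ U)]
            · ring
            · intro i hi j hj h1 h2
              simp [w, h1, h2, show i ∉ U' from fun h => hdis h1 h]
            · exact ⟨v, (hT i hi).2, hvU⟩
            · by_contra hall
              push Not at hall
              refine hlt (lt_of_le_of_ne ?_ hne)
              refine (Multiset.le_iff_subset ?_).2 hall
              refine Multiset.nodup_of_le (Multiset.le_add_right _ (forestLeaves (F' i))) ?_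
              rw [hsum i hi, Multiset.nodup_add, Multiset.disjoint_left]
              exact ⟨hnU, hnU', hdis⟩
        -- Independence of trees removes the tree containing `v`; the induction on the number of
        -- labels then handles the remaining forest.
        have h1 : ∀ (g : CTree X → K) (w₂ : X → X → K), ∑ i ∈ s with (T i).leaves = U,
            (k i * g (T i)) * forestWeight w₂ (F' i) = 0 := by
          intro g w₂
          refine Eq.trans ?_ (treesIndependent (K := K) hnU (fun h => by simp [h] at hvU) ι _ T
            (fun i => k i * forestWeight w₂ (F' i)) (fun i hi => (hmem i hi).2.1)
            (fun w₁ => key w₁ w₂) g)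
          exact Finset.sum_congr rfl fun i _ => by ring
        have h2 : ∀ (g : CTree X → K) (f : Multiset (CTree X) → K),
            ∑ i ∈ s with (T i).leaves = U, k i * (g (T i) * f (F' i)) = 0 := by
          intro g f
          refine Eq.trans ?_ (ih _ hcard hnU' _ F' _ (fun i hi => (hmem i hi).2.2) (h1 g) f rfl)
          exact Finset.sum_congr rfl fun i _ => by ring
        refine Eq.trans ?_ (sum_eq_zero_of_mul _ T F' k h2 fun a b => f (a ::ₘ b))
        exact Finset.sum_congr rfl fun i hi => by rw [(hT i (hmem i hi).1).1]
    rw [← Finset.sum_fiberwise_of_maps_to (t := s.image fun i => (T i).leaves)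
      fun i hi => Finset.mem_image_of_mem _ hi]
    refine Finset.sum_eq_zero fun U hU => ?_
    obtain ⟨i, hi, rfl⟩ := Finset.mem_image.1 hU
    refine main _ _ rfl ?_ (hT i hi).2 f
    rw [← hsum i hi]
    exact Multiset.le_add_right _ _

end CTree

end

noncomputable section

/-! ### Weighted counting of graphs -/

namespace GraphOperad

variable {K : Type*} [Field K]

open Classical in
/-- The product of the weights of the ordered pairs of adjacent vertices. -/
def graphWeight {V : Type} [Fintype V] (w : V → V → K) (g : SimpleGraph V) : K :=
  ∏ i, ∏ j, if g.Adj i j then w i j else 1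

/-- The total weight of a linear combination of graphs. -/
def total {V : Type} [Finite V] (w : V → V → K) : (species K).obj V →ₗ[K] K :=
  letI := Fintype.ofFinite V
  letI := Fintype.ofFinite (SimpleGraph V)
  ∑ g, graphWeight w g • coeff K g

theorem total_apply {V : Type} [i1 : Fintype V] [i2 : Fintype (SimpleGraph V)] (w : V → V → K)
    (x : (species K).obj V) : total w x = ∑ g, graphWeight w g * coeff K g x := by
  rw [total, LinearMap.sum_apply]
  simp only [LinearMap.smul_apply, smul_eq_mul]
  convert rfl

open Classical in
theorem coeff_basis {V : Type} [Finite V] [Nonempty V] (g h : SimpleGraph V) :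
    coeff K h (basis K g) = if h = g then 1 else 0 :=
  Pi.single_apply g 1 h

theorem total_basis {V : Type} [Fintype V] [Nonempty V] (w : V → V → K) (g : SimpleGraph V) :
    total w (basis K g) = graphWeight w g := by
  classical
  have := Fintype.ofFinite (SimpleGraph V)
  rw [total_apply, Finset.sum_eq_single g]
  · simp [coeff_basis]
  · intro g' _ h
    simp [coeff_basis, h]
  · simp

theorem total_map {V W : Type} [Finite V] [Finite W] (σ : V ≃ W) (w : W → W → K)
    (x : (species K).obj V) :
    total w ((species K).map σ x) = total (fun i j => w (σ i) (σ j)) x := by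
  classical
  have := Fintype.ofFinite V
  have := Fintype.ofFinite W
  have := Fintype.ofFinite (SimpleGraph V)
  have := Fintype.ofFinite (SimpleGraph W)
  rw [total_apply, total_apply, ← σ.simpleGraph.symm.sum_comp]
  refine Finset.sum_congr rfl fun g _ => ?_
  congr 1
  unfold graphWeight
  rw [← σ.prod_comp]
  refine Finset.prod_congr rfl fun i _ => ?_
  rw [← σ.prod_comp]
  rfl

theorem eq_sum_basis {V : Type} [Finite V] [Fintype (SimpleGraph V)] [Nonempty V]
    (x : (species K).obj V) : x = ∑ g, coeff K g x • basis K g := by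
  classical
  apply Subtype.ext
  funext h
  change coeff K h x = coeff K h _
  rw [map_sum]
  simp [coeff_basis]

/-- The weights of the graph obtained by contracting `B`. -/
def contractWeight {A B : Type} [Fintype B] (w : A ⊕ B → A ⊕ B → K) : Option A → Option A → K
  | some a, some a' => w (.inl a) (.inl a')
  -- An edge from `a` to `*` becomes an edge from `a` to some `b`, with weights in both directions.
  -- The whole sum is placed on the ordered pair `(a, *)`, and `(*, a)` receives `1`.
  | some a, none => ∑ b, w (.inl a) (.inr b) * w (.inr b) (.inl a)
  | none, _ => 1

/-- The loose ends are attached independently of each other, so the sum over all attachments of a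
product over the neighbours of `*` is the product of the sums over `B`. -/
theorem sum_graphWeight_insertion {A B : Type} [Fintype A] [Fintype B] (w : A ⊕ B → A ⊕ B → K)
    (g₁ : SimpleGraph (Option A)) (g₂ : SimpleGraph B)
    [Fintype ({a : A // g₁.Adj (some a) none} → B)] :
    ∑ f, graphWeight w (insertion g₁ g₂ f) =
      graphWeight (contractWeight w) g₁ * graphWeight (fun i j => w (.inr i) (.inr j)) g₂ := by
  classical
  have h1 : ∀ f, graphWeight w (insertion g₁ g₂ f) =
      (∏ a, ∏ a', if g₁.Adj (some a) (some a') then w (.inl a) (.inl a') else 1) *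
      graphWeight (fun i j => w (.inr i) (.inr j)) g₂ *
      ∏ a : {a : A // g₁.Adj (some a) none}, w (.inl a) (.inr (f a)) * w (.inr (f a)) (.inl a) := by
    intro f
    have h2 : ∀ (u : A → B → K)
        (_ : ∀ a b, Decidable (∃ h : g₁.Adj (some a) none, f ⟨a, h⟩ = b)), ∏ a : A, ∏ b : B,
        (if ∃ h : g₁.Adj (some a) none, f ⟨a, h⟩ = b then u a b else 1) =
        ∏ a : {a : A // g₁.Adj (some a) none}, u a (f a) := by
      intro u d
      have h3 : ∀ a : A, (∏ b : B,
          if ∃ h : g₁.Adj (some a) none, f ⟨a, h⟩ = b then u a b else 1) =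
          if h : g₁.Adj (some a) none then u a (f ⟨a, h⟩) else 1 := by
        intro a
        by_cases h : g₁.Adj (some a) none
        · simp [h]
        · simp [h]
      simp only [h3]
      rw [Finset.prod_dite]
      simp only [Finset.prod_const_one, mul_one]
      exact Finset.prod_bij' (fun a _ => ⟨a.1, (Finset.mem_filter.1 a.2).2⟩)
        (fun a _ => ⟨a.1, Finset.mem_filter.2 ⟨Finset.mem_univ _, a.2⟩⟩)
          (by simp) (by simp) (by simp)
        (by simp) (by simp)
    have h4 : (∏ a, ∏ b, if (insertion g₁ g₂ f).Adj (.inl a) (.inr b) then w (.inl a) (.inr b)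
        else 1) = _ := h2 (fun a b => w (.inl a) (.inr b)) fun _ _ => Classical.propDecidable _
    have h5 : (∏ b, ∏ a, if (insertion g₁ g₂ f).Adj (.inr b) (.inl a) then w (.inr b) (.inl a)
        else 1) = _ := Finset.prod_comm.trans
          (h2 (fun a b => w (.inr b) (.inl a)) fun _ _ => Classical.propDecidable _)
    have h6 : (∏ a, ∏ a', if (insertion g₁ g₂ f).Adj (.inl a) (.inl a') then w (.inl a) (.inl a')
        else 1) = ∏ a, ∏ a', if g₁.Adj (some a) (some a') then w (.inl a) (.inl a') else 1 :=
      Finset.prod_congr rfl fun a _ => Finset.prod_congr rfl fun a' _ => if_congr Iff.rfl rfl rfl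
    have h7 : (∏ b, ∏ b', if (insertion g₁ g₂ f).Adj (.inr b) (.inr b') then w (.inr b) (.inr b')
        else 1) = graphWeight (fun i j => w (.inr i) (.inr j)) g₂ :=
      Finset.prod_congr rfl fun a _ => Finset.prod_congr rfl fun a' _ => if_congr Iff.rfl rfl rfl
    rw [graphWeight]
    simp only [Fintype.prod_sum_type, Finset.prod_mul_distrib]
    rw [h4, h5, h6, h7]
    ring
  have h6 : graphWeight (contractWeight w) g₁ =
      (∏ a, ∏ a', if g₁.Adj (some a) (some a') then w (.inl a) (.inl a') else 1) *
      ∏ a : {a : A // g₁.Adj (some a) none}, ∑ b, w (.inl a) (.inr b) * w (.inr b) (.inl a) := by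
    unfold graphWeight
    simp only [Fintype.prod_option, Finset.prod_mul_distrib, contractWeight, ite_self,
      Finset.prod_const_one, one_mul]
    rw [mul_comm]
    congr 1
    rw [← Finset.prod_filter]
    exact Finset.prod_bij' (fun a h => ⟨a, by simpa using h⟩)
        (fun a _ => a.1) (by simp)
          (fun a _ => Finset.mem_filter.2 ⟨Finset.mem_univ _, a.2⟩) (by simp) (by simp) (by simp)
  simp only [h1]
  rw [← Finset.mul_sum, h6, mul_right_comm]
  congr 2
  rw [Finset.prod_univ_sum, Fintype.piFinset_univ]
  convert rfl

/-- The bilinear extension of the formula for graphs. It makes total weights computable along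
compositions without listing graphs. -/
theorem total_comp {A B : Type} [Finite A] [Fintype B] (w : A ⊕ B → A ⊕ B → K)
    (x : (species K).obj (Option A)) (y : (species K).obj B) :
    total w (comp K x y) = total (contractWeight w) x *
      total (fun i j => w (.inr i) (.inr j)) y := by
  classical
  have := Fintype.ofFinite A
  rcases isEmpty_or_nonempty B with hB | hB
  · rw [((species K).positive B).elim y 0]
    simp
  have := Fintype.ofFinite (SimpleGraph (Option A))
  have := Fintype.ofFinite (SimpleGraph B)
  have key : ∀ g₁ g₂, total w (comp K (basis K g₁) (basis K g₂)) =
      graphWeight (contractWeight w) g₁ * graphWeight (fun i j => w (.inr i) (.inr j)) g₂ := by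
    intro g₁ g₂
    have := Fintype.ofFinite ({a : A // g₁.Adj (some a) none} → B)
    rw [comp_basis, finsum_eq_sum_of_fintype, map_sum, ← sum_graphWeight_insertion]
    exact Finset.sum_congr rfl fun f _ => total_basis _ _
  conv_lhs => rw [eq_sum_basis x, eq_sum_basis y]
  rw [total_apply _ x, total_apply _ y, Finset.sum_mul_sum, map_sum (comp K _), map_sum,
    Finset.sum_comm]
  refine Finset.sum_congr rfl fun g₂ _ => ?_
  rw [map_sum (comp K), LinearMap.sum_apply, map_sum]
  refine Finset.sum_congr rfl fun g₁ _ => ?_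
  rw [map_smul, map_smul, map_smul (comp K), LinearMap.smul_apply, map_smul, key, smul_eq_mul,
    smul_eq_mul]
  ring

/-- The total weights for all choices of weights separate linear combinations of graphs. -/
theorem eq_zero_of_total {V : Type} [Finite V] (x : (species K).obj V)
    (h : ∀ w : V → V → K, total w x = 0) : x = 0 := by
  classical
  have := Fintype.ofFinite V
  have := Fintype.ofFinite (SimpleGraph V)
  apply Subtype.ext
  funext g
  change coeff K g x = 0
  induction g using WellFoundedLT.induction with
  | _ g ih =>
    -- With the indicator of `g` as weights only subgraphs of `g` contribute, and the proper ones
    -- have coefficient zero by induction.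
    have h1 := h fun i j => if g.Adj i j then 1 else 0
    rw [total_apply, Finset.sum_eq_single g] at h1
    · rw [graphWeight, Finset.prod_eq_one, one_mul] at h1
      · exact h1
      · intro i _
        exact Finset.prod_eq_one fun j _ => by split_ifs <;> rfl
    · intro g' _ hne
      by_cases hle : g' ≤ g
      · rw [ih g' (lt_of_le_of_ne hle hne), mul_zero]
      · rw [SimpleGraph.le_iff_adj] at hle
        push Not at hle
        obtain ⟨i, j, h2, h3⟩ := hle
        rw [graphWeight, Finset.prod_eq_zero (i := i) (Finset.mem_univ _), zero_mul]
        refine Finset.prod_eq_zero (i := j) (Finset.mem_univ _) ?_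
        rw [if_pos h2, if_neg h3]
    · simp

theorem total_points (w : Fin 2 → Fin 2 → K) : total w (basis K (⊥ : SimpleGraph (Fin 2))) = 1 := by
  rw [total_basis]
  simp [graphWeight]

theorem total_segment (w : Fin 2 → Fin 2 → K) :
    total w (basis K (⊤ : SimpleGraph (Fin 2))) = w 0 1 * w 1 0 := by
  rw [total_basis]
  simp [graphWeight]

/-- The two contractions collect all weights between `A` and `B` on the ordered pair `(1, 0)`. Thus
P contributes the factor `1`, and S the cross sum. -/
theorem total_bin {A B : Type} [Fintype A] [Fintype B] (w : A ⊕ B → A ⊕ B → K)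
    (μ : (species K).obj (Fin 2)) (x : (species K).obj A) (y : (species K).obj B) :
    total w ((graphOperad K).bin μ x y) =
      total (fun i j => if i = 1 ∧ j = 0 then ∑ a, ∑ b, w (.inl a) (.inr b) * w (.inr b) (.inl a)
        else 1) μ *
        (total (fun i j => w (.inl i) (.inl j)) x * total (fun i j => w (.inr i) (.inr j)) y) := by
  classical
  have h : ∀ (w : A ⊕ B → A ⊕ B → K), total w ((graphOperad K).bin μ x y) =
      total (contractWeight w) ((species K).map (Relabel.leftPoint A)
        (comp K ((species K).map Relabel.pair μ) x)) * total (fun i j => w (.inr i) (.inr j)) y :=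
    fun w => total_comp w _ y
  rw [h, total_map, total_comp, total_map, mul_assoc]
  congr 1
  refine congrArg (fun w => total w μ) ?_
  funext i j
  fin_cases i <;> fin_cases j
  · rfl
  · rfl
  · change ∑ a, (1 : K) * ∑ b, w (.inl a) (.inr b) * w (.inr b) (.inl a) = _
    simp
  · rfl

end GraphOperad

end

noncomputable section

/-! ### Algebras with a product and a biderivation -/

/-- A commutative associative product `p` and a commutative biderivation `s`. -/
structure IsBiderivation {K A : Type*} [Field K] [AddCommGroup A] [Module K A]
    (p s : A →ₗ[K] A →ₗ[K] A) : Prop where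
  p_comm : ∀ a b, p a b = p b a
  s_comm : ∀ a b, s a b = s b a
  p_assoc : ∀ a b c, p (p a b) c = p a (p b c)
  s_p : ∀ a b c, s a (p b c) = p (s a b) c + p (s a c) b

namespace IsBiderivation

variable {K A : Type*} [Field K] [AddCommGroup A] [Module K A] {p s : A →ₗ[K] A →ₗ[K] A}
  (h : IsBiderivation p s) {X : Type} (e : X → A)

/-- The value of a tree, formed with the biderivation. -/
def tree (T : CTree X) : A := T.fold e (fun a b => s a b) h.s_comm

/-- The product of the values of the trees of a forest; there is none for the empty forest. -/
def forest? (F : Multiset (CTree X)) : Option A :=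
  haveI : LeftCommutative fun (T : CTree X) (a : Option A) =>
      some (a.elim (h.tree e T) (p (h.tree e T))) := ⟨by
    rintro T T' (_ | a)
    · exact congrArg some (h.p_comm _ _)
    · refine congrArg some ?_
      change p _ (p _ _) = p _ (p _ _)
      rw [← h.p_assoc, ← h.p_assoc, h.p_comm (h.tree e T)]⟩
  F.foldr (fun T a => some (a.elim (h.tree e T) (p (h.tree e T)))) none

/-- The product of the values of the trees of a nonempty forest. -/
def forest (F : Multiset (CTree X)) : A := (h.forest? e F).getD 0

theorem forest_singleton (T : CTree X) : h.forest e {T} = h.tree e T := by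
  simp [forest, forest?]

theorem forest_cons (T : CTree X) {F : Multiset (CTree X)} (hF : F ≠ 0) :
    h.forest e (T ::ₘ F) = p (h.tree e T) (h.forest e F) := by
  obtain ⟨T', F, rfl⟩ : ∃ T' F', F = T' ::ₘ F' := by
    obtain ⟨a, ha⟩ := Multiset.exists_mem_of_ne_zero hF
    exact ⟨a, Multiset.exists_cons_of_mem ha⟩
  simp [forest, forest?]

/-- The product has no unit, so inductions start at forests with one tree. -/
theorem forest_induction {C : ∀ F : Multiset (CTree X), F ≠ 0 → Prop}
    (h1 : ∀ T, C {T} (Multiset.singleton_ne_zero T))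
    (h2 : ∀ T F (hF : F ≠ 0), C F hF → C (T ::ₘ F) (Multiset.cons_ne_zero))
    (F : Multiset (CTree X)) (hF : F ≠ 0) : C F hF := by
  induction F using Multiset.induction with
  | empty => exact absurd rfl hF
  | cons T F ih =>
    by_cases h0 : F = 0
    · subst h0; exact h1 T
    · exact h2 T F h0 (ih h0)

theorem p_forest_forest (F F' : Multiset (CTree X)) (hF : F ≠ 0) (hF' : F' ≠ 0) :
    p (h.forest e F) (h.forest e F') = h.forest e (F + F') := by
  induction F, hF using forest_induction with
  | h1 T => rw [forest_singleton, Multiset.singleton_add, forest_cons _ _ _ hF']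
  | h2 T F h0 ih =>
    rw [forest_cons _ _ _ h0, h.p_assoc, ih, Multiset.cons_add, forest_cons]
    simp [h0]

/-- The span of the products of trees. -/
def forestSpan : Submodule K A := Submodule.span K {a | ∃ F, F ≠ 0 ∧ h.forest e F = a}

theorem p_mem {a b : A} (ha : a ∈ h.forestSpan e) (hb : b ∈ h.forestSpan e) :
    p a b ∈ h.forestSpan e := by
  have h1 : ∀ F, F ≠ 0 → p (h.forest e F) b ∈ h.forestSpan e := by
    intro F hF
    induction hb using Submodule.span_induction with
    | mem x hx =>
      obtain ⟨F', hF', rfl⟩ := hx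
      rw [p_forest_forest _ _ _ _ hF hF']
      exact Submodule.subset_span ⟨_, by simp [hF], rfl⟩
    | zero => rw [map_zero]; exact Submodule.zero_mem _
    | add x y _ _ hx hy => rw [map_add]; exact Submodule.add_mem _ hx hy
    | smul c x _ hx => rw [map_smul]; exact Submodule.smul_mem _ _ hx
  induction ha using Submodule.span_induction with
  | mem x hx =>
    obtain ⟨F', hF', rfl⟩ := hx
    exact h1 F' hF'
  | zero => rw [map_zero]; exact Submodule.zero_mem _
  | add x y _ _ hx hy => rw [map_add]; exact Submodule.add_mem _ hx hy
  | smul c x _ hx => rw [map_smul]; exact Submodule.smul_mem _ _ hx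

theorem tree_mem (T : CTree X) : h.tree e T ∈ h.forestSpan e :=
  Submodule.subset_span ⟨{T}, by simp, forest_singleton _ _ _⟩

/-- By the derivation rule, `s` acts on one tree of the product at a time, and `s` of two trees is a
tree. -/
theorem s_tree_forest_mem (T : CTree X) (F : Multiset (CTree X)) (hF : F ≠ 0) :
    s (h.tree e T) (h.forest e F) ∈ h.forestSpan e := by
  induction F, hF using forest_induction with
  | h1 T' =>
    rw [forest_singleton]
    have := h.tree_mem e (CTree.node T T')
    rwa [tree, CTree.fold_node] at this
  | h2 T' F h0 ih =>
    rw [forest_cons _ _ _ h0, h.s_p]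
    refine Submodule.add_mem _ (h.p_mem e ?_ (Submodule.subset_span ⟨F, h0, rfl⟩))
      (h.p_mem e (ih) (h.tree_mem e T'))
    have := h.tree_mem e (CTree.node T T')
    rwa [tree, CTree.fold_node] at this

/-- By symmetry `s` is a derivation in its first argument as well, which reduces the claim to a tree
acting on a forest. -/
theorem s_mem {a b : A} (ha : a ∈ h.forestSpan e) (hb : b ∈ h.forestSpan e) :
    s a b ∈ h.forestSpan e := by
  have h1 : ∀ F, F ≠ 0 → s (h.forest e F) b ∈ h.forestSpan e := by
    intro F hF
    induction hb using Submodule.span_induction with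
    | mem x hx =>
      obtain ⟨F', hF', rfl⟩ := hx
      induction F, hF using forest_induction with
      | h1 T => rw [forest_singleton]; exact h.s_tree_forest_mem e T F' hF'
      | h2 T F h0 ih =>
        rw [forest_cons _ _ _ h0, h.s_comm, h.s_p]
        refine Submodule.add_mem _ (h.p_mem e ?_ (Submodule.subset_span ⟨F, h0, rfl⟩))
          (h.p_mem e ?_ (h.tree_mem e T))
        · rw [h.s_comm]; exact h.s_tree_forest_mem e T F' hF'
        · rw [h.s_comm]; exact ih
    | zero => rw [map_zero]; exact Submodule.zero_mem _
    | add x y _ _ hx hy => rw [map_add]; exact Submodule.add_mem _ hx hy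
    | smul c x _ hx => rw [map_smul]; exact Submodule.smul_mem _ _ hx
  induction ha using Submodule.span_induction with
  | mem x hx =>
    obtain ⟨F', hF', rfl⟩ := hx
    exact h1 F' hF'
  | zero => rw [map_zero]; exact Submodule.zero_mem _
  | add x y _ _ hx hy => rw [map_add]; exact Submodule.add_mem _ hx hy
  | smul c x _ hx => rw [map_smul]; exact Submodule.smul_mem _ _ hx

end IsBiderivation

namespace Operad

variable {K : Type*} [Field K] (O : Operad K) {V : Type} [DecidableEq V]

theorem gmul_smul (c : K) (μ : O.obj (Fin 2)) (a b : O.Twisted V) :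
    O.gmul (c • μ) a b = c • O.gmul μ a b := by
  induction a using Twisted.induction with
  | h0 => simp
  | add a a' h h' => rw [map_add, LinearMap.add_apply, h, h', map_add, LinearMap.add_apply,
      smul_add]
  | hom B x =>
    induction b using Twisted.induction with
    | h0 => simp
    | add a a' h h' => rw [map_add, h, h', map_add, smul_add]
    | hom C y =>
      rw [gmul_hom_hom, gmul_hom_hom]
      split_ifs
      · simp only [map_smul, LinearMap.smul_apply]
      · rw [smul_zero]

theorem gmul_neg (μ : O.obj (Fin 2)) (a b : O.Twisted V) :
    O.gmul (-μ) a b = -O.gmul μ a b := by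
  rw [← neg_one_smul K μ, gmul_smul, neg_one_smul]

theorem gmul_zero (a b : O.Twisted V) : O.gmul 0 a b = 0 := by
  rw [← zero_smul K (0 : O.obj (Fin 2)), gmul_smul, zero_smul]

end Operad

end

noncomputable section

/-! ### The presentation of `SP` -/

namespace SP

variable {K : Type*} [Field K]

theorem map_P {V W : Type} [Finite V] [Finite W] (σ : Fin 2 ≃ V) (τ : V ≃ W) :
    (gens K).map τ (P K σ) = P K (σ.trans τ) :=
  Subtype.ext ((graphOperad K).map_trans σ τ _).symm

theorem map_S {V W : Type} [Finite V] [Finite W] (σ : Fin 2 ≃ V) (τ : V ≃ W) :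
    (gens K).map τ (S K σ) = S K (σ.trans τ) :=
  Subtype.ext ((graphOperad K).map_trans σ τ _).symm

theorem map_basis_bot {V W : Type} [Finite V] [Finite W] [Nonempty V] [Nonempty W] (σ : V ≃ W) :
    (GraphOperad.species K).map σ (GraphOperad.basis K ⊥) = GraphOperad.basis K ⊥ := by
  classical
  apply Subtype.ext
  funext g
  refine Eq.trans (GraphOperad.coeff_basis (K := K) (⊥ : SimpleGraph V) (g.comap σ)) (Eq.trans ?_
    (GraphOperad.coeff_basis (K := K) (⊥ : SimpleGraph W) g).symm)
  congr 1
  rw [eq_iff_iff]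
  constructor
  · intro h
    ext i j
    have := congrArg (fun h => h.Adj (σ.symm i) (σ.symm j)) h
    simpa using this
  · rintro rfl
    rfl

theorem map_basis_top {V W : Type} [Finite V] [Finite W] [Nonempty V] [Nonempty W] (σ : V ≃ W) :
    (GraphOperad.species K).map σ (GraphOperad.basis K ⊤) = GraphOperad.basis K ⊤ := by
  classical
  apply Subtype.ext
  funext g
  refine Eq.trans (GraphOperad.coeff_basis (K := K) (⊤ : SimpleGraph V) (g.comap σ)) (Eq.trans ?_
    (GraphOperad.coeff_basis (K := K) (⊤ : SimpleGraph W) g).symm)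
  congr 1
  rw [eq_iff_iff]
  constructor
  · intro h
    ext i j
    have := congrArg (fun h => h.Adj (σ.symm i) (σ.symm j)) h
    simpa using this
  · rintro rfl
    ext i j
    simp

theorem P_congr {V : Type} [Finite V] (σ τ : Fin 2 ≃ V) : P K σ = P K τ := by
  have : Nonempty V := ⟨σ 0⟩
  exact Subtype.ext ((map_basis_bot σ).trans (map_basis_bot τ).symm)

theorem S_congr {V : Type} [Finite V] (σ τ : Fin 2 ≃ V) : S K σ = S K τ := by
  have : Nonempty V := ⟨σ 0⟩
  exact Subtype.ext ((map_basis_top σ).trans (map_basis_top τ).symm)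

theorem exists_eq {V : Type} [Finite V] (σ : Fin 2 ≃ V) (x : (gens K).obj V) :
    ∃ a b : K, x = a • P K σ + b • S K σ := by
  obtain ⟨x, hx⟩ := x
  induction hx using Submodule.span_induction with
  | mem x hx =>
    obtain ⟨τ, z, rfl | rfl, rfl⟩ := hx
    · exact ⟨1, 0, by rw [one_smul, zero_smul, add_zero]; exact P_congr τ σ⟩
    · exact ⟨0, 1, by rw [one_smul, zero_smul, zero_add]; exact S_congr τ σ⟩
  | zero => exact ⟨0, 0, by rw [zero_smul, zero_smul, add_zero]; rfl⟩
  | add x y hx hy h1 h2 =>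
    obtain ⟨a, b, h1⟩ := h1
    obtain ⟨c, d, h2⟩ := h2
    refine ⟨a + c, b + d, ?_⟩
    rw [add_smul, add_smul, add_add_add_comm, ← h1, ← h2]
    rfl
  | smul c x hx h1 =>
    obtain ⟨a, b, h1⟩ := h1
    refine ⟨c * a, c * b, ?_⟩
    rw [mul_smul, mul_smul, ← smul_add, ← h1]
    rfl

theorem isBinary : (gens K).IsBinary := by
  intro V _ hV
  refine ⟨fun x y => ?_⟩
  have h : ∀ x : (gens K).obj V, x = 0 := by
    rintro ⟨x, hx⟩
    have he : {y | ∃ (σ : Fin 2 ≃ V), ∃ x ∈ ({points K, segment K} : Set _),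
        (graphOperad K).map σ x = y} = ∅ := by
      rw [Set.eq_empty_iff_forall_notMem]
      rintro y ⟨σ, -⟩
      exact hV (by rw [← Nat.card_congr σ, Nat.card_fin])
    have hx' : x ∈ Submodule.span K {y | ∃ (σ : Fin 2 ≃ V),
      ∃ x ∈ ({points K, segment K} : Set _), (graphOperad K).map σ x = y} := hx
    rw [he, Submodule.span_empty] at hx'
    exact Subtype.ext hx'
  rw [h x, h y]

theorem tree_mem_weight (i : Fin 3) (x : (gens K).obj (Option Unit)) (y : (gens K).obj (Fin 2)) :
    tree K i x y ∈ (FreeOperad.weight (gens K) 2).carrier (Fin 3) :=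
  Submodule.subset_span (.map _ (.comp (.of x) (.of y)))

theorem isQuadratic : IsQuadratic (gens K) (relations K) := by
  intro V _
  refine Submodule.span_le.2 ?_
  rintro _ ⟨σ, x, hx, rfl⟩
  refine (FreeOperad.weight (gens K) 2).map_mem σ ?_
  rcases hx with rfl | rfl
  · exact Submodule.sub_mem _ (tree_mem_weight _ _ _) (tree_mem_weight _ _ _)
  · exact Submodule.sub_mem _ (Submodule.sub_mem _ (tree_mem_weight _ _ _) (tree_mem_weight _ _ _))
      (tree_mem_weight _ _ _)

variable (K) in
/-- The operad given by the presentation. -/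
abbrev presented : Operad K := Ope (gens K) (relations K)

variable (K) in
/-- The projection to the operad given by the presentation. -/
def proj : Operad.Hom (freeOperad (gens K)) (presented K) :=
  (freeOperad (gens K)).quotientHom (relations K)

variable (K) in
/-- The class of the edgeless graph with two vertices. -/
def p : (presented K).obj (Fin 2) :=
  (proj K).app (Fin 2) (FreeOperad.ι (gens K) (Fin 2) (P K (Equiv.refl _)))

variable (K) in
/-- The class of the graph with two vertices and an edge. -/
def s : (presented K).obj (Fin 2) :=
  (proj K).app (Fin 2) (FreeOperad.ι (gens K) (Fin 2) (S K (Equiv.refl _)))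

theorem map_p {V : Type} [Finite V] (σ : Fin 2 ≃ V) :
    (presented K).map σ (p K) = (proj K).app V (FreeOperad.ι (gens K) V (P K σ)) := by
  rw [p, ← (proj K).app_map, FreeOperad.map_ι, map_P]
  rfl

theorem map_s {V : Type} [Finite V] (σ : Fin 2 ≃ V) :
    (presented K).map σ (s K) = (proj K).app V (FreeOperad.ι (gens K) V (S K σ)) := by
  rw [s, ← (proj K).app_map, FreeOperad.map_ι, map_S]
  rfl

theorem map_swap_p : (presented K).map (Equiv.swap 0 1) (p K) = p K := by
  rw [map_p, P_congr]
  rfl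

theorem map_swap_s : (presented K).map (Equiv.swap 0 1) (s K) = s K := by
  rw [map_s, S_congr]
  rfl

theorem proj_eq_zero {x : (freeOperad (gens K)).obj (Fin 3)}
    (hx : x = relation₁ K ∨ x = relation₂ K) :
    (proj K).app (Fin 3) x = 0 := by
  refine (Submodule.Quotient.mk_eq_zero _).2 (.of (Submodule.subset_span ⟨Equiv.refl _, x, ?_, ?_⟩))
  · exact hx
  · exact (freeOperad (gens K)).map_refl x

theorem proj_tree (i : Fin 3) (x : (gens K).obj (Option Unit)) (y : (gens K).obj (Fin 2)) :
    (proj K).app (Fin 3) (tree K i x y) = (presented K).map (Relabel.slot (Equiv.refl _) i)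
      ((presented K).comp ((proj K).app _ (FreeOperad.ι (gens K) _ x))
        ((proj K).app _ (FreeOperad.ι (gens K) _ y))) := by
  rw [← (proj K).app_comp, ← (proj K).app_map]
  rfl

/-- Read in the twisted algebra, the first relation is associativity and the second is the
derivation rule, up to the commutativity of both operations. -/
theorem isBiderivation {V : Type} [DecidableEq V] :
    IsBiderivation ((presented K).gmul (V := V) (p K)) ((presented K).gmul (s K)) where
  p_comm a b := by rw [← Operad.gmul_swap, map_swap_p]
  s_comm a b := by rw [← Operad.gmul_swap, map_swap_s]
  p_assoc a b c := by
    -- The entries are indexed by the leaf at the root: the first relation is the tree of index `2`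
    -- minus that of index `0`, and index `1` does not occur.
    have h := (presented K).gmul_relation ![-p K, 0, p K] ![p K, p K, p K] (by
      have h := proj_eq_zero (K := K) (Or.inl rfl)
      rw [relation₁, map_sub, proj_tree, proj_tree, ← map_p, ← map_p] at h
      simp only [Fin.sum_univ_three, Matrix.cons_val_zero, Matrix.cons_val_one, Matrix.cons_val,
          map_neg, map_zero, LinearMap.neg_apply, LinearMap.zero_apply]
      rw [Operad.map_eq_self _ (σ := Equiv.refl _) (fun _ => rfl)] at h
      refine Eq.trans ?_ h
      abel) a b c
    simp only [Matrix.cons_val_zero, Matrix.cons_val_one, Matrix.cons_val, Operad.gmul_neg,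
      Operad.gmul_zero, add_zero] at h
    rw [add_neg_eq_zero] at h
    rw [h, ← Operad.gmul_swap, map_swap_p]
  s_p a b c := by
    -- Index `0` carries S below P, indices `1` and `2` carry P below S with negative sign.
    have h := (presented K).gmul_relation ![s K, -p K, -p K] ![p K, s K, s K] (by
      have h := proj_eq_zero (K := K) (Or.inr rfl)
      rw [relation₂, map_sub, map_sub, proj_tree, proj_tree, proj_tree, ← map_p, ← map_p, ← map_s,
        ← map_s] at h
      simp only [Fin.sum_univ_three, Matrix.cons_val_zero, Matrix.cons_val_one, Matrix.cons_val,
          map_neg, LinearMap.neg_apply]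
      rw [Operad.map_eq_self _ (σ := Equiv.refl _) (fun _ => rfl),
        Operad.map_eq_self _ (σ := Equiv.refl _) (fun _ => rfl)] at h
      refine Eq.trans ?_ h
      abel) a b c
    simp only [Matrix.cons_val_zero, Matrix.cons_val_one, Matrix.cons_val, Operad.gmul_neg] at h
    have e1 : ∀ a b : (presented K).Twisted V, (presented K).gmul (s K) a b =
      (presented K).gmul (s K) b a := fun a b => by rw [← Operad.gmul_swap, map_swap_s]
    rw [e1 a, e1 a c]
    rw [← sub_eq_zero, ← h]
    abel

theorem binMem {V : Type} [Finite V] (x : (presented K).obj V) :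
    Operad.BinMem (presented K) {p K, s K} V x := by
  refine Operad.binMem_of_surjective (proj K) _ ?_
    (Operad.quotientHom_surjective (freeOperad (gens K)) (relations K) V) x
  intro V _ g
  by_cases hV : Nonempty (Fin 2 ≃ V)
  · obtain ⟨σ⟩ := hV
    obtain ⟨a, b, rfl⟩ := exists_eq σ g
    simp only [map_add, map_smul]
    rw [← map_p, ← map_s]
    exact .add (.smul a (.map σ (.of_mem _ (Or.inl rfl))))
      (.smul b (.map σ (.of_mem _ (Or.inr rfl))))
  · have h := isBinary (K := K) V fun h => hV
      ⟨(Finite.equivFinOfCardEq h).symm⟩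
    rw [h.elim g 0, map_zero, map_zero]
    exact .zero

/-- The upper bound for `Ope(G, R)`: the span of the forests contains the generators of the twisted
algebra and is closed under both products. -/
theorem forestSpan_eq_top {V : Type} [DecidableEq V] :
    (isBiderivation (K := K)).forestSpan (presented K).leaf =
      (⊤ : Submodule K ((presented K).Twisted V)) := by
  refine Operad.Twisted.eq_top_of_binMem _ _ (S := {p K, s K}) ?_ ?_ fun U _ x => binMem x
  · intro v
    exact isBiderivation.tree_mem _ (CTree.leaf v)
  · rintro μ (rfl | rfl) a ha b hb
    · exact isBiderivation.p_mem _ ha hb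
    · exact isBiderivation.s_mem _ ha hb

end SP

end

/-! ### The surjection from the presented operad onto `SP` -/

noncomputable section

namespace Operad

variable {K : Type*} [Field K]

/-- The inclusion of a suboperad. -/
def suboperadHom (O : Operad K) (G : O.toLinSpecies.Sub) : Hom (O.suboperad G) O where
  app V _ := Submodule.subtype ((O.genSub G).carrier V)
  app_map _ _ := rfl
  app_one := rfl
  app_comp _ _ := rfl

theorem suboperadHom_injective (O : Operad K) (G : O.toLinSpecies.Sub) (V : Type) [Finite V] :
    Function.Injective ((O.suboperadHom G).app V) :=
  Submodule.subtype_injective _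

/-- The composition of two morphisms of operads. -/
def Hom.comp {O P Q : Operad K} (ψ : Hom P Q) (φ : Hom O P) : Hom O Q where
  app V _ := ψ.app V ∘ₗ φ.app V
  app_map σ x := by rw [LinearMap.comp_apply, φ.app_map, ψ.app_map, LinearMap.comp_apply]
  app_one := by rw [LinearMap.comp_apply, φ.app_one, ψ.app_one]
  app_comp x y := by
    rw [LinearMap.comp_apply, φ.app_comp, ψ.app_comp, LinearMap.comp_apply, LinearMap.comp_apply]

/-- A bijective morphism of operads is an isomorphism. -/
def Hom.toIso {O P : Operad K} (φ : Hom O P)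
    (h : ∀ (V : Type) [Finite V], Function.Bijective (φ.app V)) : Iso O P where
  equiv V _ := LinearEquiv.ofBijective (φ.app V) (h V)
  map_equiv := φ.app_map
  equiv_one := φ.app_one
  equiv_comp := φ.app_comp

end Operad

namespace SP

variable {K : Type*} [Field K]

variable (K) in
/-- The morphism from the free operad that sends the generators to the two graphs. -/
def freeHom : Operad.Hom (freeOperad (gens K)) (operad K) :=
  FreeOperad.lift (operad K)
    (fun V _ => Submodule.inclusion (p := (generators K).carrier V)
      (p' := ((graphOperad K).genSub (generators K)).carrier V) fun _ hx => .of hx)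
    (fun _ _ => rfl)

variable (K) in
/-- The inclusion of `SP` into the operad of graphs. -/
def inclusion : Operad.Hom (operad K) (graphOperad K) :=
  (graphOperad K).suboperadHom (generators K)

theorem inclusion_injective (V : Type) [Finite V] : Function.Injective ((inclusion K).app V) :=
  Operad.suboperadHom_injective _ _ V

variable (K) in
/-- The morphism from the free operad to the operad of graphs. -/
def graphHom (V : Type) [Finite V] :
    (freeOperad (gens K)).obj V →ₗ[K] (GraphOperad.species K).obj V :=
  (inclusion K).app V ∘ₗ (freeHom K).app V

theorem graphHom_tree (i : Fin 3) (x : (gens K).obj (Option Unit)) (y : (gens K).obj (Fin 2)) :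
    graphHom K (Fin 3) (tree K i x y) =
      (GraphOperad.species K).map (Relabel.slot (Equiv.refl _) i) (GraphOperad.comp K x.1 y.1) :=
  rfl

theorem total_tree (w : Fin 3 → Fin 3 → K) (i : Fin 3) (x : (gens K).obj (Option Unit))
    (y : (gens K).obj (Fin 2)) :
    GraphOperad.total w (graphHom K (Fin 3) (tree K i x y)) =
      GraphOperad.total (GraphOperad.contractWeight fun a b => w (Relabel.slot (Equiv.refl _) i a)
        (Relabel.slot (Equiv.refl _) i b)) x.1 *
      GraphOperad.total (fun a b => w (Relabel.slot (Equiv.refl _) i (.inr a))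
        (Relabel.slot (Equiv.refl _) i (.inr b))) y.1 := by
  rw [graphHom_tree, GraphOperad.total_map]
  exact GraphOperad.total_comp _ x.1 y.1

theorem total_P {V : Type} [Finite V] (σ : Fin 2 ≃ V) (w : V → V → K) :
    GraphOperad.total w (P K σ).1 = 1 :=
  (GraphOperad.total_map σ w _).trans (GraphOperad.total_points _)

theorem total_S {V : Type} [Finite V] (σ : Fin 2 ≃ V) (w : V → V → K) :
    GraphOperad.total w (S K σ).1 = w (σ 0) (σ 1) * w (σ 1) (σ 0) :=
  (GraphOperad.total_map σ w _).trans (GraphOperad.total_segment _)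

theorem graphHom_relation₁ : graphHom K (Fin 3) (relation₁ K) = 0 := by
  refine GraphOperad.eq_zero_of_total _ fun w => ?_
  rw [relation₁, map_sub, map_sub, total_tree, total_tree, total_P, total_P, total_P, total_P]
  ring

/-- On total weights the relation says that the cross sum from one vertex to two others is the sum
of the two single edge weights. -/
theorem graphHom_relation₂ : graphHom K (Fin 3) (relation₂ K) = 0 := by
  refine GraphOperad.eq_zero_of_total _ fun w => ?_
  rw [relation₂, map_sub, map_sub, map_sub, map_sub, total_tree, total_tree, total_tree, total_P,
    total_P, total_P, total_S, total_S, total_S]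
  change (1 : K) * (∑ b : Fin 2, w 0 (Relabel.slot (Equiv.refl _) 0 (.inr b)) *
    w (Relabel.slot (Equiv.refl _) 0 (.inr b)) 0) * 1 - 1 * (w 0 1 * w 1 0) -
    1 * (w 2 0 * w 0 2) = 0
  rw [Fin.sum_univ_two]
  change (1 : K) * (w 0 1 * w 1 0 + w 0 2 * w 2 0) * 1 - 1 * (w 0 1 * w 1 0) -
    1 * (w 2 0 * w 0 2) = 0
  ring

theorem freeHom_relations (V : Type) [Finite V] (x : (freeOperad (gens K)).obj V)
    (hx : x ∈ (relations K).carrier V) : (freeHom K).app V x = 0 := by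
  have h : (relations K).carrier V ≤ LinearMap.ker ((freeHom K).app V) := by
    refine Submodule.span_le.2 ?_
    rintro _ ⟨σ, x, hx, rfl⟩
    rw [SetLike.mem_coe, LinearMap.mem_ker, (freeHom K).app_map]
    have h0 : (freeHom K).app (Fin 3) x = 0 := by
      apply inclusion_injective
      rw [map_zero]
      rcases hx with rfl | rfl
      · exact graphHom_relation₁
      · exact graphHom_relation₂
    rw [h0, map_zero]
  exact h hx

variable (K) in
/-- The morphism from the presented operad to `SP`. -/
def presentedHom : Operad.Hom (presented K) (operad K) :=
  (freeHom K).quotientLift (relations K) freeHom_relations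

/-- The image of the free operad in `𝕂G` contains the generators and the unit and is closed under
all operations that build the suboperad. -/
theorem presentedHom_surjective (V : Type) [Finite V] :
    Function.Surjective ((presentedHom K).app V) := by
  rintro ⟨x, hx⟩
  suffices h : ∃ y, (graphHom K V) y = x by
    obtain ⟨y, hy⟩ := h
    exact ⟨(proj K).app V y, Subtype.ext hy⟩
  have hx : Operad.GenMem (graphOperad K) (generators K) V x := hx
  clear * - hx
  induction hx with
  | @of V _ x hx => exact ⟨FreeOperad.ι (gens K) V ⟨x, hx⟩, rfl⟩
  | one => exact ⟨(freeOperad (gens K)).one, rfl⟩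
  | zero => exact ⟨0, map_zero _⟩
  | add _ _ h1 h2 =>
    obtain ⟨y, rfl⟩ := h1
    obtain ⟨z, rfl⟩ := h2
    exact ⟨y + z, map_add _ _ _⟩
  | smul c _ h1 =>
    obtain ⟨y, rfl⟩ := h1
    exact ⟨c • y, map_smul _ _ _⟩
  | map σ _ h1 =>
    obtain ⟨y, rfl⟩ := h1
    exact ⟨(freeOperad (gens K)).map σ y, congrArg ((inclusion K).app _) ((freeHom K).app_map σ y)⟩
  | comp _ _ h1 h2 =>
    obtain ⟨y, rfl⟩ := h1
    obtain ⟨z, rfl⟩ := h2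
    exact ⟨(freeOperad (gens K)).comp y z, congrArg ((inclusion K).app _)
        ((freeHom K).app_comp y z)⟩

variable (K) in
/-- The morphism from the presented operad to the operad of graphs. -/
def toGraphs : Operad.Hom (presented K) (graphOperad K) := (inclusion K).comp (presentedHom K)

theorem toGraphs_p : (toGraphs K).app (Fin 2) (p K) = (P K (Equiv.refl (Fin 2))).1 := rfl

theorem toGraphs_s : (toGraphs K).app (Fin 2) (s K) = (S K (Equiv.refl (Fin 2))).1 := rfl

/-- The total weight of the graphs in the image of an element of the presented operad. -/
def totalWeight {V : Type} [Finite V] (w : V → V → K) : (presented K).obj V →ₗ[K] K :=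
  LinearMap.comp (M₂ := (graphOperad K).obj V) (GraphOperad.total w) ((toGraphs K).app V)

theorem totalWeight_map {V W : Type} [Finite V] [Finite W] (σ : V ≃ W) (w : W → W → K)
    (x : (presented K).obj V) :
    totalWeight w ((presented K).map σ x) = totalWeight (fun i j => w (σ i) (σ j)) x :=
  (congrArg (GraphOperad.total w) ((toGraphs K).app_map σ x)).trans (GraphOperad.total_map σ w _)

theorem totalWeight_one (w : Unit → Unit → K) : totalWeight w (presented K).one = 1 := by
  refine (congrArg (GraphOperad.total w) (toGraphs K).app_one).trans
    ((GraphOperad.total_basis w ⊥).trans ?_)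
  simp [GraphOperad.graphWeight]

theorem totalWeight_bin_p {A B : Type} [Finite A] [Finite B] (w : A ⊕ B → A ⊕ B → K)
    (x : (presented K).obj A) (y : (presented K).obj B) :
    totalWeight w ((presented K).bin (p K) x y) =
      totalWeight (fun i j => w (.inl i) (.inl j)) x *
        totalWeight (fun i j => w (.inr i) (.inr j)) y := by
  have := Fintype.ofFinite A
  have := Fintype.ofFinite B
  refine (congrArg (GraphOperad.total w) ((toGraphs K).app_bin (p K) x y)).trans ?_
  rw [toGraphs_p]
  refine (GraphOperad.total_bin w _ _ _).trans ?_
  rw [total_P, one_mul]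
  rfl

theorem totalWeight_bin_s {A B : Type} [Fintype A] [Fintype B] (w : A ⊕ B → A ⊕ B → K)
    (x : (presented K).obj A) (y : (presented K).obj B) :
    totalWeight w ((presented K).bin (s K) x y) =
      (∑ a, ∑ b, w (.inl a) (.inr b) * w (.inr b) (.inl a)) *
      (totalWeight (fun i j => w (.inl i) (.inl j)) x *
        totalWeight (fun i j => w (.inr i) (.inr j)) y) := by
  refine (congrArg (GraphOperad.total w) ((toGraphs K).app_bin (s K) x y)).trans ?_
  rw [toGraphs_s]
  refine (GraphOperad.total_bin w _ _ _).trans ?_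
  rw [total_S]
  congr 1
  simp

end SP

end

/-! ### Injectivity: total weights separate the elements of the presented operad -/

noncomputable section

namespace Operad

variable {K : Type*} [Field K] (O : Operad K) {V : Type} [DecidableEq V]

/-- The projection of the twisted algebra to the operations with arguments `B`. -/
def component (B : Finset V) : O.Twisted V →ₗ[K] O.obj B :=
  DirectSum.component K (Finset V) (fun B => O.obj B) B

theorem component_hom_self (B : Finset V) (x : O.obj B) : O.component B (O.hom B x) = x :=
  DirectSum.component.lof_self K (M := fun B : Finset V => O.obj B) B x

theorem component_hom_of_ne {B C : Finset V} (h : C ≠ B) (x : O.obj C) :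
    O.component B (O.hom C x) = 0 :=
  (DirectSum.component.of K (M := fun B : Finset V => O.obj B) B C x).trans (dif_neg h)

end Operad

namespace SP

variable {K : Type*} [Field K]

section

variable {V : Type} [DecidableEq V]

/-- The element `a` of the twisted algebra is an operation whose arguments are the elements of `M`
and whose total weight is `c`; it vanishes if `M` has multiple elements. -/
def HasWeight (M : Multiset V) (c : (V → V → K) → K) (a : (presented K).Twisted V) : Prop :=
  (¬ M.Nodup ∧ a = 0) ∨ ∃ (B : Finset V) (x : (presented K).obj B), B.val = M ∧
    a = (presented K).hom B x ∧ ∀ w : V → V → K, totalWeight (fun i j : B => w i j) x = c w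

theorem hasWeight_leaf (v : V) :
    HasWeight (K := K) {v} (fun _ => 1) ((presented K).leaf v) :=
  Or.inr ⟨{v}, _, rfl, rfl, fun w => by rw [totalWeight_map, totalWeight_one]⟩

/-- If the labels overlap, the product vanishes and the union has repeated labels, in accordance
with the first alternative of `HasWeight`. -/
theorem HasWeight.gmul {M M' : Multiset V} {c c' d : (V → V → K) → K}
    {a a' : (presented K).Twisted V} (h : HasWeight M c a) (h' : HasWeight M' c' a')
    (μ : (presented K).obj (Fin 2))
    (hμ : ∀ (B C : Finset V), B.val = M → C.val = M' → ∀ (x : (presented K).obj B)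
      (y : (presented K).obj C) (w : V → V → K), totalWeight (fun i j : B => w i j) x = c w →
      totalWeight (fun i j : C => w i j) y = c' w →
      totalWeight (fun i j : B ⊕ C => w (i.elim (·.1) (·.1)) (j.elim (·.1) (·.1)))
        ((presented K).bin μ x y) = d w) :
    HasWeight (M + M') d ((presented K).gmul μ a a') := by
  rcases h with ⟨h, rfl⟩ | ⟨B, x, rfl, rfl, hx⟩
  · left
    refine ⟨fun h1 => h (Multiset.nodup_add.1 h1).1, ?_⟩
    rw [map_zero, LinearMap.zero_apply]
  rcases h' with ⟨h', rfl⟩ | ⟨C, y, rfl, rfl, hy⟩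
  · left
    exact ⟨fun h1 => h' (Multiset.nodup_add.1 h1).2.1, map_zero _⟩
  by_cases hd : Disjoint B C
  · right
    refine ⟨B ∪ C, _, ?_, Operad.gmul_hom_hom_of_disjoint _ _ hd _ _, fun w => ?_⟩
    · rw [← Finset.disjUnion_eq_union B C hd]
      rfl
    · rw [totalWeight_map, ← hμ B C rfl rfl x y w (hx w) (hy w)]
      congr 2
      funext i j
      rcases i with i | i <;> rcases j with j | j <;> rfl
  · left
    refine ⟨fun h1 => hd (Finset.disjoint_val.1 (Multiset.nodup_add.1 h1).2.2), ?_⟩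
    exact Operad.gmul_hom_hom_of_not_disjoint _ _ hd _ _

theorem HasWeight.p {M M' : Multiset V} {c c' : (V → V → K) → K}
    {a a' : (presented K).Twisted V} (h : HasWeight M c a) (h' : HasWeight M' c' a') :
    HasWeight (M + M') (fun w => c w * c' w) ((presented K).gmul (p K) a a') := by
  refine h.gmul h' _ ?_
  intro B C _ _ x y w hx hy
  rw [totalWeight_bin_p, ← hx, ← hy]
  rfl

theorem HasWeight.s {M M' : Multiset V} {c c' : (V → V → K) → K}
    {a a' : (presented K).Twisted V} (h : HasWeight M c a) (h' : HasWeight M' c' a') :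
    HasWeight (M + M') (fun w => CTree.cross w M M' * (c w * c' w))
      ((presented K).gmul (s K) a a') := by
  refine h.gmul h' _ ?_
  rintro B C rfl rfl x y w hx hy
  rw [totalWeight_bin_s, ← hx, ← hy]
  congr 1
  change ∑ a : B, ∑ b : C, w a b * w b a = _
  rw [Finset.sum_coe_sort B (fun a => ∑ b : C, w a b * w b a)]
  refine Finset.sum_congr rfl fun a _ => ?_
  exact Finset.sum_coe_sort C (fun b => w a b * w b a)

theorem hasWeight_tree (T : CTree V) : HasWeight T.leaves (fun w => CTree.weight w T)
    ((isBiderivation (K := K)).tree (presented K).leaf T) := by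
  induction T using CTree.induction with
  | leaf v => exact hasWeight_leaf v
  | node a b ha hb =>
    simp only [CTree.leaves_node, CTree.weight_node]
    rw [IsBiderivation.tree, CTree.fold_node]
    exact ha.s hb

theorem hasWeight_forest (F : Multiset (CTree V)) (hF : F ≠ 0) :
    HasWeight (CTree.forestLeaves F) (fun w => CTree.forestWeight w F)
      ((isBiderivation (K := K)).forest (presented K).leaf F) := by
  induction F, hF using IsBiderivation.forest_induction with
  | h1 T =>
    rw [IsBiderivation.forest_singleton]
    simpa [CTree.forestLeaves, CTree.forestWeight] using hasWeight_tree (K := K) T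
  | h2 T F h0 ih =>
    simp only [CTree.forestLeaves_cons, CTree.forestWeight_cons]
    rw [IsBiderivation.forest_cons _ _ _ h0]
    exact (hasWeight_tree T).p ih

/-- Write `x` as a combination of forests. Its total weights are the same combination of forest
weights, so by `CTree.forestsIndependent` all coefficients, and with them `x`, vanish. -/
theorem eq_zero_of_totalWeight [CharZero K] [Fintype V] (x : (presented K).obj V)
    (hx : ∀ w : V → V → K, totalWeight w x = 0) : x = 0 := by
  let e : V ≃ (Finset.univ : Finset V) := (Equiv.subtypeUnivEquiv Finset.mem_univ).symm
  let π : (presented K).Twisted V →ₗ[K] (presented K).obj (Finset.univ : Finset V) :=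
    (presented K).component Finset.univ
  have hmem : (presented K).hom Finset.univ ((presented K).map e x) ∈
      (isBiderivation (K := K)).forestSpan (presented K).leaf := by
    rw [forestSpan_eq_top]
    exact Submodule.mem_top
  obtain ⟨n, k, g, hg⟩ := Submodule.mem_span_set'.1 hmem
  choose F hF0 hF using fun i => (g i).2
  have h1 : (presented K).map e x =
      ∑ i, k i • π ((isBiderivation (K := K)).forest (presented K).leaf (F i)) := by
    have h := congrArg π hg
    rw [map_sum] at h
    refine Eq.trans (Operad.component_hom_self _ _ _).symm (h.symm.trans ?_)
    exact Finset.sum_congr rfl fun i _ => by rw [map_smul, hF]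
  -- Forests with other labels, or with repeated labels, project to zero in the component of the
  -- full label set.
  let t := Finset.univ.filter fun i => CTree.forestLeaves (F i) = Finset.univ.val
  have h2 : (presented K).map e x =
      ∑ i ∈ t, k i • π ((isBiderivation (K := K)).forest (presented K).leaf (F i)) := by
    rw [h1, Finset.sum_filter_of_ne]
    intro i _ hne
    by_contra hl
    refine hne ?_
    rcases hasWeight_forest (K := K) (F i) (hF0 i) with ⟨-, h⟩ | ⟨B, y, hB, h, -⟩
    · rw [h, map_zero, smul_zero]
    · rw [h]
      have : π ((presented K).hom B y) = 0 := by
        refine Operad.component_hom_of_ne _ ?_ y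
        rintro rfl
        exact hl hB.symm
      rw [this, smul_zero]
  have h3 : ∀ i ∈ t, ∀ w : V → V → K, totalWeight (fun i j : (Finset.univ : Finset V) => w i j)
      (π ((isBiderivation (K := K)).forest (presented K).leaf (F i))) =
        CTree.forestWeight w (F i) := by
    intro i hi w
    rw [Finset.mem_filter] at hi
    rcases hasWeight_forest (K := K) (F i) (hF0 i) with ⟨h, -⟩ | ⟨B, y, hB, h, hw⟩
    · rw [hi.2] at h
      exact absurd Finset.univ.nodup h
    · obtain rfl : B = Finset.univ := Finset.val_injective (hB.trans hi.2)
      refine Eq.trans ?_ (hw w)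
      rw [h]
      exact congrArg _ (Operad.component_hom_self _ _ y)
  -- A forest may occur several times in the expression. Independence annihilates its total
  -- coefficient, hence also the combination of the operations themselves.
  have h4 := CTree.sum_smul_eq_zero t F k
    (CTree.forestsIndependent (K := K) Finset.univ.nodup _ t F k
      (fun i hi => (Finset.mem_filter.1 hi).2) fun w => by
      rw [← hx w]
      have h5 : totalWeight (fun i j : (Finset.univ : Finset V) => w i j)
          ((presented K).map e x) = totalWeight w x := by
        rw [totalWeight_map]
        rfl
      rw [← h5, h2, map_sum]
      refine Finset.sum_congr rfl fun i hi => ?_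
      rw [map_smul, h3 i hi, smul_eq_mul])
    fun F => π ((isBiderivation (K := K)).forest (presented K).leaf F)
  rw [← h2] at h4
  rw [← (presented K).map_refl x, ← Equiv.self_trans_symm e, (presented K).map_trans, h4, map_zero]

end

theorem presentedHom_injective [CharZero K] (V : Type) [Finite V] :
    Function.Injective ((presentedHom K).app V) := by
  classical
  have := Fintype.ofFinite V
  rw [injective_iff_map_eq_zero]
  intro x hx
  refine eq_zero_of_totalWeight x fun w => ?_
  change GraphOperad.total w ((inclusion K).app V ((presentedHom K).app V x)) = 0
  rw [hx, map_zero]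
  exact map_zero _

/-- `Ope(G, R)` is isomorphic to `SP`. -/
theorem nonempty_iso (K : Type*) [Field K] [CharZero K] :
    Nonempty (Operad.Iso (Ope (gens K) (relations K)) (operad K)) :=
  ⟨(presentedHom K).toIso fun V _ => ⟨presentedHom_injective V, presentedHom_surjective V⟩⟩

end SP

end

noncomputable section

/-! ### The endomorphism operad -/

namespace EndOperad

variable (K : Type*) [Field K] (A : Type*) [AddCommGroup A] [Module K A]

/-- The multilinear operations with arguments `V` on a vector space. -/
def Op (V : Type) : Submodule K (MultilinearMap K (fun _ : V => A) A) where
  carrier := {f | IsEmpty V → f = 0}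
  add_mem' hf hg h := by rw [hf h, hg h, add_zero]
  zero_mem' _ := rfl
  smul_mem' c f hf h := by rw [hf h, smul_zero]

end EndOperad

namespace EndOperad

section

variable {A : Type*}

/-- The arguments of the outer operation in a partial composition. -/
def insert {B C : Type} (a : A) (v : B ⊕ C → A) : Option B → A
  | none => a
  | some b => v (.inl b)

theorem insert_update_inl {B C : Type} [DecidableEq B] [DecidableEq C] (a : A) (v : B ⊕ C → A)
    (b : B) (x : A) : insert a (Function.update v (.inl b) x) =
      Function.update (insert a v) (some b) x := by
  funext i
  rcases i with _ | i
  · rw [Function.update_of_ne (by simp)]; rfl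
  · by_cases h : i = b
    · subst h; simp [insert]
    · rw [Function.update_of_ne (by simpa using h)]
      simp [insert, h]

theorem insert_update_none {B C : Type} [DecidableEq B] (a x : A) (v : B ⊕ C → A) :
    Function.update (insert a v) none x = insert x v := by
  funext i
  rcases i with _ | i
  · simp [insert]
  · rw [Function.update_of_ne (by simp)]; rfl

theorem insert_update_inr {B C : Type} [DecidableEq B] [DecidableEq C] (a : A) (v : B ⊕ C → A)
    (c : C) (x : A) : insert a (Function.update v (.inr c) x) = insert a v := by
  funext i
  rcases i with _ | i
  · rfl
  · simp [insert]

end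

variable {K : Type*} [Field K] {A : Type*} [AddCommGroup A] [Module K A]

theorem map_insert_add {B C : Type} (f : MultilinearMap K (fun _ : Option B => A) A) (a a' : A)
    (v : B ⊕ C → A) : f (insert (a + a') v) = f (insert a v) + f (insert a' v) := by
  classical
  have h := f.map_update_add (insert 0 v) none a a'
  simpa only [insert_update_none] using h

theorem map_insert_smul {B C : Type} (f : MultilinearMap K (fun _ : Option B => A) A) (c : K)
    (a : A) (v : B ⊕ C → A) : f (insert (c • a) v) = c • f (insert a v) := by
  classical
  have h := f.map_update_smul (insert 0 v) none c a
  simpa only [insert_update_none] using h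

theorem map_insert_zero {B C : Type} (f : MultilinearMap K (fun _ : Option B => A) A)
    (v : B ⊕ C → A) : f (insert 0 v) = 0 := by
  simpa using map_insert_smul f 0 0 v

/-- The partial composition of multilinear operations. -/
def comp {B C : Type} (f : MultilinearMap K (fun _ : Option B => A) A)
    (g : MultilinearMap K (fun _ : C => A) A) : MultilinearMap K (fun _ : B ⊕ C => A) A :=
  letI := Classical.decEq B
  letI := Classical.decEq C
  MultilinearMap.mk' (fun v => f (insert (g fun c => v (.inr c)) v))
    (by
      rintro v (b | c) x y
      · simp only [insert_update_inl]
        have h : ∀ z, (fun c => Function.update v (Sum.inl b) z (Sum.inr c)) =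
            fun c => v (.inr c) := by intro z; funext c; simp
        rw [h, h, h, f.map_update_add]
      · simp only [insert_update_inr]
        have h : ∀ z, (fun d => Function.update v (Sum.inr c) z (Sum.inr d)) =
            Function.update (fun d => v (.inr d)) c z := by
          intro z; funext d
          exact congrFun (Function.update_comp_eq_of_injective v Sum.inr_injective c z) d
        rw [h, h, h, g.map_update_add, map_insert_add])
    (by
      rintro v (b | c) r x
      · simp only [insert_update_inl]
        have h : ∀ z, (fun c => Function.update v (Sum.inl b) z (Sum.inr c)) =
            fun c => v (.inr c) := by intro z; funext c; simp
        rw [h, h, f.map_update_smul]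
      · simp only [insert_update_inr]
        have h : ∀ z, (fun d => Function.update v (Sum.inr c) z (Sum.inr d)) =
            Function.update (fun d => v (.inr d)) c z := by
          intro z; funext d
          exact congrFun (Function.update_comp_eq_of_injective v Sum.inr_injective c z) d
        rw [h, h, g.map_update_smul, map_insert_smul])

theorem comp_apply {B C : Type} (f : MultilinearMap K (fun _ : Option B => A) A)
    (g : MultilinearMap K (fun _ : C => A) A) (v : B ⊕ C → A) :
    comp f g v = f (insert (g fun c => v (.inr c)) v) := rfl

end EndOperad

open EndOperad in
/-- The operad of multilinear operations on a vector space. -/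
def endOperad (K : Type*) [Field K] (A : Type*) [AddCommGroup A] [Module K A] : Operad K where
  obj V _ := Op K A V
  map {V W} _ _ σ :=
    { toFun := fun f => ⟨f.1.domDomCongr σ, fun h => by
        rw [f.2 (σ.isEmpty_congr.2 h)]; rfl⟩
      map_add' := fun _ _ => rfl
      map_smul' := fun _ _ => rfl }
  map_refl _ := rfl
  map_trans _ _ _ := rfl
  positive V _ h := ⟨fun f g => Subtype.ext ((f.2 h).trans (g.2 h).symm)⟩
  one := ⟨MultilinearMap.ofSubsingleton K A A () LinearMap.id,
      fun h => absurd h (not_isEmpty_of_nonempty _)⟩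
  comp {B C} _ _ := LinearMap.mk₂ K
    (fun f g => ⟨EndOperad.comp f.1 g.1, fun h => by
      ext v
      rw [comp_apply, g.2 ⟨fun c => h.elim (.inr c)⟩, zero_apply, map_insert_zero]
      rfl⟩)
    (fun f f' g => rfl) (fun c f g => rfl)
    (fun f g g' => Subtype.ext (MultilinearMap.ext fun v => map_insert_add f.1 _ _ v))
    (fun c f g => Subtype.ext (MultilinearMap.ext fun v => map_insert_smul f.1 c _ v))
  comp_map σ τ f g := by
    apply Subtype.ext
    ext v
    change f.1 _ = f.1 _
    congr 1
    funext i
    rcases i with _ | i <;> rfl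
  comp_par f g h := by
    apply Subtype.ext
    ext v
    change f.1 _ = f.1 _
    congr 1
    funext i
    rcases i with _ | _ | i <;> rfl
  comp_seq f g h := by
    apply Subtype.ext
    ext v
    change f.1 _ = f.1 _
    congr 1
    funext i
    rcases i with _ | i
    · change g.1 _ = g.1 _
      congr 1
      funext i
      rcases i with _ | i <;> rfl
    · rfl
  comp_one f := by
    apply Subtype.ext
    ext v
    change f.1 _ = f.1 _
    congr 1
    funext i
    rcases i with _ | i <;> rfl
  one_comp f := by
    apply Subtype.ext
    ext v
    rfl

namespace EndOperad

variable {K : Type*} [Field K] {A : Type*} [AddCommGroup A] [Module K A]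

/-- The value of an operation. -/
def eval {V : Type} [Finite V] (v : V → A) : (endOperad K A).obj V →ₗ[K] A where
  toFun f := (show Op K A V from f).1 v
  map_add' _ _ := rfl
  map_smul' _ _ := rfl

theorem ext_eval {V : Type} [Finite V] {f g : (endOperad K A).obj V}
    (h : ∀ v : V → A, eval v f = eval v g) : f = g :=
  Subtype.ext (MultilinearMap.ext h)

theorem eval_map {V W : Type} [Finite V] [Finite W] (σ : V ≃ W) (f : (endOperad K A).obj V)
    (v : W → A) : eval v ((endOperad K A).map σ f) = eval (fun i => v (σ i)) f := rfl

theorem eval_comp {B C : Type} [Finite B] [Finite C] (f : (endOperad K A).obj (Option B))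
    (g : (endOperad K A).obj C) (v : B ⊕ C → A) :
    eval v ((endOperad K A).comp f g) = eval (insert (eval (fun c => v (.inr c)) g) v) f := rfl

/-- A bilinear operation, as an element of the endomorphism operad. -/
def ofBilin (b : A →ₗ[K] A →ₗ[K] A) : (endOperad K A).obj (Fin 2) :=
  ⟨MultilinearMap.mk' (fun v => b (v 0) (v 1))
    (by intro v i x y; fin_cases i <;> simp) (by intro v i c x; fin_cases i <;> simp),
    fun h => absurd h (not_isEmpty_of_nonempty _)⟩

theorem eval_ofBilin (b : A →ₗ[K] A →ₗ[K] A) (v : Fin 2 → A) :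
    eval v (ofBilin b) = b (v 0) (v 1) := rfl

theorem eval_bin {B C : Type} [Finite B] [Finite C] (μ : (endOperad K A).obj (Fin 2))
    (f : (endOperad K A).obj B) (g : (endOperad K A).obj C) (v : B ⊕ C → A) :
    eval v ((endOperad K A).bin μ f g) =
      eval ![eval (fun b => v (.inl b)) f, eval (fun c => v (.inr c)) g] μ := by
  rw [Operad.bin_apply, eval_comp, eval_map, eval_comp, eval_map]
  congr 2
  funext i
  fin_cases i <;> rfl

end EndOperad

end

noncomputable section

/-! ### The generators of `SP` and of its Koszul dual -/

theorem Equiv.Perm.fin_two (τ : Equiv.Perm (Fin 2)) : τ = Equiv.refl _ ∨ τ = Equiv.swap 0 1 := by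
  revert τ; decide

/-- Two bijections from `Fin 2` are equal or differ by the transposition. -/
theorem Equiv.fin_two_eq_or {V : Type} (σ τ : Fin 2 ≃ V) :
    τ = σ ∨ τ = (Equiv.swap 0 1).trans σ := by
  have h : τ = (τ.trans σ.symm).trans σ := by ext; simp
  rcases Equiv.Perm.fin_two (τ.trans σ.symm) with h1 | h1
  · left; rw [h, h1]; rfl
  · right; rw [h, h1]

namespace SP

variable {K : Type*} [Field K]

/-- The two generators. -/
def gen (K : Type*) [Field K] {V : Type} [Finite V] (u : Bool) (σ : Fin 2 ≃ V) : (gens K).obj V :=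
  if u then S K σ else P K σ

/-- The coordinates with respect to the two generators. -/
def coord (K : Type*) [Field K] (V : Type) [Finite V] (u : Bool) : (gens K).obj V →ₗ[K] K :=
  GraphOperad.coeff K (if u then ⊤ else ⊥) ∘ₗ Submodule.subtype ((generators K).carrier V)

theorem map_gen {V W : Type} [Finite V] [Finite W] (u : Bool) (σ : Fin 2 ≃ V) (τ : V ≃ W) :
    (gens K).map τ (gen K u σ) = gen K u (σ.trans τ) := by
  cases u
  · exact map_P σ τ
  · exact map_S σ τ

theorem gen_congr {V : Type} [Finite V] (u : Bool) (σ τ : Fin 2 ≃ V) : gen K u σ = gen K u τ := by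
  cases u
  · exact P_congr σ τ
  · exact S_congr σ τ

theorem coord_gen {V : Type} [Finite V] (u v : Bool) (σ : Fin 2 ≃ V) :
    coord K V u (gen K v σ) = if u = v then 1 else 0 := by
  have : Nonempty V := ⟨σ 0⟩
  have : Nontrivial V := ⟨σ 0, σ 1, by simp⟩
  have h : (⊥ : SimpleGraph V) ≠ ⊤ := bot_ne_top
  have hP : (P K σ).1 = GraphOperad.basis K ⊥ := map_basis_bot σ
  have hS : (S K σ).1 = GraphOperad.basis K ⊤ := map_basis_top σ
  cases u <;> cases v
  · refine (congrArg (GraphOperad.coeff K _) hP).trans ((GraphOperad.coeff_basis _ _).trans ?_)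
    simp
  · refine (congrArg (GraphOperad.coeff K _) hS).trans ((GraphOperad.coeff_basis _ _).trans ?_)
    simp
  · refine (congrArg (GraphOperad.coeff K _) hP).trans ((GraphOperad.coeff_basis _ _).trans ?_)
    simp
  · refine (congrArg (GraphOperad.coeff K _) hS).trans ((GraphOperad.coeff_basis _ _).trans ?_)
    simp

theorem eq_sum_gen {V : Type} [Finite V] (σ : Fin 2 ≃ V) (x : (gens K).obj V) :
    x = ∑ u, coord K V u x • gen K u σ := by
  obtain ⟨a, b, rfl⟩ := exists_eq σ x
  change a • gen K false σ + b • gen K true σ =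
    ∑ u, coord K V u (a • gen K false σ + b • gen K true σ) • gen K u σ
  rw [Fintype.sum_bool, map_add, map_add, map_smul, map_smul, map_smul, map_smul, coord_gen,
    coord_gen, coord_gen, coord_gen, add_comm]
  simp only [if_pos, smul_eq_mul, mul_one, mul_zero, reduceCtorEq, if_false, zero_add, add_zero]

theorem coord_map {V W : Type} [Finite V] [Finite W] (τ : V ≃ W) (u : Bool) (x : (gens K).obj V) :
    coord K W u ((gens K).map τ x) = coord K V u x := by
  by_cases hV : Nonempty (Fin 2 ≃ V)
  · obtain ⟨σ⟩ := hV
    rw [eq_sum_gen σ x]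
    simp only [map_sum, map_smul, map_gen, coord_gen]
  · have h := isBinary (K := K) V fun h => hV ⟨(Finite.equivFinOfCardEq h).symm⟩
    rw [h.elim x 0, map_zero, map_zero, map_zero]

/-- The two generators of the Koszul dual. -/
def dualGen (K : Type*) [Field K] {V : Type} [Finite V] (u : Bool) (σ : Fin 2 ≃ V) :
    (gens K).dual.obj V :=
  -- The sign records whether `σ 0` comes first in the ordering `o`. Orderings of a two-element set
  -- exist only for `n = 2`, so other `n` impose nothing.
  ⟨fun _ o => (if (o.symm (σ 0)).val = 0 then 1 else -1 : K) • coord K V u, by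
    intro n o τ
    obtain rfl : n = 2 := by simpa using Nat.card_congr (o.trans σ.symm)
    rw [smul_smul]
    have h : ∀ (τ : Equiv.Perm (Fin 2)) (k : Fin 2), (if (τ.symm k).val = 0 then 1 else -1 : ℤ) =
        (Equiv.Perm.sign τ : ℤ) * if k.val = 0 then 1 else -1 := by decide
    have h1 := congrArg (Int.cast : ℤ → K) (h τ (o.symm (σ 0)))
    push_cast at h1
    rw [← h1]
    rfl⟩

theorem dualGen_apply {V : Type} [Finite V] (u : Bool) (σ : Fin 2 ≃ V) :
    (dualGen K u σ).1 2 σ = coord K V u := by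
  change (if (σ.symm (σ 0)).val = 0 then 1 else -1 : K) • coord K V u = _
  simp

/-- The other ordering of a two-element set only changes the sign, so a single ordering determines
the element. -/
theorem dual_ext {V : Type} [Finite V] (σ : Fin 2 ≃ V) {f g : (gens K).dual.obj V}
    (h : f.1 2 σ = g.1 2 σ) : f = g := by
  apply Subtype.ext
  funext n o
  obtain rfl : n = 2 := by simpa using Nat.card_congr (o.trans σ.symm)
  rcases Equiv.fin_two_eq_or σ o with rfl | rfl
  · exact h
  · rw [f.2 2 σ, g.2 2 σ, h]

theorem map_dualGen {V W : Type} [Finite V] [Finite W] (u : Bool) (σ : Fin 2 ≃ V) (τ : V ≃ W) :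
    (gens K).dual.map τ (dualGen K u σ) = dualGen K u (σ.trans τ) := by
  refine dual_ext (σ.trans τ) ?_
  rw [dualGen_apply]
  apply LinearMap.ext
  intro x
  have h : (σ.trans τ).trans τ.symm = σ := by ext; simp
  change (dualGen K u σ).1 2 ((σ.trans τ).trans τ.symm) ((gens K).map τ.symm x) = _
  rw [h, dualGen_apply, coord_map]

/-- The generators P and S are symmetric, so the sign twist makes their duals antisymmetric. -/
theorem dualGen_swap {V : Type} [Finite V] (u : Bool) (σ : Fin 2 ≃ V) :
    dualGen K u ((Equiv.swap 0 1).trans σ) = -dualGen K u σ := by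
  refine dual_ext ((Equiv.swap 0 1).trans σ) ?_
  rw [dualGen_apply]
  change _ = -(dualGen K u σ).1 2 ((Equiv.swap 0 1).trans σ)
  rw [(dualGen K u σ).2 2 σ, dualGen_apply, Equiv.Perm.sign_swap (by decide)]
  apply LinearMap.ext
  intro x
  change _ = -((((-1 : ℤˣ) : ℤ) : K) * coord K V u x)
  simp

theorem eq_sum_dualGen {V : Type} [Finite V] (σ : Fin 2 ≃ V) (f : (gens K).dual.obj V) :
    f = ∑ u, f.1 2 σ (gen K u σ) • dualGen K u σ := by
  refine dual_ext σ ?_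
  have h : (∑ u, f.1 2 σ (gen K u σ) • dualGen K u σ).1 2 σ =
      ∑ u, f.1 2 σ (gen K u σ) • coord K V u := by
    have h1 := map_sum (Koszul.eval (gens K) σ) (fun u => f.1 2 σ (gen K u σ) • dualGen K u σ)
      Finset.univ
    refine Eq.trans h1 ?_
    refine Finset.sum_congr rfl fun u _ => ?_
    rw [map_smul]
    exact congrArg _ (dualGen_apply u σ)
  rw [h]
  apply LinearMap.ext
  intro x
  conv_lhs => rw [eq_sum_gen σ x]
  simp only [map_sum, map_smul, LinearMap.sum_apply, LinearMap.smul_apply, smul_eq_mul]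
  exact Finset.sum_congr rfl fun u _ => mul_comm _ _

theorem dual_isEmpty {V : Type} [Finite V] (hV : ¬ Nonempty (Fin 2 ≃ V)) (f : (gens K).dual.obj V) :
    f = 0 := by
  apply Subtype.ext
  funext n o
  apply LinearMap.ext
  intro x
  have h := isBinary (K := K) V fun h => hV ⟨(Finite.equivFinOfCardEq h).symm⟩
  rw [h.elim x 0, map_zero, map_zero]

variable (Q : Operad K)

open Classical in
/-- The morphism from the free operad on the generators given by two symmetric operations. -/
def ofSymmetric (β : Bool → Q.obj (Fin 2)) (hβ : ∀ u, Q.map (Equiv.swap 0 1) (β u) = β u) :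
    Operad.Hom (freeOperad (gens K)) Q :=
  FreeOperad.lift Q
    (fun V _ => if h : Nonempty (Fin 2 ≃ V) then
      ∑ u, (coord K V u).smulRight (Q.map h.some (β u)) else 0)
    (by
      intro V W _ _ σ x
      by_cases h : Nonempty (Fin 2 ≃ V)
      · have h' : Nonempty (Fin 2 ≃ W) := ⟨h.some.trans σ⟩
        rw [dif_pos h, dif_pos h']
        simp only [LinearMap.sum_apply, LinearMap.smulRight_apply, coord_map, map_sum, map_smul,
          Q.map_map]
        refine Finset.sum_congr rfl fun u _ => ?_
        -- The chosen ordering of `W` may differ from the transported one by the transposition,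
        -- which the symmetry of `β u` absorbs.
        rcases Equiv.fin_two_eq_or (h.some.trans σ) h'.some with h1 | h1
        · rw [h1]
        · rw [h1, ← Q.map_map, hβ]
      · have h' : ¬ Nonempty (Fin 2 ≃ W) := fun ⟨τ⟩ => h ⟨τ.trans σ.symm⟩
        rw [dif_neg h, dif_neg h', LinearMap.zero_apply, LinearMap.zero_apply, map_zero])

theorem ofSymmetric_ι (β : Bool → Q.obj (Fin 2)) (hβ : ∀ u, Q.map (Equiv.swap 0 1) (β u) = β u)
    {V : Type} [Finite V] (u : Bool) (σ : Fin 2 ≃ V) :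
    (ofSymmetric Q β hβ).app V (FreeOperad.ι (gens K) V (gen K u σ)) = Q.map σ (β u) := by
  classical
  change (if h : Nonempty (Fin 2 ≃ V) then
      ∑ u, (coord K V u).smulRight (Q.map h.some (β u)) else 0) (gen K u σ) = _
  rw [dif_pos ⟨σ⟩]
  simp only [LinearMap.sum_apply, LinearMap.smulRight_apply, coord_gen]
  rw [Finset.sum_eq_single u (by intro v _ h; rw [if_neg h, zero_smul]) (by simp), if_pos rfl,
    one_smul]
  rcases Equiv.fin_two_eq_or σ (Nonempty.some (⟨σ⟩ : Nonempty (Fin 2 ≃ V))) with h1 | h1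
  · rw [h1]
  · rw [h1, ← Q.map_map, hβ]

open Classical in
/-- The morphism from the free operad on the dual generators given by two antisymmetric
operations. -/
def ofAntisymmetric (β : Bool → Q.obj (Fin 2)) (hβ : ∀ u, Q.map (Equiv.swap 0 1) (β u) = -β u) :
    Operad.Hom (freeOperad (gens K).dual) Q :=
  FreeOperad.lift Q
    (fun V _ => if h : Nonempty (Fin 2 ≃ V) then
      ∑ u, ((LinearMap.applyₗ (gen K u h.some)) ∘ₗ (Koszul.eval (gens K) h.some)).smulRight
        (Q.map h.some (β u)) else 0)
    (by
      intro V W _ _ σ f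
      by_cases h : Nonempty (Fin 2 ≃ V)
      · have h' : Nonempty (Fin 2 ≃ W) := ⟨h.some.trans σ⟩
        rw [dif_pos h, dif_pos h']
        simp only [LinearMap.sum_apply, LinearMap.smulRight_apply, map_sum, map_smul, Q.map_map,
          LinearMap.comp_apply, LinearMap.applyₗ_apply_apply]
        refine Finset.sum_congr rfl fun u _ => ?_
        have h2 : ∀ τ : Fin 2 ≃ W, Koszul.eval (gens K) τ ((gens K).dual.map σ f) (gen K u τ) =
            f.1 2 (τ.trans σ.symm) (gen K u (τ.trans σ.symm)) := by
          intro τ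
          rw [← map_gen]
          rfl
        rw [h2]
        have h3 : (h.some.trans σ).trans σ.symm = h.some := by ext; simp
        -- If the two orderings differ, the sign from the twist of `f` cancels the sign from the
        -- antisymmetry of `β u`.
        rcases Equiv.fin_two_eq_or (h.some.trans σ) h'.some with h1 | h1
        · rw [h1, h3]
          rfl
        · rw [h1, ← Q.map_map, hβ, Equiv.trans_assoc, h3, f.2 2, Equiv.Perm.sign_swap (by decide),
            gen_congr u _ h.some]
          change ((((-1 : ℤˣ) : ℤ) : K) • Koszul.eval (gens K) h.some f) (gen K u h.some) • _ = _
          simp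
      · have h' : ¬ Nonempty (Fin 2 ≃ W) := fun ⟨τ⟩ => h ⟨τ.trans σ.symm⟩
        rw [dif_neg h, dif_neg h', LinearMap.zero_apply, LinearMap.zero_apply, map_zero])

theorem ofAntisymmetric_ι (β : Bool → Q.obj (Fin 2))
    (hβ : ∀ u, Q.map (Equiv.swap 0 1) (β u) = -β u) {V : Type} [Finite V] (u : Bool)
    (σ : Fin 2 ≃ V) : (ofAntisymmetric Q β hβ).app V
      (FreeOperad.ι (gens K).dual V (dualGen K u σ)) = Q.map σ (β u) := by
  have key : ∀ τ : Fin 2 ≃ V, ∑ v, (Koszul.eval (gens K) τ (dualGen K u τ)) (gen K v τ) •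
      Q.map τ (β v) = Q.map τ (β u) := by
    intro τ
    have h : Koszul.eval (gens K) τ (dualGen K u τ) = coord K V u := dualGen_apply u τ
    simp only [h, coord_gen]
    rw [Finset.sum_eq_single u (by intro v _ h; rw [if_neg h.symm, zero_smul]) (by simp),
      if_pos rfl, one_smul]
  classical
  change (if h : Nonempty (Fin 2 ≃ V) then
      ∑ u, ((LinearMap.applyₗ (gen K u h.some)) ∘ₗ (Koszul.eval (gens K) h.some)).smulRight
        (Q.map h.some (β u)) else 0) (dualGen K u σ) = _
  rw [dif_pos ⟨σ⟩]
  simp only [LinearMap.sum_apply, LinearMap.smulRight_apply, LinearMap.comp_apply,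
    LinearMap.applyₗ_apply_apply]
  generalize Nonempty.some (⟨σ⟩ : Nonempty (Fin 2 ≃ V)) = τ
  rcases Equiv.fin_two_eq_or τ σ with h1 | h1
  · rw [h1, key]
  · rw [h1, dualGen_swap, ← Q.map_map, hβ, map_neg, map_neg, ← key τ, ← Finset.sum_neg_distrib]
    simp only [LinearMap.neg_apply, neg_smul]

end SP

end

noncomputable section

/-! ### The orthogonal of the relations -/

theorem TensorProduct.exists_eq_sum_tmul {K ι κ M N : Type*} [Field K] [Fintype ι] [Fintype κ]
    [AddCommGroup M] [Module K M] [AddCommGroup N] [Module K N] {p : ι → M} {q : κ → N}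
    (hp : ∀ x, ∃ c : ι → K, x = ∑ i, c i • p i) (hq : ∀ y, ∃ c : κ → K, y = ∑ j, c j • q j)
    (t : M ⊗[K] N) : ∃ c : ι → κ → K, t = ∑ i, ∑ j, c i j • (p i ⊗ₜ q j) := by
  induction t using TensorProduct.induction_on with
  | zero => exact ⟨0, by simp⟩
  | tmul x y =>
    obtain ⟨c, rfl⟩ := hp x
    obtain ⟨d, rfl⟩ := hq y
    refine ⟨fun i j => c i * d j, ?_⟩
    rw [TensorProduct.sum_tmul]
    refine Finset.sum_congr rfl fun i _ => ?_
    rw [TensorProduct.tmul_sum]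
    exact Finset.sum_congr rfl fun j _ => TensorProduct.smul_tmul_smul _ _ _ _
  | add s t hs ht =>
    obtain ⟨c, rfl⟩ := hs
    obtain ⟨d, rfl⟩ := ht
    exact ⟨c + d, by simp [add_smul, Finset.sum_add_distrib]⟩

namespace SP

variable {K : Type*} [Field K]

/-- The quadratic trees with coefficients `ξ i u v` at the tree with root `u` and upper node `v`. -/
def quad (ξ : Fin 3 → Bool → Bool → K) : Koszul.Quad (gens K) := fun i =>
  ∑ u, ∑ v, ξ i u v • (gen K u Relabel.pair ⊗ₜ gen K v (Equiv.refl (Fin 2)))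

/-- The dual quadratic trees with coefficients `φ i u v` at the tree with root `u` and upper
node `v`. -/
def dualQuad (φ : Fin 3 → Bool → Bool → K) : Koszul.Quad (gens K).dual := fun i =>
  ∑ u, ∑ v, φ i u v • (dualGen K u Relabel.pair ⊗ₜ dualGen K v (Equiv.refl (Fin 2)))

theorem exists_eq_quad (x : Koszul.Quad (gens K)) : ∃ ξ, x = quad ξ := by
  choose c hc using fun i => TensorProduct.exists_eq_sum_tmul
    (fun y => ⟨_, eq_sum_gen Relabel.pair y⟩) (fun z => ⟨_, eq_sum_gen (Equiv.refl (Fin 2)) z⟩)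
      (x i)
  exact ⟨c, funext hc⟩

theorem exists_eq_dualQuad (x : Koszul.Quad (gens K).dual) : ∃ φ, x = dualQuad φ := by
  choose c hc using fun i => TensorProduct.exists_eq_sum_tmul
    (fun y => ⟨_, eq_sum_dualGen Relabel.pair y⟩)
    (fun z => ⟨_, eq_sum_dualGen (Equiv.refl (Fin 2)) z⟩) (x i)
  exact ⟨c, funext hc⟩

theorem pairing_dualQuad_quad (φ ξ : Fin 3 → Bool → Bool → K) :
    Koszul.pairing (gens K) (dualQuad φ) (quad ξ) = ∑ i, ∑ u, ∑ v, φ i u v * ξ i u v := by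
  have h1 : Koszul.pairing (gens K) (dualQuad φ) (quad ξ) =
      ∑ i, TensorProduct.dualDistrib K _ _ (TensorProduct.map (Koszul.eval (gens K) Relabel.pair)
        (Koszul.eval (gens K) (Equiv.refl (Fin 2))) (dualQuad φ i)) (quad ξ i) := by
    simp only [Koszul.pairing, LinearMap.sum_apply]
    rfl
  rw [h1]
  refine Finset.sum_congr rfl fun i _ => ?_
  have h2 : ∀ (V : Type) [Finite V] (σ : Fin 2 ≃ V) (u : Bool),
      Koszul.eval (gens K) σ (dualGen K u σ) = coord K V u := fun V _ σ u => dualGen_apply u σ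
  simp only [dualQuad, quad, map_sum, map_smul, TensorProduct.map_tmul, LinearMap.sum_apply,
    LinearMap.smul_apply, TensorProduct.dualDistrib_apply, h2, coord_gen, smul_eq_mul]
  simp [mul_comm]

theorem toFree_quad (ξ : Fin 3 → Bool → Bool → K) :
    Koszul.toFree (gens K) (Equiv.refl (Fin 3)) (quad ξ) = ∑ i, ∑ u, ∑ v, ξ i u v •
      tree K i (gen K u Relabel.pair) (gen K v (Equiv.refl (Fin 2))) := by
  rw [Koszul.toFree, LinearMap.sum_apply]
  refine Finset.sum_congr rfl fun i _ => ?_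
  rw [LinearMap.comp_apply, LinearMap.proj_apply, quad, map_sum]
  refine Finset.sum_congr rfl fun u _ => ?_
  rw [map_sum]
  refine Finset.sum_congr rfl fun v _ => ?_
  rw [map_smul, TensorProduct.lift.tmul]
  rfl

theorem toFree_dualQuad (φ : Fin 3 → Bool → Bool → K) :
    Koszul.toFree (gens K).dual (Equiv.refl (Fin 3)) (dualQuad φ) =
      ∑ i, ∑ u, ∑ v, φ i u v • Koszul.tree (gens K).dual (Equiv.refl (Fin 3)) i
        (dualGen K u Relabel.pair) (dualGen K v (Equiv.refl (Fin 2))) := by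
  rw [Koszul.toFree, LinearMap.sum_apply]
  refine Finset.sum_congr rfl fun i _ => ?_
  rw [LinearMap.comp_apply, LinearMap.proj_apply, dualQuad, map_sum]
  refine Finset.sum_congr rfl fun u _ => ?_
  rw [map_sum]
  refine Finset.sum_congr rfl fun v _ => ?_
  rw [map_smul, TensorProduct.lift.tmul]

/-- The coefficients of the quadratic dual trees that are orthogonal to the relations. -/
def IsOrthogonal (φ : Fin 3 → Bool → Bool → K) : Prop :=
  ∀ i, φ (i + 2) false false = φ i false false ∧
    φ i true false = φ (i + 1) false true + φ (i + 2) false true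

/-- Rotations preserve the order of the two upper leaves, so trees are permuted without using the
symmetry of the generators. -/
theorem map_tree (j i : Fin 3) (x : (gens K).obj (Option Unit)) (y : (gens K).obj (Fin 2)) :
    (freeOperad (gens K)).map (Equiv.addRight j) (tree K i x y) = tree K (i + j) x y := by
  have h : (Relabel.slot (Equiv.refl (Fin 3)) i).trans (Equiv.addRight j) =
      Relabel.slot (Equiv.refl (Fin 3)) (i + j) := by
    ext v : 1
    rcases v with v | v
    · rfl
    · revert v i j
      decide
  refine ((freeOperad (gens K)).map_map (Relabel.slot (Equiv.refl (Fin 3)) i) (Equiv.addRight j)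
    ((freeOperad (gens K)).comp (FreeOperad.ι (gens K) _ x) (FreeOperad.ι (gens K) _ y))).trans ?_
  rw [h]
  rfl

theorem relation₁_mem (j : Fin 3) : tree K (j + 2) (gen K false Relabel.pair)
    (gen K false (Equiv.refl _)) - tree K j (gen K false Relabel.pair)
      (gen K false (Equiv.refl _)) ∈
      (relations K).carrier (Fin 3) := by
  refine Submodule.subset_span ⟨Equiv.addRight j, relation₁ K, Or.inl rfl, ?_⟩
  change (freeOperad (gens K)).map _ (_ - _) = _
  rw [map_sub, map_tree, map_tree, zero_add, add_comm]
  rfl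

theorem relation₂_mem (j : Fin 3) : tree K j (gen K true Relabel.pair)
    (gen K false (Equiv.refl _)) - tree K (j + 2) (gen K false Relabel.pair)
      (gen K true (Equiv.refl _)) - tree K (j + 1) (gen K false Relabel.pair)
      (gen K true (Equiv.refl _)) ∈ (relations K).carrier (Fin 3) := by
  refine Submodule.subset_span ⟨Equiv.addRight j, relation₂ K, Or.inr rfl, ?_⟩
  change (freeOperad (gens K)).map _ (_ - _ - _) = _
  rw [map_sub, map_sub, map_tree, map_tree, map_tree, zero_add, add_comm 2, add_comm 1]
  rfl

/-- The equations are the pairings with the rotations of the two relations. -/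
theorem isOrthogonal_of_mem {V : Type} [Finite V] (o : Fin 3 ≃ V) (φ : Fin 3 → Bool → Bool → K)
    (h : dualQuad φ ∈ Koszul.orthogonalAt (gens K) (relations K) o) : IsOrthogonal φ := by
  have h' : ∀ ξ, Koszul.toFree (gens K) (Equiv.refl (Fin 3)) (quad ξ) ∈
      (relations K).carrier (Fin 3) → ∑ i, ∑ u, ∑ v, φ i u v * ξ i u v = 0 := by
    intro ξ hξ
    rw [← pairing_dualQuad_quad]
    refine h _ ?_
    have := (relations K).map_mem o hξ
    rwa [Koszul.map_toFree] at this
  intro j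
  constructor
  -- The coefficients of the first relation rotated by `j`.
  · have h1 := h' (fun i u v => if u = false ∧ v = false then
      (if i = j + 2 then 1 else 0) - (if i = j then 1 else 0) else 0) (by
        rw [toFree_quad]
        have := relation₁_mem (K := K) j
        simpa [sub_smul, Finset.sum_sub_distrib] using this)
    simpa [mul_sub, Finset.sum_sub_distrib, sub_eq_zero] using h1
  · have h1 := h' (fun i u v => (if u = true ∧ v = false ∧ i = j then 1 else 0) -
      (if u = false ∧ v = true ∧ i = j + 2 then 1 else 0) -
      (if u = false ∧ v = true ∧ i = j + 1 then 1 else 0)) (by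
        rw [toFree_quad]
        have := relation₂_mem (K := K) j
        simpa [sub_smul, Finset.sum_sub_distrib, ite_and] using this)
    have h2 : φ j true false - φ (j + 2) false true - φ (j + 1) false true = 0 := by
      simpa [mul_sub, Finset.sum_sub_distrib, ite_and] using h1
    linear_combination h2

/-- The space carrying the operations that compute the coefficients of quadratic trees. -/
abbrev TestSpace (K : Type*) [Field K] : Type _ := (Fin 3 → K) × (Fin 3 → Bool → K) × K

/-- The operations that compute the coefficients of quadratic trees. -/
def testMul (φ : Fin 3 → Bool → Bool → K) (u : Bool) :
    TestSpace K →ₗ[K] TestSpace K →ₗ[K] TestSpace K :=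
  -- The space is graded. The first component is spanned by the leaves; the entry `(i, v)` of the
  -- second records the operation `v` applied to the two leaves other than `i`; the third collects
  -- the coefficient `φ i u v` when `u` joins such an entry with the leaf `i`.
  LinearMap.mk₂ K (fun x y => (0, fun i v => if v = u then
      x.1 (i + 1) * y.1 (i + 2) + x.1 (i + 2) * y.1 (i + 1) else 0,
      ∑ i, ∑ v, φ i u v * (x.1 i * y.2.1 i v + y.1 i * x.2.1 i v)))
    (fun x x' y => by
      refine Prod.ext (by simp) (Prod.ext (funext fun i => funext fun v => ?_) ?_)
      · dsimp
        split_ifs <;> ring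
      · simp only [Prod.snd_add, Prod.fst_add, Pi.add_apply, ← Finset.sum_add_distrib]
        exact Finset.sum_congr rfl fun i _ => Finset.sum_congr rfl fun v _ => by ring)
    (fun c x y => by
      refine Prod.ext (by simp) (Prod.ext (funext fun i => funext fun v => ?_) ?_)
      · dsimp
        split_ifs <;> ring
      · simp only [Prod.smul_snd, Prod.smul_fst, Pi.smul_apply, smul_eq_mul, Finset.mul_sum]
        exact Finset.sum_congr rfl fun i _ => Finset.sum_congr rfl fun v _ => by ring)
    (fun x y y' => by
      refine Prod.ext (by simp) (Prod.ext (funext fun i => funext fun v => ?_) ?_)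
      · dsimp
        split_ifs <;> ring
      · simp only [Prod.snd_add, Prod.fst_add, Pi.add_apply, ← Finset.sum_add_distrib]
        exact Finset.sum_congr rfl fun i _ => Finset.sum_congr rfl fun v _ => by ring)
    (fun c x y => by
      refine Prod.ext (by simp) (Prod.ext (funext fun i => funext fun v => ?_) ?_)
      · dsimp
        split_ifs <;> ring
      · simp only [Prod.smul_snd, Prod.smul_fst, Pi.smul_apply, smul_eq_mul, Finset.mul_sum]
        exact Finset.sum_congr rfl fun i _ => Finset.sum_congr rfl fun v _ => by ring)

theorem testMul_apply (φ : Fin 3 → Bool → Bool → K) (u : Bool) (x y : TestSpace K) :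
    testMul φ u x y = (0, fun i v => if v = u then
      x.1 (i + 1) * y.1 (i + 2) + x.1 (i + 2) * y.1 (i + 1) else 0,
      ∑ i, ∑ v, φ i u v * (x.1 i * y.2.1 i v + y.1 i * x.2.1 i v)) := rfl

theorem testMul_comm (φ : Fin 3 → Bool → Bool → K) (u : Bool) (x y : TestSpace K) :
    testMul φ u x y = testMul φ u y x := by
  rw [testMul_apply, testMul_apply]
  refine Prod.ext rfl (Prod.ext (funext fun i => funext fun v => ?_) ?_)
  · dsimp
    split_ifs <;> ring
  · dsimp only
    exact Finset.sum_congr rfl fun i _ => Finset.sum_congr rfl fun v _ => by ring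

theorem testMul_swap (φ : Fin 3 → Bool → Bool → K) (u : Bool) :
    (endOperad K (TestSpace K)).map (Equiv.swap 0 1) (EndOperad.ofBilin (testMul φ u)) =
      EndOperad.ofBilin (testMul φ u) :=
  EndOperad.ext_eval fun v => by
    rw [EndOperad.eval_map, EndOperad.eval_ofBilin, EndOperad.eval_ofBilin, testMul_comm]
    simp

/-- The functional on the free operad that computes the pairing with `φ`. -/
def testForm (φ : Fin 3 → Bool → Bool → K) : (freeOperad (gens K)).obj (Fin 3) →ₗ[K] K :=
  LinearMap.snd K _ _ ∘ₗ LinearMap.snd K _ _ ∘ₗ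
    EndOperad.eval (fun i => ((Pi.single i 1, 0, 0) : TestSpace K)) ∘ₗ
      (ofSymmetric (endOperad K (TestSpace K)) _ (testMul_swap φ)).app (Fin 3)

/-- On a quadratic tree the test operations return the coefficient of `φ` at its root leaf, whatever
the order of the upper leaves. -/
theorem testForm_map_tree (φ : Fin 3 → Bool → Bool → K) (σ : Equiv.Perm (Fin 3)) (i : Fin 3)
    (u v : Bool) : testForm φ ((freeOperad (gens K)).map σ (tree K i (gen K u Relabel.pair)
      (gen K v (Equiv.refl (Fin 2))))) = φ (σ i) u v := by
  set Ψ := ofSymmetric (endOperad K (TestSpace K)) _ (testMul_swap φ) with hΨ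
  have h1 : Ψ.app (Fin 3) ((freeOperad (gens K)).map σ (tree K i (gen K u Relabel.pair)
        (gen K v (Equiv.refl (Fin 2))))) = (endOperad K (TestSpace K)).map σ
      ((endOperad K (TestSpace K)).map (Relabel.slot (Equiv.refl _) i)
        ((endOperad K (TestSpace K)).comp ((endOperad K (TestSpace K)).map Relabel.pair
          (EndOperad.ofBilin (testMul φ u))) ((endOperad K (TestSpace K)).map (Equiv.refl _)
          (EndOperad.ofBilin (testMul φ v))))) := by
    rw [Ψ.app_map]
    refine congrArg _ ?_
    refine (Ψ.app_map (Relabel.slot (Equiv.refl (Fin 3)) i)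
      ((freeOperad (gens K)).comp (FreeOperad.ι (gens K) _ (gen K u Relabel.pair))
        (FreeOperad.ι (gens K) _ (gen K v (Equiv.refl _))))).trans (congrArg _ ?_)
    rw [Ψ.app_comp, hΨ, ofSymmetric_ι, ofSymmetric_ι]
  have h2 : testForm φ ((freeOperad (gens K)).map σ (tree K i (gen K u Relabel.pair)
      (gen K v (Equiv.refl (Fin 2))))) =
      (testMul φ u (testMul φ v (Pi.single (σ (i + 1)) 1, 0, 0) (Pi.single (σ (i + 2)) 1, 0, 0))
        (Pi.single (σ i) 1, 0, 0)).2.2 := by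
    change (EndOperad.eval (fun i => ((Pi.single i 1, 0, 0) : TestSpace K))
      (Ψ.app (Fin 3) ((freeOperad (gens K)).map σ (tree K i (gen K u Relabel.pair)
        (gen K v (Equiv.refl (Fin 2))))))).2.2 = _
    rw [h1]
    rfl
  -- A permutation of three points keeps or reverses the cyclic order; reversal exchanges the upper
  -- leaves, and the test product is symmetric in them.
  have h3 : ∀ (σ : Equiv.Perm (Fin 3)) (i : Fin 3),
      (σ i + 1 = σ (i + 1) ∧ σ i + 2 = σ (i + 2) ∧ σ (i + 1) ≠ σ (i + 2)) ∨
      (σ i + 1 = σ (i + 2) ∧ σ i + 2 = σ (i + 1) ∧ σ (i + 1) ≠ σ (i + 2)) := by decide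
  rw [h2, testMul_apply]
  dsimp only
  rw [Finset.sum_eq_single (σ i), Finset.sum_eq_single v]
  · rw [testMul_apply]
    rcases h3 σ i with ⟨h4, h5, h6⟩ | ⟨h4, h5, h6⟩
    · simp [h4, h5, h6, h6.symm]
    · simp [h4, h5, h6, h6.symm]
  · intro w _ hw
    rw [testMul_apply]
    simp [hw]
  · simp
  · intro j _ hj
    rw [testMul_apply]
    simp [hj]
  · simp

/-- Orthogonality must be checked for every combination of trees whose image in the free operad lies
in `R`, without knowing that `toFree` is injective. The pairing with `φ` is therefore realised by
the functional `testForm` on the free operad, which vanishes on all relabellings of the relations.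
-/
theorem mem_orthogonalAt (φ : Fin 3 → Bool → Bool → K) (hφ : IsOrthogonal φ) :
    dualQuad φ ∈ Koszul.orthogonalAt (gens K) (relations K) (Equiv.refl (Fin 3)) := by
  intro x hx
  have hker : (relations K).carrier (Fin 3) ≤ LinearMap.ker (testForm φ) := by
    refine Submodule.span_le.2 ?_
    rintro _ ⟨σ, x, hx, rfl⟩
    -- The equations of `IsOrthogonal` are invariant under exchanging `i + 1` and `i + 2`, so they
    -- also cover the permutations that reverse the cyclic order.
    have h3 : ∀ (σ : Equiv.Perm (Fin 3)),
        (σ 1 = σ 0 + 1 ∧ σ 2 = σ 0 + 2) ∨ (σ 1 = σ 0 + 2 ∧ σ 2 = σ 0 + 1) := by decide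
    have h4 : φ (σ 0 + 1) false false = φ (σ 0) false false := by
      have := (hφ (σ 0 + 1)).1
      rw [show σ 0 + 1 + 2 = σ 0 by generalize σ 0 = j; revert j; decide] at this
      exact this.symm
    rcases hx with rfl | rfl
    · change testForm φ ((freeOperad (gens K)).map σ
        (tree K 2 (gen K false Relabel.pair) (gen K false (Equiv.refl _)) -
          tree K 0 (gen K false Relabel.pair) (gen K false (Equiv.refl _)))) = 0
      rw [map_sub, map_sub, testForm_map_tree, testForm_map_tree, sub_eq_zero]
      rcases h3 σ with h | h
      · rw [h.2, (hφ _).1]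
      · rw [h.2, h4]
    · change testForm φ ((freeOperad (gens K)).map σ
        (tree K 0 (gen K true Relabel.pair) (gen K false (Equiv.refl _)) -
          tree K 2 (gen K false Relabel.pair) (gen K true (Equiv.refl _)) -
          tree K 1 (gen K false Relabel.pair) (gen K true (Equiv.refl _)))) = 0
      rw [map_sub, map_sub, map_sub, map_sub, testForm_map_tree, testForm_map_tree,
        testForm_map_tree, (hφ (σ 0)).2]
      rcases h3 σ with h | h
      · rw [h.1, h.2]; ring
      · rw [h.1, h.2]; ring
  obtain ⟨ξ, rfl⟩ := exists_eq_quad x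
  have h := hker hx
  rw [LinearMap.mem_ker, toFree_quad] at h
  rw [pairing_dualQuad_quad]
  refine Eq.trans ?_ h
  simp only [map_sum, map_smul]
  refine Finset.sum_congr rfl fun i _ => Finset.sum_congr rfl fun u _ =>
    Finset.sum_congr rfl fun v _ => ?_
  have h5 := testForm_map_tree φ (Equiv.refl _) i u v
  rw [(freeOperad (gens K)).map_refl] at h5
  rw [h5, smul_eq_mul, mul_comm]
  rfl

end SP

end

noncomputable section

/-! ### The presentation of the Koszul dual of `SP` -/

/-- A Lie bracket `ℓ` together with an antisymmetric operation `m` such that `ℓ` is a derivation of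
`m` and all the products `m (m a b) c` vanish. -/
structure IsDualPair {K A : Type*} [Field K] [AddCommGroup A] [Module K A]
    (ℓ m : A →ₗ[K] A →ₗ[K] A) : Prop where
  ℓ_swap : ∀ a b, ℓ a b = -ℓ b a
  m_swap : ∀ a b, m a b = -m b a
  jacobi : ∀ a b c, ℓ (ℓ a b) c + ℓ (ℓ b c) a + ℓ (ℓ c a) b = 0
  m_m : ∀ a b c, m (m a b) c = 0
  ℓ_m : ∀ a b c, ℓ (m a b) c + m (ℓ b c) a + m (ℓ c a) b = 0

namespace SP

variable {K : Type*} [Field K]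

variable (K) in
/-- The projection to the Koszul dual. -/
def dualProj : Operad.Hom (freeOperad (gens K).dual) (dual K) :=
  (freeOperad (gens K).dual).quotientHom (Koszul.orthogonal (gens K) (relations K))

variable (K) in
/-- The two binary operations generating the Koszul dual. -/
def dualOp (u : Bool) : (dual K).obj (Fin 2) :=
  (dualProj K).app (Fin 2) (FreeOperad.ι (gens K).dual (Fin 2) (dualGen K u (Equiv.refl _)))

theorem map_dualOp {V : Type} [Finite V] (u : Bool) (σ : Fin 2 ≃ V) :
    (dual K).map σ (dualOp K u) =
      (dualProj K).app V (FreeOperad.ι (gens K).dual V (dualGen K u σ)) := by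
  rw [dualOp, ← (dualProj K).app_map, FreeOperad.map_ι, map_dualGen]
  rfl

theorem map_swap_dualOp (u : Bool) :
    (dual K).map (Equiv.swap 0 1) (dualOp K u) = -dualOp K u := by
  have h := dualGen_swap (K := K) u (Equiv.refl (Fin 2))
  rw [map_dualOp, dualOp, ← map_neg, ← map_neg, ← h]
  rfl

theorem dual_binMem {V : Type} [Finite V] (x : (dual K).obj V) :
    Operad.BinMem (dual K) (Set.range (dualOp K)) V x := by
  refine Operad.binMem_of_surjective (dualProj K) _ ?_
    (Operad.quotientHom_surjective (freeOperad (gens K).dual) _ V) x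
  intro V _ g
  by_cases hV : Nonempty (Fin 2 ≃ V)
  · obtain ⟨σ⟩ := hV
    rw [eq_sum_dualGen σ g, Fintype.sum_bool]
    simp only [map_add, map_smul]
    rw [← map_dualOp, ← map_dualOp]
    exact .add (.smul _ (.map σ (.of_mem _ ⟨_, rfl⟩))) (.smul _ (.map σ (.of_mem _ ⟨_, rfl⟩)))
  · rw [dual_isEmpty hV g, map_zero, map_zero]
    exact .zero

/-- Relations with a single decorated tree for each root leaf suffice to obtain all the identities
of `IsDualPair`. -/
theorem dual_relation (a b : Fin 3 → Bool) (s : Fin 3 → K)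
    (h : IsOrthogonal (K := K) fun i u v => if u = a i ∧ v = b i then s i else 0) :
    ∑ i, (dual K).map (Relabel.slot (Equiv.refl _) i) ((dual K).comp
      ((dual K).map Relabel.pair (s i • dualOp K (a i))) (dualOp K (b i))) = 0 := by
  have h1 : (dualProj K).app (Fin 3) (Koszul.toFree (gens K).dual (Equiv.refl (Fin 3))
      (dualQuad fun i u v => if u = a i ∧ v = b i then s i else 0)) = 0 := by
    refine (Submodule.Quotient.mk_eq_zero _).2 (.of ?_)
    exact Submodule.mem_iSup_of_mem (Equiv.refl (Fin 3)) ⟨_, mem_orthogonalAt _ h, rfl⟩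
  rw [toFree_dualQuad, map_sum] at h1
  refine Eq.trans (Finset.sum_congr rfl fun i _ => ?_) h1
  rw [map_sum, Finset.sum_eq_single (a i), map_sum, Finset.sum_eq_single (b i)]
  · rw [if_pos ⟨rfl, rfl⟩, map_smul, map_smul, map_smul, LinearMap.smul_apply, map_smul,
      map_dualOp, dualOp, ← (dualProj K).app_comp, ← (dualProj K).app_map]
    rfl
  · intro v _ hv
    rw [if_neg fun h => hv h.2, zero_smul, map_zero]
  · exact fun h => absurd (Finset.mem_univ _) h
  · intro u _ hu
    rw [map_sum, Finset.sum_eq_zero]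
    intro v _
    rw [if_neg fun h => hu h.1, zero_smul, map_zero]
  · exact fun h => absurd (Finset.mem_univ _) h

/-- The solutions of `IsOrthogonal` are generated by rotations of three: equal coefficients on the
`ℓ`-`ℓ` trees give the Jacobi identity; the `m`-`m` trees are unconstrained, so each one vanishes;
and one tree with root `ℓ` and upper node `m` forces two trees with root `m` and upper node `ℓ`,
which is the derivation rule. -/
theorem isDualPair {V : Type} [DecidableEq V] :
    IsDualPair ((dual K).gmul (V := V) (dualOp K false)) ((dual K).gmul (dualOp K true)) where
  ℓ_swap a b := by
    rw [← Operad.gmul_swap, map_swap_dualOp, Operad.gmul_neg]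
  m_swap a b := by
    rw [← Operad.gmul_swap, map_swap_dualOp, Operad.gmul_neg]
  jacobi a b c := by
    have h := (dual K).gmul_relation _ _ (dual_relation (fun _ => false) (fun _ => false)
      (fun _ => 1) fun i => by simp) a b c
    simpa using h
  m_m a b c := by
    have h := (dual K).gmul_relation _ _ (dual_relation (fun _ => true) (fun _ => true)
      ![0, 0, 1] fun i => by simp) a b c
    simpa [Operad.gmul_zero] using h
  ℓ_m a b c := by
    have h := (dual K).gmul_relation _ _ (dual_relation ![true, true, false] ![false, false, true]
      (fun _ => 1) fun i => by fin_cases i <;> simp) a b c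
    simpa using h

/-! ### Models of the Koszul dual -/

section

variable {A : Type*} [AddCommGroup A] [Module K A] {ℓ m : A →ₗ[K] A →ₗ[K] A}

/-- The operations on a model. -/
def modelOp (ℓ m : A →ₗ[K] A →ₗ[K] A) (u : Bool) : (endOperad K A).obj (Fin 2) :=
  EndOperad.ofBilin (if u then m else ℓ)

theorem modelOp_swap (h : IsDualPair ℓ m) (u : Bool) :
    (endOperad K A).map (Equiv.swap 0 1) (modelOp ℓ m u) = -modelOp ℓ m u :=
  EndOperad.ext_eval fun v => by
    rw [EndOperad.eval_map, modelOp, map_neg, EndOperad.eval_ofBilin, EndOperad.eval_ofBilin]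
    cases u
    · exact h.ℓ_swap _ _
    · exact h.m_swap _ _

theorem ofAntisymmetric_tree (h : IsDualPair ℓ m) (i : Fin 3) (u v : Bool) (w : Fin 3 → A) :
    EndOperad.eval w ((ofAntisymmetric (endOperad K A) _ (modelOp_swap h)).app (Fin 3)
      (Koszul.tree (gens K).dual (Equiv.refl (Fin 3)) i (dualGen K u Relabel.pair)
        (dualGen K v (Equiv.refl (Fin 2))))) =
      (if u then m else ℓ) ((if v then m else ℓ) (w (i + 1)) (w (i + 2))) (w i) := by
  set Ψ := ofAntisymmetric (endOperad K A) _ (modelOp_swap h) with hΨ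
  have h1 : Ψ.app (Fin 3) (Koszul.tree (gens K).dual (Equiv.refl (Fin 3)) i
      (dualGen K u Relabel.pair) (dualGen K v (Equiv.refl (Fin 2)))) =
      (endOperad K A).map (Relabel.slot (Equiv.refl _) i)
        ((endOperad K A).comp ((endOperad K A).map Relabel.pair (modelOp ℓ m u))
          ((endOperad K A).map (Equiv.refl _) (modelOp ℓ m v))) := by
    refine (Ψ.app_map (Relabel.slot (Equiv.refl (Fin 3)) i) ((freeOperad (gens K).dual).comp
      (FreeOperad.ι (gens K).dual _ (dualGen K u Relabel.pair))
      (FreeOperad.ι (gens K).dual _ (dualGen K v (Equiv.refl _))))).trans (congrArg _ ?_)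
    rw [Ψ.app_comp, hΨ, ofAntisymmetric_ι, ofAntisymmetric_ι]
  rw [h1]
  rfl

/-- The identities of `IsDualPair` are all that `R^⊥` imposes, so every pair satisfying them is a
model of the Koszul dual. -/
theorem ofAntisymmetric_orthogonal (h : IsDualPair ℓ m) {V : Type} [Finite V]
    {x : (freeOperad (gens K).dual).obj V}
    (hx : x ∈ (Koszul.orthogonal (gens K) (relations K)).carrier V) :
    (ofAntisymmetric (endOperad K A) _ (modelOp_swap h)).app V x = 0 := by
  have hle : (Koszul.orthogonal (gens K) (relations K)).carrier V ≤
      LinearMap.ker ((ofAntisymmetric (endOperad K A) _ (modelOp_swap h)).app V) := by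
    refine iSup_le fun o => ?_
    rintro _ ⟨f, hf, rfl⟩
    obtain ⟨φ, rfl⟩ := exists_eq_dualQuad f
    have hφ := isOrthogonal_of_mem o φ hf
    have h0 := Koszul.map_toFree (gens K).dual (Equiv.refl (Fin 3)) o (dualQuad φ)
    rw [Equiv.refl_trans] at h0
    rw [LinearMap.mem_ker, ← h0, Operad.Hom.app_map]
    refine Eq.trans (congrArg _ (EndOperad.ext_eval fun w => ?_)) (map_zero _)
    rw [toFree_dualQuad, map_zero]
    have key : EndOperad.eval w ((ofAntisymmetric (endOperad K A) _ (modelOp_swap h)).app (Fin 3)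
        (∑ i, ∑ u, ∑ v, φ i u v • Koszul.tree (gens K).dual (Equiv.refl (Fin 3)) i
          (dualGen K u Relabel.pair) (dualGen K v (Equiv.refl (Fin 2))))) =
        ∑ i, ∑ u, ∑ v, φ i u v •
          (if u then m else ℓ) ((if v then m else ℓ) (w (i + 1)) (w (i + 2))) (w i) := by
      rw [map_sum, map_sum]
      refine Finset.sum_congr rfl fun i _ => ?_
      rw [map_sum, map_sum]
      refine Finset.sum_congr rfl fun u _ => ?_
      rw [map_sum, map_sum]
      refine Finset.sum_congr rfl fun v _ => ?_
      rw [map_smul, map_smul]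
      exact congrArg _ (ofAntisymmetric_tree h i u v w)
    rw [key]
    have h1 := h.jacobi (w 0) (w 1) (w 2)
    have h2 := h.ℓ_m (w 0) (w 1) (w 2)
    have h3 := h.ℓ_m (w 1) (w 2) (w 0)
    have h4 := h.ℓ_m (w 2) (w 0) (w 1)
    have e0 : φ 2 false false = φ 0 false false := (hφ 0).1
    have e1 : φ 0 false false = φ 1 false false := (hφ 1).1
    have f0 : φ 0 true false = φ 1 false true + φ 2 false true := (hφ 0).2
    have f1 : φ 1 true false = φ 2 false true + φ 0 false true := (hφ 1).2
    have f2 : φ 2 true false = φ 0 false true + φ 1 false true := (hφ 2).2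
    simp only [Fin.sum_univ_three, Fintype.sum_bool, if_true, Bool.false_eq_true, if_false, h.m_m,
      smul_zero, zero_add, f0, f1, f2, e0, ← e1,
      show (1 : Fin 3) + 1 = 2 from rfl, show (1 : Fin 3) + 2 = 0 from rfl,
      show (2 : Fin 3) + 1 = 0 from rfl, show (2 : Fin 3) + 2 = 1 from rfl]
    -- After eliminating the dependent coefficients, what remains is a multiple of the Jacobi
    -- identity and one multiple of each rotation of the derivation rule.
    linear_combination (norm := module) (φ 0 false false) • h1 + (φ 2 false true) • h2 +
      (φ 0 false true) • h3 + (φ 1 false true) • h4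
  exact hle hx

/-- The morphism from the Koszul dual to the operad of operations on a model. -/
def toModel (h : IsDualPair ℓ m) : Operad.Hom (dual K) (endOperad K A) :=
  (ofAntisymmetric (endOperad K A) _ (modelOp_swap h)).quotientLift _
    fun _ _ _ hx => ofAntisymmetric_orthogonal h hx

theorem toModel_dualOp (h : IsDualPair ℓ m) (u : Bool) :
    (toModel h).app (Fin 2) (dualOp K u) = modelOp ℓ m u := by
  refine (ofAntisymmetric_ι (endOperad K A) _ (modelOp_swap h) u (Equiv.refl (Fin 2))).trans ?_
  exact (endOperad K A).map_refl _

theorem eval_toModel_bin (h : IsDualPair ℓ m) {B C : Type} [Finite B] [Finite C] (u : Bool)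
    (x : (dual K).obj B) (y : (dual K).obj C) (w : B ⊕ C → A) :
    EndOperad.eval w ((toModel h).app (B ⊕ C) ((dual K).bin (dualOp K u) x y)) =
      (if u then m else ℓ) (EndOperad.eval (fun b => w (.inl b)) ((toModel h).app B x))
        (EndOperad.eval (fun c => w (.inr c)) ((toModel h).app C y)) := by
  rw [Operad.Hom.app_bin, toModel_dualOp, EndOperad.eval_bin]
  rfl

end

end SP

end

noncomputable section

/-! ### Lie monomials -/

section

variable {K A V : Type*} [Field K] [AddCommGroup A] [Module K A]

/-- The iterated brackets of the elements `e v`; the multiset records the arguments. -/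
inductive LieMonomial (ℓ : A →ₗ[K] A →ₗ[K] A) (e : V → A) : Multiset V → A → Prop
  | leaf (v : V) : LieMonomial ℓ e {v} (e v)
  | bracket {s t : Multiset V} {a b : A} : LieMonomial ℓ e s a → LieMonomial ℓ e t b →
      LieMonomial ℓ e (s + t) (ℓ a b)

/-- The bracket `[u₁, [u₂, …, [uₙ, v]…]]`. -/
def rightNormed (ℓ : A →ₗ[K] A →ₗ[K] A) (e : V → A) (w : List V) (v : V) : A :=
  w.foldr (fun u a => ℓ (e u) a) (e v)

theorem rightNormed_cons (ℓ : A →ₗ[K] A →ₗ[K] A) (e : V → A) (u : V) (w : List V) (v : V) :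
    rightNormed ℓ e (u :: w) v = ℓ (e u) (rightNormed ℓ e w v) := rfl

theorem lieMonomial_rightNormed (ℓ : A →ₗ[K] A →ₗ[K] A) (e : V → A) (w : List V) (v : V) :
    LieMonomial ℓ e (v ::ₘ (w : Multiset V)) (rightNormed ℓ e w v) := by
  induction w with
  | nil => exact .leaf v
  | cons u w ih =>
    have h := LieMonomial.bracket (.leaf u) ih
    rwa [Multiset.singleton_add, Multiset.cons_swap, Multiset.cons_coe] at h

theorem LieMonomial.ne_zero {ℓ : A →ₗ[K] A →ₗ[K] A} {e : V → A} {s : Multiset V} {a : A}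
    (h : LieMonomial ℓ e s a) : s ≠ 0 := by
  induction h with
  | leaf v => exact Multiset.singleton_ne_zero v
  | bracket _ _ h1 h2 => exact fun h => h1 (add_eq_zero.1 h).1

/-- The span of the right-normed brackets that end in `v` and have the arguments `s`. -/
def rightNormedSpan (ℓ : A →ₗ[K] A →ₗ[K] A) (e : V → A) (v : V) (s : Multiset V) :
    Submodule K A :=
  Submodule.span K {a | ∃ w : List V, v ::ₘ (w : Multiset V) = s ∧ a = rightNormed ℓ e w v}

/-- The span of the Lie monomials. -/
def lieSpan (ℓ : A →ₗ[K] A →ₗ[K] A) (e : V → A) : Submodule K A :=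
  Submodule.span K {a | ∃ s, LieMonomial ℓ e s a}

theorem bracket_mem_lieSpan {ℓ : A →ₗ[K] A →ₗ[K] A} {e : V → A} {a b : A} (ha : a ∈ lieSpan ℓ e)
    (hb : b ∈ lieSpan ℓ e) :
    ℓ a b ∈ lieSpan ℓ e := by
  have h1 : Submodule.map₂ ℓ (lieSpan ℓ e) (lieSpan ℓ e) ≤ lieSpan ℓ e := by
    rw [lieSpan, Submodule.map₂_span_span, Submodule.span_le]
    rintro _ ⟨x, ⟨s, hx⟩, y, ⟨t, hy⟩, rfl⟩
    exact Submodule.subset_span ⟨_, .bracket hx hy⟩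
  exact h1 (Submodule.apply_mem_map₂ _ ha hb)

namespace IsDualPair

variable {ℓ m : A →ₗ[K] A →ₗ[K] A} (h : IsDualPair ℓ m) (e : V → A)
include h

theorem ℓ_ℓ (a b c : A) : ℓ (ℓ a b) c = ℓ a (ℓ b c) - ℓ b (ℓ a c) := by
  have h1 := h.jacobi a b c
  rw [h.ℓ_swap (ℓ b c), h.ℓ_swap (ℓ c a), h.ℓ_swap c a, map_neg, neg_neg] at h1
  rw [← sub_eq_zero, ← h1]
  abel

theorem ℓ_m_right (a b c : A) : ℓ a (m b c) = m (ℓ a b) c + m b (ℓ a c) := by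
  have h1 := h.ℓ_m b c a
  rw [h.ℓ_swap (m b c), h.m_swap (ℓ c a), h.ℓ_swap c a, map_neg, neg_neg] at h1
  rw [← sub_eq_zero, ← neg_eq_zero, ← h1]
  abel

/-- By the Jacobi identity, bracketing with a Lie monomial is a combination of iterated brackets
with its leaves, and these only lengthen a right-normed bracket on the left. -/
theorem ℓ_mem_rightNormedSpan {s : Multiset V} {a : A} (ha : LieMonomial ℓ e s a) (v : V)
    (t : Multiset V) : ∀ b ∈ rightNormedSpan ℓ e v t, ℓ a b ∈ rightNormedSpan ℓ e v (s + t) := by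
  induction ha generalizing t with
  | leaf u =>
    intro b hb
    suffices rightNormedSpan ℓ e v t ≤ (rightNormedSpan ℓ e v ({u} + t)).comap (ℓ (e u)) from
      this hb
    refine Submodule.span_le.2 ?_
    rintro _ ⟨w, rfl, rfl⟩
    refine Submodule.subset_span ⟨u :: w, ?_, rfl⟩
    rw [Multiset.singleton_add, Multiset.cons_swap, Multiset.cons_coe u]
  | @bracket s₁ s₂ a₁ a₂ _ _ h1 h2 =>
    intro b hb
    rw [h.ℓ_ℓ]
    refine Submodule.sub_mem _ ?_ ?_
    · have := h1 _ _ (h2 _ _ hb)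
      rwa [← add_assoc] at this
    · have := h2 _ _ (h1 _ _ hb)
      rwa [← add_assoc, add_comm s₂] at this

/-- Antisymmetry moves the factor containing `v` to the right. By induction it is right-normed
ending in `v`, and the other factor acts on it. -/
theorem mem_rightNormedSpan {s : Multiset V} {a : A} (ha : LieMonomial ℓ e s a) {v : V}
    (hv : v ∈ s) : a ∈ rightNormedSpan ℓ e v s := by
  induction ha with
  | leaf u =>
    rw [Multiset.mem_singleton.1 hv]
    exact Submodule.subset_span ⟨[], rfl, rfl⟩
  | bracket ha hb iha ihb =>
    rcases Multiset.mem_add.1 hv with hv | hv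
    · rw [h.ℓ_swap, add_comm]
      exact Submodule.neg_mem _ (h.ℓ_mem_rightNormedSpan e hb v _ _ (iha hv))
    · exact h.ℓ_mem_rightNormedSpan e ha v _ _ (ihb hv)

theorem m_eq_zero {x : A} (hx : x ∈ Submodule.map₂ m (lieSpan ℓ e) (lieSpan ℓ e)) : m x = 0 := by
  have h1 : Submodule.map₂ m (lieSpan ℓ e) (lieSpan ℓ e) ≤ LinearMap.ker m :=
    Submodule.map₂_le.2 fun a _ b _ => LinearMap.ext fun c => h.m_m a b c
  exact h1 hx

theorem ℓ_mem_map₂ {a x : A} (ha : a ∈ lieSpan ℓ e)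
    (hx : x ∈ Submodule.map₂ m (lieSpan ℓ e) (lieSpan ℓ e)) :
    ℓ a x ∈ Submodule.map₂ m (lieSpan ℓ e) (lieSpan ℓ e) := by
  have h1 : Submodule.map₂ m (lieSpan ℓ e) (lieSpan ℓ e) ≤
      (Submodule.map₂ m (lieSpan ℓ e) (lieSpan ℓ e)).comap (ℓ a) :=
    Submodule.map₂_le.2 fun b hb c hc => by
      rw [Submodule.mem_comap, h.ℓ_m_right]
      exact Submodule.add_mem _ (Submodule.apply_mem_map₂ _ (bracket_mem_lieSpan ha hb) hc)
        (Submodule.apply_mem_map₂ _ hb (bracket_mem_lieSpan ha hc))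
  exact h1 hx

/-- By the derivation rule the bracket of `x` with `m(b, c)` is a sum of values of `m` at `ℓ x b`
and at `ℓ x c`; both lie in the image of `m`, which `m` annihilates. -/
theorem ℓ_eq_zero {x y : A} (hx : x ∈ Submodule.map₂ m (lieSpan ℓ e) (lieSpan ℓ e))
    (hy : y ∈ Submodule.map₂ m (lieSpan ℓ e) (lieSpan ℓ e)) : ℓ x y = 0 := by
  have h1 : Submodule.map₂ m (lieSpan ℓ e) (lieSpan ℓ e) ≤ LinearMap.ker (ℓ x) :=
    Submodule.map₂_le.2 fun b hb c hc => by
      rw [LinearMap.mem_ker, h.ℓ_m_right, h.m_swap b, h.ℓ_swap x, h.ℓ_swap x, map_neg, map_neg,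
        h.m_eq_zero e (h.ℓ_mem_map₂ e hb hx), h.m_eq_zero e (h.ℓ_mem_map₂ e hc hx)]
      simp
  exact h1 hy

/-- The elements `a + ∑ m(b, c)` where `a`, `b`, `c` are combinations of Lie monomials are closed
under `ℓ`. -/
theorem ℓ_mem {a b : A} (ha : a ∈ lieSpan ℓ e ⊔ Submodule.map₂ m (lieSpan ℓ e) (lieSpan ℓ e))
    (hb : b ∈ lieSpan ℓ e ⊔ Submodule.map₂ m (lieSpan ℓ e) (lieSpan ℓ e)) :
    ℓ a b ∈ lieSpan ℓ e ⊔ Submodule.map₂ m (lieSpan ℓ e) (lieSpan ℓ e) := by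
  obtain ⟨a, ha₁, x, hx, rfl⟩ := Submodule.mem_sup.1 ha
  obtain ⟨b, hb₁, y, hy, rfl⟩ := Submodule.mem_sup.1 hb
  rw [map_add, map_add, LinearMap.add_apply, LinearMap.add_apply, h.ℓ_eq_zero e hx hy, add_zero,
      h.ℓ_swap x b]
  refine Submodule.add_mem _ ?_ ?_
  · exact Submodule.mem_sup.2 ⟨_, bracket_mem_lieSpan ha₁ hb₁, _, Submodule.neg_mem _
      (h.ℓ_mem_map₂ e hb₁ hx), rfl⟩
  · exact Submodule.mem_sup_right (h.ℓ_mem_map₂ e ha₁ hy)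

/-- The elements `a + ∑ m(b, c)` where `a`, `b`, `c` are combinations of Lie monomials are closed
under `m`. -/
theorem m_mem {a b : A} (ha : a ∈ lieSpan ℓ e ⊔ Submodule.map₂ m (lieSpan ℓ e) (lieSpan ℓ e))
    (hb : b ∈ lieSpan ℓ e ⊔ Submodule.map₂ m (lieSpan ℓ e) (lieSpan ℓ e)) :
    m a b ∈ lieSpan ℓ e ⊔ Submodule.map₂ m (lieSpan ℓ e) (lieSpan ℓ e) := by
  obtain ⟨a, ha₁, x, hx, rfl⟩ := Submodule.mem_sup.1 ha
  obtain ⟨b, hb₁, y, hy, rfl⟩ := Submodule.mem_sup.1 hb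
  rw [map_add m, h.m_eq_zero e hx, add_zero, map_add, h.m_swap a y, h.m_eq_zero e hy,
    LinearMap.zero_apply, neg_zero, add_zero]
  exact Submodule.mem_sup_right (Submodule.apply_mem_map₂ _ ha₁ hb₁)

end IsDualPair

/-! ### Normal forms -/

/-- The words in which every element of `B` occurs exactly once. -/
abbrev Words (B : Finset V) : Type _ := {w : List V // (w : Multiset V) = B.val}

/-- The indices of the normal forms `[w, v]` and `m([w, v], [w', c])`, where `c` is the chosen
element of the set `C` of the arguments of the second factor. -/
abbrev NormalIndex [Fintype V] [DecidableEq V] (v : V) (c : Finset V → V) : Type _ :=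
  Words (Finset.univ.erase v) ⊕ Σ C : {C : Finset V // v ∉ C ∧ C.Nonempty},
    Words (Finset.univ.erase v \ C.1) × Words (C.1.erase (c C.1))

/-- The normal forms. -/
def normalForm [Fintype V] [DecidableEq V] (ℓ m : A →ₗ[K] A →ₗ[K] A) (e : V → A) (v : V)
    (c : Finset V → V) : NormalIndex v c → A
  | .inl w => rightNormed ℓ e w.1 v
  | .inr i => m (rightNormed ℓ e i.2.1.1 v) (rightNormed ℓ e i.2.2.1 (c i.1.1))

end

/-! ### Homogeneous elements of the twisted algebra -/

namespace Operad

variable {K : Type*} [Field K] (O : Operad K) {V : Type} [DecidableEq V]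

/-- The elements of the twisted algebra with the arguments `s`. -/
def homogeneous (s : Multiset V) : Submodule K (O.Twisted V) :=
  Submodule.span K {a | ∃ (B : Finset V) (x : O.obj B), B.val = s ∧ a = O.hom B x}

theorem leaf_mem_homogeneous (v : V) : O.leaf v ∈ O.homogeneous {v} :=
  Submodule.subset_span ⟨{v}, _, rfl, rfl⟩

theorem gmul_mem_homogeneous (μ : O.obj (Fin 2)) {s t : Multiset V} {a b : O.Twisted V}
    (ha : a ∈ O.homogeneous s) (hb : b ∈ O.homogeneous t) :
    O.gmul μ a b ∈ O.homogeneous (s + t) := by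
  have h : Submodule.map₂ (O.gmul μ) (O.homogeneous s) (O.homogeneous t) ≤
      O.homogeneous (V := V) (s + t) := by
    rw [homogeneous, homogeneous, Submodule.map₂_span_span, Submodule.span_le]
    rintro _ ⟨_, ⟨B, x, rfl, rfl⟩, _, ⟨C, y, rfl, rfl⟩, rfl⟩
    dsimp only
    by_cases hd : Disjoint B C
    · rw [gmul_hom_hom_of_disjoint O μ hd]
      refine Submodule.subset_span ⟨_, _, ?_, rfl⟩
      rw [← Finset.disjUnion_eq_union B C hd]
      rfl
    · rw [gmul_hom_hom_of_not_disjoint O μ hd]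
      exact Submodule.zero_mem _
  exact h (Submodule.apply_mem_map₂ _ ha hb)

theorem component_eq_zero {s : Multiset V} {a : O.Twisted V} (ha : a ∈ O.homogeneous s)
    {B : Finset V} (hB : s ≠ B.val) : O.component B a = 0 := by
  have h : O.homogeneous s ≤ LinearMap.ker (O.component B) := by
    refine Submodule.span_le.2 ?_
    rintro _ ⟨C, x, rfl, rfl⟩
    exact component_hom_of_ne O (fun h => hB (by rw [h])) x
  exact h ha

theorem hom_component {B : Finset V} {a : O.Twisted V} (ha : a ∈ O.homogeneous B.val) :
    O.hom B (O.component B a) = a := by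
  induction ha using Submodule.span_induction with
  | mem x hx =>
    obtain ⟨C, x, hC, rfl⟩ := hx
    obtain rfl := Finset.val_injective hC
    rw [component_hom_self]
  | zero => rw [map_zero, map_zero]
  | add x y _ _ hx hy => rw [map_add, map_add, hx, hy]
  | smul c x _ hx => rw [map_smul, map_smul, hx]

theorem _root_.LieMonomial.mem_homogeneous {μ : O.obj (Fin 2)} {s : Multiset V} {a : O.Twisted V}
    (h : LieMonomial (O.gmul μ) O.leaf s a) : a ∈ O.homogeneous s := by
  induction h with
  | leaf v => exact O.leaf_mem_homogeneous v
  | bracket _ _ h1 h2 => exact O.gmul_mem_homogeneous μ h1 h2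

end Operad

namespace SP

variable {K : Type*} [Field K]

section

variable {V : Type} [DecidableEq V]

/-- Closure under `ℓ` and `m` shows that no further nesting occurs: the dual is Lie plus `m(Lie,
Lie)`. -/
theorem lieSpan_sup_eq_top : lieSpan ((dual K).gmul (dualOp K false)) (dual K).leaf ⊔
    Submodule.map₂ ((dual K).gmul (dualOp K true))
      (lieSpan ((dual K).gmul (dualOp K false)) (dual K).leaf)
      (lieSpan ((dual K).gmul (dualOp K false)) (dual K).leaf) =
        (⊤ : Submodule K ((dual K).Twisted V)) := by
  refine Operad.Twisted.eq_top_of_binMem _ _ (S := Set.range (dualOp K)) ?_ ?_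
    fun U _ x => dual_binMem x
  · exact fun v => Submodule.mem_sup_left (Submodule.subset_span ⟨_, .leaf v⟩)
  · rintro _ ⟨u, rfl⟩ a ha b hb
    cases u
    · exact isDualPair.ℓ_mem _ ha hb
    · exact isDualPair.m_mem _ ha hb

variable (K) in
/-- The normal forms in the twisted algebra of the Koszul dual. -/
def dualNormalForm [Fintype V] (v : V) (c : Finset V → V) : NormalIndex v c → (dual K).Twisted V :=
  normalForm ((dual K).gmul (dualOp K false)) ((dual K).gmul (dualOp K true)) (dual K).leaf v c

/-- Both factors are made right-normed: the first ends in `v`, and the second, on the label set `C`,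
ends in the chosen element `c C`. -/
theorem component_m_mem [Fintype V] (v : V) (c : Finset V → V) (hc : ∀ C, C.Nonempty → c C ∈ C)
    {s t : Multiset V} {a b : (dual K).Twisted V}
    (ha : LieMonomial ((dual K).gmul (dualOp K false)) (dual K).leaf s a)
    (hb : LieMonomial ((dual K).gmul (dualOp K false)) (dual K).leaf t b)
    (hst : s + t = Finset.univ.val) (hv : v ∈ s) :
    (dual K).component Finset.univ ((dual K).gmul (dualOp K true) a b) ∈
      Submodule.span K (Set.range fun i => (dual K).component Finset.univ
        (dualNormalForm K v c i)) := by
  have hnd : (s + t).Nodup := hst ▸ Finset.univ.nodup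
  obtain ⟨C, rfl⟩ : ∃ C : Finset V, C.val = t := ⟨⟨t, (Multiset.nodup_add.1 hnd).2.1⟩, rfl⟩
  have hC : C.Nonempty := by
    rw [Finset.nonempty_iff_ne_empty]
    rintro rfl
    exact hb.ne_zero rfl
  have hvC : v ∉ C := fun h => Multiset.disjoint_left.1 (Multiset.nodup_add.1 hnd).2.2 hv h
  have h1 := isDualPair.mem_rightNormedSpan _ ha hv
  have h2 := isDualPair.mem_rightNormedSpan _ hb (hc C hC)
  suffices h : Submodule.map₂ ((dual K).gmul (dualOp K true))
      (rightNormedSpan ((dual K).gmul (dualOp K false)) (dual K).leaf v s)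
      (rightNormedSpan ((dual K).gmul (dualOp K false)) (dual K).leaf (c C) C.val) ≤
      (Submodule.span K (Set.range fun i => (dual K).component Finset.univ
        (dualNormalForm K v c i))).comap ((dual K).component Finset.univ) from
    h (Submodule.apply_mem_map₂ _ h1 h2)
  rw [rightNormedSpan, rightNormedSpan, Submodule.map₂_span_span, Submodule.span_le]
  rintro _ ⟨_, ⟨w, hw, rfl⟩, _, ⟨w', hw', rfl⟩, rfl⟩
  refine Submodule.subset_span ⟨.inr ⟨⟨C, hvC, hC⟩, ⟨w, ?_⟩, ⟨w', ?_⟩⟩, rfl⟩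
  · rw [Finset.sdiff_val, Finset.erase_val, ← hst, ← hw, Multiset.cons_add,
      Multiset.erase_cons_head, Multiset.add_sub_cancel_right]
  · rw [Finset.erase_val, ← hw', Multiset.erase_cons_head]

/-- The normal forms span the Koszul dual. -/
theorem span_dualNormalForm [Fintype V] (v : V) (c : Finset V → V)
    (hc : ∀ C, C.Nonempty → c C ∈ C) :
    Submodule.span K (Set.range fun i => (dual K).component Finset.univ
      (dualNormalForm K v c i)) = ⊤ := by
  rw [eq_top_iff]
  rintro x -
  rw [← (dual K).component_hom_self Finset.univ x]
  suffices h : (⊤ : Submodule K ((dual K).Twisted V)) ≤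
      (Submodule.span K (Set.range fun i => (dual K).component Finset.univ
        (dualNormalForm K v c i))).comap ((dual K).component Finset.univ) from
    h Submodule.mem_top
  rw [← lieSpan_sup_eq_top, sup_le_iff]
  constructor
  · refine Submodule.span_le.2 ?_
    rintro a ⟨s, ha⟩
    by_cases hs : s = Finset.univ.val
    · subst hs
      have h1 := isDualPair.mem_rightNormedSpan _ ha (Finset.mem_univ v)
      refine Submodule.span_le.2 ?_ h1
      rintro _ ⟨w, hw, rfl⟩
      refine Submodule.subset_span ⟨.inl ⟨w, ?_⟩, rfl⟩
      rw [Finset.erase_val, ← hw, Multiset.erase_cons_head]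
    · rw [SetLike.mem_coe, Submodule.mem_comap,
        Operad.component_eq_zero _ (ha.mem_homogeneous) hs]
      exact Submodule.zero_mem _
  · rw [lieSpan, Submodule.map₂_span_span, Submodule.span_le]
    rintro _ ⟨a, ⟨s, ha⟩, b, ⟨t, hb⟩, rfl⟩
    rw [SetLike.mem_coe, Submodule.mem_comap]
    change (dual K).component Finset.univ ((dual K).gmul (dualOp K true) a b) ∈ _
    by_cases hst : s + t = Finset.univ.val
    · rcases Multiset.mem_add.1 (hst ▸ Finset.mem_univ v : v ∈ s + t) with hv | hv
      · exact component_m_mem v c hc ha hb hst hv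
      -- Antisymmetry of `m` puts the label `v` into the first factor.
      · rw [isDualPair.m_swap, map_neg]
        exact Submodule.neg_mem _ (component_m_mem v c hc hb ha (by rw [add_comm, hst]) hv)
    · rw [Operad.component_eq_zero _ (Operad.gmul_mem_homogeneous _ _ ha.mem_homogeneous
        hb.mem_homogeneous) hst]
      exact Submodule.zero_mem _

end

end SP

end

noncomputable section

/-! ### A model of the Koszul dual from a Lie algebra -/

section

variable (K L : Type*) [Field K] [LieRing L] [LieAlgebra K L]

/-- The bracket on `L × (L ⊗ L)`. -/
def modelBracket : (L × L ⊗[K] L) →ₗ[K] (L × L ⊗[K] L) →ₗ[K] (L × L ⊗[K] L) :=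
  LinearMap.mk₂ K (fun a b => (⁅a.1, b.1⁆, ⁅a.1, b.2⁆ - ⁅b.1, a.2⁆))
    (fun a a' b => Prod.ext (by simp) (by
      simp only [Prod.fst_add, Prod.snd_add, add_lie, lie_add]; abel))
    (fun c a b => Prod.ext (by simp) (by simp [smul_sub]))
    (fun a b b' => Prod.ext (by simp) (by
      simp only [Prod.fst_add, Prod.snd_add, add_lie, lie_add]; abel))
    (fun c a b => Prod.ext (by simp) (by simp [smul_sub]))

/-- The wedge product on `L × (L ⊗ L)`. -/
def modelWedge : (L × L ⊗[K] L) →ₗ[K] (L × L ⊗[K] L) →ₗ[K] (L × L ⊗[K] L) :=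
  LinearMap.mk₂ K (fun a b => (0, a.1 ⊗ₜ b.1 - b.1 ⊗ₜ a.1))
    (fun a a' b => Prod.ext (by simp) (by
      simp only [Prod.fst_add, Prod.snd_add, TensorProduct.add_tmul, TensorProduct.tmul_add]; abel))
    (fun c a b => Prod.ext (by simp) (by
      simp [smul_sub, TensorProduct.smul_tmul']))
    (fun a b b' => Prod.ext (by simp) (by
      simp only [Prod.fst_add, Prod.snd_add, TensorProduct.add_tmul, TensorProduct.tmul_add]; abel))
    (fun c a b => Prod.ext (by simp) (by
      simp [smul_sub, TensorProduct.smul_tmul']))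

variable {K L}

theorem modelBracket_apply (a b : L × L ⊗[K] L) :
    modelBracket K L a b = (⁅a.1, b.1⁆, ⁅a.1, b.2⁆ - ⁅b.1, a.2⁆) := rfl

theorem modelWedge_apply (a b : L × L ⊗[K] L) :
    modelWedge K L a b = (0, a.1 ⊗ₜ b.1 - b.1 ⊗ₜ a.1) := rfl

/-- The first operation is the Lie bracket of the extension of `L` by the module `L ⊗ L` with zero
bracket. The wedge is equivariant, depends only on the `L`-components and takes values in the
module, so its iterates vanish. -/
theorem isDualPair_model : IsDualPair (modelBracket K L) (modelWedge K L) where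
  ℓ_swap a b := Prod.ext (lie_skew _ _).symm (by simp [modelBracket_apply])
  m_swap a b := Prod.ext (by simp [modelWedge_apply]) (by simp [modelWedge_apply])
  jacobi a b c := by
    refine Prod.ext ?_ ?_
    · simp only [modelBracket_apply, Prod.fst_add, Prod.fst_zero]
      rw [← lie_skew ⁅a.1, b.1⁆, ← lie_skew ⁅b.1, c.1⁆, ← lie_skew ⁅c.1, a.1⁆, ← neg_eq_zero,
        ← lie_jacobi a.1 b.1 c.1]
      abel
    · simp only [modelBracket_apply, Prod.snd_add, Prod.snd_zero, lie_sub, lie_lie]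
      abel
  m_m a b c := Prod.ext (by simp [modelWedge_apply]) (by simp [modelWedge_apply])
  ℓ_m a b c := by
    refine Prod.ext (by simp [modelBracket_apply, modelWedge_apply]) ?_
    simp only [modelBracket_apply, modelWedge_apply, Prod.snd_add, Prod.snd_zero, zero_lie, lie_sub,
      TensorProduct.LieModule.lie_tmul_right, zero_sub]
    rw [← lie_skew b.1 c.1]
    simp only [TensorProduct.neg_tmul, TensorProduct.tmul_neg]
    abel

theorem rightNormed_model {V : Type*} (e : V → L) (w : List V) (v : V) :
    rightNormed (modelBracket K L) (fun u => (e u, 0)) w v =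
      (rightNormed (LieModule.toEnd K L L : L →ₗ[K] L →ₗ[K] L) e w v, 0) := by
  induction w with
  | nil => rfl
  | cons u w ih =>
    rw [rightNormed_cons, ih, modelBracket_apply, rightNormed_cons, lie_zero, lie_zero, sub_zero]
    rfl

end

/-! ### Coefficients of right-normed brackets in the free associative algebra -/

section

variable {K V : Type*} [Field K]

/-- The coefficient of a word. -/
def wordCoeff (K : Type*) {V : Type*} [Field K] (l : List V) :
    MonoidAlgebra K (FreeMonoid V) →ₗ[K] K where
  toFun a := a.coeff (FreeMonoid.ofList l)
  map_add' _ _ := rfl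
  map_smul' _ _ := rfl

/-- A letter, as an element of the free associative algebra. -/
def letter (K : Type*) {V : Type*} [Field K] (u : V) : MonoidAlgebra K (FreeMonoid V) :=
  MonoidAlgebra.single (FreeMonoid.of u) 1

open Classical in
theorem wordCoeff_letter (l : List V) (u : V) :
    wordCoeff K l (letter K u) = if l = [u] then 1 else 0 := by
  change (Finsupp.single (FreeMonoid.of u) (1 : K)) (FreeMonoid.ofList l) = _
  rw [Finsupp.single_apply]
  exact if_congr ⟨fun h => congrArg FreeMonoid.toList h.symm, fun h => by rw [h]; rfl⟩ rfl rfl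

theorem wordCoeff_cons_letter_mul (l : List V) (u : V) (a : MonoidAlgebra K (FreeMonoid V)) :
    wordCoeff K (u :: l) (letter K u * a) = wordCoeff K l a := by
  refine (MonoidAlgebra.coeff_single_mul_eq_mul_coeff (FreeMonoid.ofList l) fun m _ => ?_).trans
    (one_mul _)
  exact ⟨fun h => (List.cons.inj (congrArg FreeMonoid.toList h)).2, fun h => by rw [h]; rfl⟩

theorem wordCoeff_letter_mul {l : List V} {u : V} (h : ∀ l', l ≠ u :: l')
    (a : MonoidAlgebra K (FreeMonoid V)) : wordCoeff K l (letter K u * a) = 0 :=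
  MonoidAlgebra.coeff_single_mul_of_forall_mul_ne _ _ fun _ hd =>
    h _ (congrArg FreeMonoid.toList hd.symm)

theorem wordCoeff_concat_mul_letter (l : List V) (u : V) (a : MonoidAlgebra K (FreeMonoid V)) :
    wordCoeff K (l ++ [u]) (a * letter K u) = wordCoeff K l a := by
  refine (MonoidAlgebra.coeff_mul_single_eq_coeff_mul (FreeMonoid.ofList l) fun m _ => ?_).trans
    (mul_one _)
  exact ⟨fun h => List.append_cancel_right (congrArg FreeMonoid.toList h), fun h => by rw [h]; rfl⟩

theorem wordCoeff_mul_letter {l : List V} {u : V} (h : ∀ l', l ≠ l' ++ [u])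
    (a : MonoidAlgebra K (FreeMonoid V)) : wordCoeff K l (a * letter K u) = 0 :=
  MonoidAlgebra.coeff_mul_single_of_forall_mul_ne _ _ fun _ hd =>
    h _ (congrArg FreeMonoid.toList hd.symm)

attribute [local instance] LieRing.ofAssociativeRing

/-- The right-normed bracket in the free associative algebra. -/
abbrev assocBracket (K : Type*) {V : Type*} [Field K] (w : List V) (v : V) :
    MonoidAlgebra K (FreeMonoid V) :=
  rightNormed (LieModule.toEnd K (MonoidAlgebra K (FreeMonoid V)) (MonoidAlgebra K (FreeMonoid V)) :
    MonoidAlgebra K (FreeMonoid V) →ₗ[K] _) (letter K) w v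

theorem assocBracket_cons (u : V) (w : List V) (v : V) : assocBracket K (u :: w) v =
    letter K u * assocBracket K w v - assocBracket K w v * letter K u := rfl

/-- The bracket is homogeneous: only words with exactly its letters occur. -/
theorem wordCoeff_assocBracket_of_ne {l w : List V} {v : V}
    (h : (l : Multiset V) ≠ v ::ₘ (w : Multiset V)) : wordCoeff K l (assocBracket K w v) = 0 := by
  induction w generalizing l with
  | nil =>
    refine (wordCoeff_letter l v).trans (if_neg ?_)
    rintro rfl
    exact h rfl
  | cons u w ih =>
    rw [assocBracket_cons, map_sub]
    have h1 : wordCoeff K l (letter K u * assocBracket K w v) = 0 := by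
      by_cases hl : ∃ l', l = u :: l'
      · obtain ⟨l', rfl⟩ := hl
        rw [wordCoeff_cons_letter_mul]
        refine ih fun h2 => h ?_
        rw [← Multiset.cons_coe, ← Multiset.cons_coe, h2, Multiset.cons_swap]
      · exact wordCoeff_letter_mul (fun l' hl' => hl ⟨l', hl'⟩) _
    have h2 : wordCoeff K l (assocBracket K w v * letter K u) = 0 := by
      by_cases hl : ∃ l', l = l' ++ [u]
      · obtain ⟨l', rfl⟩ := hl
        rw [wordCoeff_concat_mul_letter]
        refine ih fun h2 => h ?_
        rw [← Multiset.coe_add, h2, ← Multiset.cons_coe, Multiset.cons_add, Multiset.cons_inj_right,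
          add_comm]
        rfl
      · exact wordCoeff_mul_letter (fun l' hl' => hl ⟨l', hl'⟩) _
    rw [h1, h2, sub_zero]

-- In a commutator with the letter `u ≠ v`, only the term with `u` in front contains words ending in
-- `v`. So the bracket has a single word ending in `v`, namely `w` followed by `v`.
open Classical in
theorem wordCoeff_assocBracket (l : List V) {w : List V} {v : V} (h : v ∉ w) :
    wordCoeff K (l ++ [v]) (assocBracket K w v) = if l = w then 1 else 0 := by
  induction w generalizing l with
  | nil =>
    refine (wordCoeff_letter _ v).trans ?_
    simp
  | cons u w ih =>
    rw [List.mem_cons, not_or] at h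
    rw [assocBracket_cons, map_sub, wordCoeff_mul_letter (l := l ++ [v]) (u := u), sub_zero]
    · rcases l with _ | ⟨u', l⟩
      · rw [wordCoeff_letter_mul]
        · simp
        · intro l' hl'
          exact h.1 (List.cons.inj hl').1
      · by_cases hu : u' = u
        · subst hu
          rw [List.cons_append, wordCoeff_cons_letter_mul, ih _ h.2]
          simp
        · rw [wordCoeff_letter_mul]
          · simp [hu]
          · intro l' hl'
            exact hu (List.cons.inj hl').1
    · intro l' hl'
      exact h.1 (by simpa using (List.append_inj' hl' rfl).2)

end

/-! ### Independence of the normal forms -/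

section

variable {K V : Type*} [Field K] [Fintype V] [DecidableEq V]

attribute [local instance] LieRing.ofAssociativeRing

/-- The functionals dual to the normal forms. -/
def normalDual (K : Type*) {V : Type*} [Field K] [Fintype V] [DecidableEq V] (v : V)
    (c : Finset V → V) : NormalIndex v c → Module.Dual K (MonoidAlgebra K (FreeMonoid V) ×
      MonoidAlgebra K (FreeMonoid V) ⊗[K] MonoidAlgebra K (FreeMonoid V))
  | .inl l => wordCoeff K (l.1 ++ [v]) ∘ₗ LinearMap.fst K _ _
  | .inr i => TensorProduct.dualDistrib K _ _ (wordCoeff K (i.2.1.1 ++ [v]) ⊗ₜ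
      wordCoeff K (i.2.2.1 ++ [c i.1.1])) ∘ₗ LinearMap.snd K _ _

theorem normalDual_inr (v : V) (c : Finset V → V) (C : {C : Finset V // v ∉ C ∧ C.Nonempty})
    (l : Words (Finset.univ.erase v \ C.1)) (l' : Words (C.1.erase (c C.1)))
    (a : MonoidAlgebra K (FreeMonoid V))
    (t : MonoidAlgebra K (FreeMonoid V) ⊗[K] MonoidAlgebra K (FreeMonoid V)) :
    normalDual K v c (.inr ⟨C, l, l'⟩) (a, t) = TensorProduct.dualDistrib K _ _
      (wordCoeff K (l.1 ++ [v]) ⊗ₜ wordCoeff K (l'.1 ++ [c C.1])) t := rfl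

-- For two wedges the letters of the second factor determine `C`, and the words with last letters
-- `v` and `c C` determine the two brackets.
open Classical in
theorem normalDual_normalForm (v : V) (c : Finset V → V) (hc : ∀ C, C.Nonempty → c C ∈ C)
    (i j : NormalIndex v c) : normalDual K v c i (normalForm
      (modelBracket K (MonoidAlgebra K (FreeMonoid V)))
      (modelWedge K (MonoidAlgebra K (FreeMonoid V))) (fun u => (letter K u, 0)) v c j) =
        if i = j then 1 else 0 := by
  have hmem : ∀ {B : Finset V} (w : Words B) (u : V), u ∉ B → u ∉ w.1 := by
    intro B w u hu h
    have h1 : u ∈ (w.1 : Multiset V) := h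
    rw [w.2] at h1
    exact hu h1
  rcases i with l | ⟨C, l, l'⟩ <;> rcases j with w | ⟨D, w, w'⟩
  · refine (congrArg (fun z => wordCoeff K (l.1 ++ [v]) z.1)
      (rightNormed_model (K := K) (letter K) w.1 v)).trans ?_
    refine (wordCoeff_assocBracket l.1 (hmem w v (by simp))).trans ?_
    simp [Subtype.ext_iff]
  · rw [if_neg (by simp)]
    exact map_zero (wordCoeff K (l.1 ++ [v]))
  · rw [if_neg (by simp)]
    refine (congrArg (fun z => TensorProduct.dualDistrib K _ _ (wordCoeff K (l.1 ++ [v]) ⊗ₜ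
      wordCoeff K (l'.1 ++ [c C.1])) z.2) (rightNormed_model (K := K) (letter K) w.1 v)).trans ?_
    exact map_zero _
  · have h1 : normalForm (modelBracket K (MonoidAlgebra K (FreeMonoid V)))
        (modelWedge K (MonoidAlgebra K (FreeMonoid V))) (fun u => (letter K u, 0)) v c
        (.inr ⟨D, w, w'⟩) = (0, assocBracket K w.1 v ⊗ₜ assocBracket K w'.1 (c D.1) -
          assocBracket K w'.1 (c D.1) ⊗ₜ assocBracket K w.1 v) := by
      rw [normalForm, rightNormed_model, rightNormed_model, modelWedge_apply]
    rw [h1]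
    rw [normalDual_inr]
    have hw' : c D.1 ::ₘ (w'.1 : Multiset V) = D.1.val := by
      rw [w'.2, Finset.erase_val, Multiset.cons_erase (hc _ D.2.2)]
    have hl' : ((l'.1 ++ [c C.1] : List V) : Multiset V) = C.1.val := by
      rw [← Multiset.coe_add, l'.2, Finset.erase_val, add_comm]
      exact Multiset.cons_erase (hc _ C.2.2)
    -- The exchanged term of the wedge does not contribute, because its first factor does not
    -- involve `v`.
    have h2 : wordCoeff K (l.1 ++ [v]) (assocBracket K w'.1 (c D.1)) = 0 := by
      refine wordCoeff_assocBracket_of_ne fun h => D.2.1 ?_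
      rw [hw'] at h
      have h3 : v ∈ ((l.1 ++ [v] : List V) : Multiset V) := by simp
      rw [h] at h3
      exact h3
    rw [map_sub, TensorProduct.dualDistrib_apply, TensorProduct.dualDistrib_apply, h2, zero_mul,
      sub_zero, wordCoeff_assocBracket l.1 (hmem w v (by simp))]
    by_cases hC : C = D
    · subst hC
      rw [wordCoeff_assocBracket l'.1 (hmem w' _ (by simp))]
      by_cases h3 : l = w
      · by_cases h4 : l' = w'
        · rw [h3, h4, if_pos rfl, if_pos rfl, if_pos rfl, mul_one]
        · rw [if_neg fun h => h4 (Subtype.ext h), mul_zero, if_neg]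
          intro h
          exact h4 (Prod.ext_iff.1 (eq_of_heq (Sigma.mk.inj (Sum.inr.inj h)).2)).2
      · rw [if_neg fun h => h3 (Subtype.ext h), zero_mul, if_neg]
        intro h
        exact h3 (Prod.ext_iff.1 (eq_of_heq (Sigma.mk.inj (Sum.inr.inj h)).2)).1
    · rw [wordCoeff_assocBracket_of_ne, mul_zero, if_neg]
      · intro h
        exact hC (Sigma.mk.inj (Sum.inr.inj h)).1
      · rw [hl', hw']
        exact fun h => hC (Subtype.ext (Finset.val_injective h))

theorem linearIndependent_normalForm (v : V) (c : Finset V → V) (hc : ∀ C, C.Nonempty → c C ∈ C) :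
    LinearIndependent K (normalForm (modelBracket K (MonoidAlgebra K (FreeMonoid V)))
      (modelWedge K (MonoidAlgebra K (FreeMonoid V))) (fun u => (letter K u, 0)) v c) := by
  classical
  refine LinearIndependent.of_pairwise_dual_eq_zero_one _ (normalDual K v c) ?_ ?_
  · intro i j hij
    rw [normalDual_normalForm v c hc, if_neg hij]
  · intro i
    rw [normalDual_normalForm v c hc, if_pos rfl]

end

end

noncomputable section

/-! ### The dimensions of the Koszul dual -/

section

variable {V : Type*} [Fintype V] [DecidableEq V] {v : V}

theorem Words.cons_val (w : Words (Finset.univ.erase v)) :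
    v ::ₘ (w.1 : Multiset V) = Finset.univ.val := by
  rw [w.2, Finset.erase_val, Multiset.cons_erase (Finset.mem_univ v)]

theorem Words.cons_val_add {C : Finset V} (hv : v ∉ C) {u : V} (hu : u ∈ C)
    (w : Words (Finset.univ.erase v \ C)) (w' : Words (C.erase u)) :
    v ::ₘ (w.1 : Multiset V) + (u ::ₘ (w'.1 : Multiset V)) = Finset.univ.val := by
  have hC : C ⊆ Finset.univ.erase v := fun x hx =>
    Finset.mem_erase.2 ⟨fun h => hv (h ▸ hx), Finset.mem_univ x⟩
  rw [w.2, w'.2, Finset.erase_val C, Multiset.cons_erase hu, Multiset.cons_add, Finset.sdiff_val,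
    Multiset.sub_add_cancel (Finset.val_le_iff.2 hC), Finset.erase_val,
    Multiset.cons_erase (Finset.mem_univ v)]

end

namespace SP

variable {K : Type*} [Field K]

section

variable {A : Type*} [AddCommGroup A] [Module K A] {ℓ m : A →ₗ[K] A →ₗ[K] A}
  (h : IsDualPair ℓ m) {V : Type} [DecidableEq V] (e : V → A)

/-- The values of the elements of the twisted algebra of the Koszul dual in a model. -/
def modelValue : (dual K).Twisted V →ₗ[K] A :=
  DirectSum.toModule K _ _ fun B =>
    EndOperad.eval (fun b : B => e b) ∘ₗ (toModel h).app B

theorem modelValue_hom (B : Finset V) (x : (dual K).obj B) : modelValue h e ((dual K).hom B x) =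
    EndOperad.eval (fun b : B => e b) ((toModel h).app B x) :=
  DirectSum.toModule_lof _ _ _

theorem modelValue_leaf (v : V) : modelValue h e ((dual K).leaf v) = e v := by
  rw [Operad.leaf, modelValue_hom, Operad.Hom.app_map, Operad.Hom.app_one]
  rfl

/-- Products with overlapping labels vanish in the twisted algebra but not in the model, so
multiplicativity requires distinct labels. -/
theorem modelValue_gmul (u : Bool) {s t : Multiset V} (hst : (s + t).Nodup)
    {a b : (dual K).Twisted V} (ha : a ∈ (dual K).homogeneous s)
    (hb : b ∈ (dual K).homogeneous t) :
    modelValue h e ((dual K).gmul (dualOp K u) a b) =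
      (if u then m else ℓ) (modelValue h e a) (modelValue h e b) := by
  induction ha using Submodule.span_induction with
  | zero => simp only [map_zero, LinearMap.zero_apply]
  | add x y _ _ hx hy => simp only [map_add, LinearMap.add_apply, hx, hy]
  | smul c x _ hx => simp only [map_smul, LinearMap.smul_apply, hx]
  | mem x hx =>
    obtain ⟨B, x, rfl, rfl⟩ := hx
    induction hb using Submodule.span_induction with
    | zero => simp only [map_zero]
    | add x y _ _ hx hy => simp only [map_add, hx, hy]
    | smul c x _ hx => simp only [map_smul, hx]
    | mem y hy =>
      obtain ⟨C, y, rfl, rfl⟩ := hy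
      have hd : Disjoint B C := Finset.disjoint_val.1 (Multiset.nodup_add.1 hst).2.2
      rw [Operad.gmul_hom_hom_of_disjoint _ _ hd, modelValue_hom, modelValue_hom, modelValue_hom,
        Operad.Hom.app_map, EndOperad.eval_map, eval_toModel_bin]
      rfl

theorem modelValue_rightNormed (w : List V) (v : V) (hw : (v ::ₘ (w : Multiset V)).Nodup) :
    modelValue h e (rightNormed ((dual K).gmul (dualOp K false)) (dual K).leaf w v) =
      rightNormed ℓ e w v := by
  induction w with
  | nil => exact modelValue_leaf h e v
  | cons u w ih =>
    have h1 : v ::ₘ ((u :: w : List V) : Multiset V) = {u} + (v ::ₘ (w : Multiset V)) := by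
      rw [Multiset.singleton_add, Multiset.cons_swap, Multiset.cons_coe u]
    rw [h1] at hw
    rw [rightNormed_cons, rightNormed_cons, modelValue_gmul h e false hw
      ((dual K).leaf_mem_homogeneous u) (lieMonomial_rightNormed _ _ w v).mem_homogeneous,
      modelValue_leaf, ih (Multiset.nodup_add.1 hw).2.1]
    rfl

variable [Fintype V] (v : V) (c : Finset V → V) (hc : ∀ C, C.Nonempty → c C ∈ C)
include hc

theorem dualNormalForm_mem (i : NormalIndex v c) :
    dualNormalForm K v c i ∈ (dual K).homogeneous Finset.univ.val := by
  rcases i with w | ⟨C, w, w'⟩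
  · rw [← w.cons_val]
    exact (lieMonomial_rightNormed _ _ _ _).mem_homogeneous
  · rw [← Words.cons_val_add C.2.1 (hc _ C.2.2) w w']
    exact (dual K).gmul_mem_homogeneous _ (lieMonomial_rightNormed _ _ _ _).mem_homogeneous
      (lieMonomial_rightNormed _ _ _ _).mem_homogeneous

theorem modelValue_dualNormalForm (i : NormalIndex v c) :
    modelValue h e (dualNormalForm K v c i) = normalForm ℓ m e v c i := by
  rcases i with w | ⟨C, w, w'⟩
  · exact modelValue_rightNormed h e w.1 v (w.cons_val ▸ Finset.univ.nodup)
  · have hnd : (v ::ₘ (w.1 : Multiset V) + (c C.1 ::ₘ (w'.1 : Multiset V))).Nodup :=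
      Words.cons_val_add C.2.1 (hc _ C.2.2) w w' ▸ Finset.univ.nodup
    refine (modelValue_gmul h e true hnd (lieMonomial_rightNormed _ _ _ _).mem_homogeneous
      (lieMonomial_rightNormed _ _ _ _).mem_homogeneous).trans ?_
    rw [modelValue_rightNormed h e _ _ (Multiset.nodup_add.1 hnd).1,
      modelValue_rightNormed h e _ _ (Multiset.nodup_add.1 hnd).2.1]
    rfl

-- Evaluation in the model is linear and sends the normal forms to the corresponding elements of the
-- model, so a linear relation would persist there.
include h in
theorem linearIndependent_dualNormalForm_of_model
    (hi : LinearIndependent K (normalForm ℓ m e v c)) :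
    LinearIndependent K fun i : NormalIndex v c =>
      (dual K).component Finset.univ (dualNormalForm K v c i) := by
  refine LinearIndependent.of_comp (modelValue h e ∘ₗ (dual K).hom Finset.univ) ?_
  have h1 : (modelValue h e ∘ₗ (dual K).hom Finset.univ) ∘ (fun i : NormalIndex v c =>
      (dual K).component Finset.univ (dualNormalForm K v c i)) = normalForm ℓ m e v c := by
    funext i
    change modelValue h e ((dual K).hom Finset.univ ((dual K).component Finset.univ _)) = _
    rw [Operad.hom_component _ (dualNormalForm_mem v c hc i), modelValue_dualNormalForm h e v c hc]
  rw [h1]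
  exact hi

end

section

variable {V : Type} [DecidableEq V] [Fintype V] (v : V) (c : Finset V → V)
  (hc : ∀ C, C.Nonempty → c C ∈ C)
include hc

attribute [local instance] LieRing.ofAssociativeRing

theorem linearIndependent_dualNormalForm : LinearIndependent K fun i : NormalIndex v c =>
    (dual K).component Finset.univ (dualNormalForm K v c i) :=
  linearIndependent_dualNormalForm_of_model isDualPair_model _ v c hc
    (linearIndependent_normalForm v c hc)

variable (K) in
/-- The normal forms are a basis of the Koszul dual. -/
def dualBasis : Module.Basis (NormalIndex v c) K ((dual K).obj (Finset.univ : Finset V)) :=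
  Module.Basis.mk (linearIndependent_dualNormalForm v c hc) (span_dualNormalForm v c hc).ge

end

end SP

/-! ### The number of normal forms -/

section

variable {V : Type*} [DecidableEq V]

instance (B : Finset V) : Finite (Words B) := by
  refine Set.Finite.to_subtype (Set.Finite.subset (List.finite_toSet B.toList.permutations) ?_)
  intro w hw
  rw [Set.mem_ofPred_eq, List.mem_permutations, ← Multiset.coe_eq_coe, Finset.coe_toList]
  exact hw

theorem card_words (B : Finset V) : Nat.card (Words B) = B.card.factorial := by
  have h : ∀ w : List V, (w : Multiset V) = B.val ↔ w ∈ B.toList.permutations.toFinset := by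
    intro w
    rw [List.mem_toFinset, List.mem_permutations, ← Multiset.coe_eq_coe, Finset.coe_toList]
  rw [Nat.card_congr (Equiv.subtypeEquivRight h), Nat.card_eq_fintype_card, Fintype.card_coe,
    List.toFinset_card_of_nodup (List.nodup_permutations _ B.nodup_toList),
    List.length_permutations, Finset.length_toList]

/-- Sets `C` with `k + 1` elements avoid `v`, so there are `n.choose (k + 1)` of them. The
complement of `C` and `v` can be ordered in `(n - (k + 1))!` ways, and `C` without its chosen
element in `k!` ways. -/
theorem card_normalIndex [Fintype V] (v : V) (c : Finset V → V) (hc : ∀ C, C.Nonempty → c C ∈ C)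
    {n : ℕ} (hn : Fintype.card V = n + 1) : Nat.card (NormalIndex v c) =
      n.factorial + ∑ k ∈ Finset.range n,
        n.choose (k + 1) * ((n - (k + 1)).factorial * k.factorial) := by
  classical
  have hcard : (Finset.univ.erase v).card = n := by
    rw [Finset.card_erase_of_mem (Finset.mem_univ v), Finset.card_univ, hn, Nat.add_sub_cancel]
  rw [Nat.card_sum, card_words, hcard, Nat.card_sigma]
  congr 1
  have h1 : ∀ C : {C : Finset V // v ∉ C ∧ C.Nonempty},
      Nat.card (Words (Finset.univ.erase v \ C.1) ×
      Words (C.1.erase (c C.1))) = (n - C.1.card).factorial * (C.1.card - 1).factorial := by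
    intro C
    have hC : C.1 ⊆ Finset.univ.erase v := fun x hx =>
      Finset.mem_erase.2 ⟨fun h => C.2.1 (h ▸ hx), Finset.mem_univ x⟩
    rw [Nat.card_prod, card_words, card_words, Finset.card_sdiff_of_subset hC, hcard,
      Finset.card_erase_of_mem (hc _ C.2.2)]
  simp only [h1]
  have h2 : ∀ C : Finset V, C ∈ (Finset.univ.erase v).powerset.filter Finset.Nonempty ↔
      v ∉ C ∧ C.Nonempty := by
    intro C
    rw [Finset.mem_filter, Finset.mem_powerset, and_congr_left_iff]
    intro _
    exact ⟨fun h hv => (Finset.mem_erase.1 (h hv)).1 rfl, fun h x hx =>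
      Finset.mem_erase.2 ⟨fun hx' => h (hx' ▸ hx), Finset.mem_univ x⟩⟩
  rw [← Finset.sum_subtype _ h2 (fun C => (n - C.card).factorial * (C.card - 1).factorial),
    Finset.sum_filter]
  -- The summand is made a function of the cardinality; the case `k = 0` excludes the empty set, for
  -- which `k - 1` would be truncated.
  have h3 : ∀ C : Finset V, (if C.Nonempty then (n - C.card).factorial * (C.card - 1).factorial
      else 0) = (fun k => if k = 0 then 0 else (n - k).factorial * (k - 1).factorial) C.card := by
    intro C
    dsimp only
    by_cases h : C.Nonempty
    · rw [if_pos h, if_neg (Finset.card_ne_zero.2 h)]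
    · rw [if_neg h, if_pos (by simpa [Finset.card_eq_zero] using h)]
  simp only [h3]
  rw [Finset.sum_powerset_apply_card fun k =>
    if k = 0 then 0 else (n - k).factorial * (k - 1).factorial, hcard, Finset.sum_range_succ']
  simp

/-- The summand of index `k` is `n! / (k + 1)`. -/
theorem sum_choose_factorial (n : ℕ) :
    ((n.factorial + ∑ k ∈ Finset.range n,
        n.choose (k + 1) * ((n - (k + 1)).factorial * k.factorial) :
      ℕ) : ℚ) = (n.factorial : ℚ) * (1 + harmonic n) := by
  rw [harmonic, mul_add, mul_one, Finset.mul_sum]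
  push_cast
  congr 1
  refine Finset.sum_congr rfl fun k hk => ?_
  have h := Nat.choose_mul_factorial_mul_factorial (Finset.mem_range.1 hk : k + 1 ≤ n)
  rw [← h, Nat.factorial_succ]
  push_cast
  have h0 : (k : ℚ) + 1 ≠ 0 := by positivity
  field_simp

end

namespace SP

variable (K : Type*) [Field K]

theorem exists_basis_dual (n : ℕ) : ∃ (ι : Type) (_ : Finite ι),
    Nonempty (Module.Basis ι K ((dual K).obj (Fin (n + 1)))) ∧
      (Nat.card ι : ℚ) = (n.factorial : ℚ) * (1 + harmonic n) := by
  classical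
  -- Any choice of elements will do; the value at the empty set is never used.
  have hc : ∀ C : Finset (Fin (n + 1)), ∃ u, C.Nonempty → u ∈ C := by
    intro C
    by_cases h : C.Nonempty
    · exact ⟨h.choose, fun _ => h.choose_spec⟩
    · exact ⟨0, fun h' => absurd h' h⟩
  choose c hc using hc
  have e : (dual K).obj (Finset.univ : Finset (Fin (n + 1))) ≃ₗ[K] (dual K).obj (Fin (n + 1)) :=
    LinearEquiv.ofLinearMap ((dual K).map (Equiv.subtypeUnivEquiv Finset.mem_univ))
      ((dual K).map (Equiv.subtypeUnivEquiv Finset.mem_univ).symm)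
      (LinearMap.ext fun x => by
        rw [LinearMap.comp_apply, Operad.map_map, Operad.map_eq_self] <;> simp)
      (LinearMap.ext fun x => by
        rw [LinearMap.comp_apply, Operad.map_map, Operad.map_eq_self] <;> simp)
  refine ⟨NormalIndex 0 c, inferInstance, ⟨(dualBasis K 0 c hc).map e⟩, ?_⟩
  rw [card_normalIndex 0 c hc (Fintype.card_fin _), sum_choose_factorial]

theorem finite_dual (n : ℕ) : Module.Finite K ((dual K).obj (Fin n)) := by
  rcases n with _ | n
  · have := (dual K).positive (Fin 0)
    infer_instance
  · obtain ⟨ι, _, ⟨b⟩, -⟩ := exists_basis_dual K n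
    exact Module.Finite.of_basis b

theorem finrank_dual_zero : Module.finrank K ((dual K).obj (Fin 0)) = 0 := by
  have := (dual K).positive (Fin 0)
  exact Module.finrank_zero_of_subsingleton

theorem finrank_dual (n : ℕ) : (Module.finrank K ((dual K).obj (Fin (n + 1))) : ℚ) =
    (n.factorial : ℚ) * (1 + harmonic n) := by
  obtain ⟨ι, _, ⟨b⟩, h⟩ := exists_basis_dual K n
  rw [Module.finrank_eq_nat_card_basis b, h]

end SP

end

noncomputable section

/-! ### The Hilbert series -/

/-- The constant coefficient is `1 / 0 = 0` by convention, as it should be. -/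
theorem PowerSeries.logOf_one_sub_X :
    PowerSeries.logOf (1 - PowerSeries.X : PowerSeries ℚ) =
      -PowerSeries.mk fun n => (1 / n : ℚ) := by
  have h : (1 - PowerSeries.X : PowerSeries ℚ) - 1 = (-1 : ℚ) • PowerSeries.X := by
    rw [neg_smul, one_smul]; ring
  rw [PowerSeries.logOf_eq, h, ← PowerSeries.rescale_eq_subst]
  ext n
  rw [PowerSeries.coeff_rescale, PowerSeries.coeff_log, map_neg, PowerSeries.coeff_mk]
  by_cases hn : n = 0
  · simp [hn]
  · rw [if_neg hn, Algebra.algebraMap_self_apply, pow_succ, mul_neg_one, neg_div, mul_neg,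
      ← mul_div_assoc, ← mul_pow, neg_one_mul, neg_neg, one_pow]

/-- With `L = -log(1 - X)` the right side is `L + L² / 2`. Both sides have constant term zero, and
the derivative `L' + L * L'` has coefficients `1 + harmonic n`, since multiplication by `L' = 1 / (1
- X)` forms partial sums. -/
theorem PowerSeries.mk_one_add_harmonic_div :
    (PowerSeries.mk fun n : ℕ => if n = 0 then 0 else (1 + harmonic (n - 1)) / (n : ℚ)) =
      PowerSeries.C (1 / 2 : ℚ) *
        ((1 - PowerSeries.logOf (1 - PowerSeries.X : PowerSeries ℚ)) ^ 2 - 1) := by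
  set L : PowerSeries ℚ := PowerSeries.mk fun n => (1 / n : ℚ) with hL
  have h2 : PowerSeries.C (1 / 2 : ℚ) * 2 = 1 := by
    rw [show (2 : PowerSeries ℚ) = PowerSeries.C 2 from (map_ofNat _ 2).symm, ← map_mul]
    norm_num
  have h1 : PowerSeries.C (1 / 2 : ℚ) * ((1 - PowerSeries.logOf (1 - PowerSeries.X)) ^ 2 - 1) =
      L + PowerSeries.C (1 / 2 : ℚ) * (L * L) := by
    rw [PowerSeries.logOf_one_sub_X]
    linear_combination L * h2
  have hL' : PowerSeries.derivative ℚ L = PowerSeries.mk fun _ => 1 := by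
    ext n
    rw [PowerSeries.coeff_derivative, hL, PowerSeries.coeff_mk, PowerSeries.coeff_mk]
    push_cast
    field_simp
  rw [h1]
  refine PowerSeries.derivative.ext ?_ ?_
  · have h3 : PowerSeries.derivative ℚ (PowerSeries.C (1 / 2 : ℚ) * (L * L)) =
        L * PowerSeries.derivative ℚ L := by
      rw [Derivation.leibniz, Derivation.leibniz, PowerSeries.derivative_C, smul_zero, add_zero,
        smul_eq_mul, smul_eq_mul]
      linear_combination L * PowerSeries.derivative ℚ L * h2
    rw [map_add, h3, hL']
    ext n
    rw [PowerSeries.coeff_derivative, PowerSeries.coeff_mk, map_add, PowerSeries.coeff_mk,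
      PowerSeries.coeff_mul, Finset.Nat.sum_antidiagonal_eq_sum_range_succ_mk,
      Finset.sum_range_succ', if_neg n.succ_ne_zero, Nat.add_sub_cancel, harmonic]
    push_cast
    rw [div_mul_cancel₀ _ (by positivity)]
    simp [hL]
  · simp [hL]

namespace SP

variable (K : Type*) [Field K]

theorem hilbertSeries_dual : (dual K).hilbertSeries = PowerSeries.C (1 / 2 : ℚ) *
    ((1 - PowerSeries.logOf (1 - PowerSeries.X : PowerSeries ℚ)) ^ 2 - 1) := by
  rw [← PowerSeries.mk_one_add_harmonic_div, LinSpecies.hilbertSeries]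
  ext n
  rw [PowerSeries.coeff_mk, PowerSeries.coeff_mk]
  rcases n with _ | n
  · rw [finrank_dual_zero]
    simp
  · rw [finrank_dual, if_neg n.succ_ne_zero, Nat.add_sub_cancel, Nat.factorial_succ]
    push_cast
    have h : (n.factorial : ℚ) ≠ 0 := by positivity
    have h' : (n : ℚ) + 1 ≠ 0 := by positivity
    field_simp

theorem finrank_dual_values :
    (List.range 9).map (fun n => Module.finrank K ((dual K).obj (Fin (n + 1)))) =
      [1, 2, 5, 17, 74, 394, 2484, 18108, 149904] := by
  have h : ∀ n d : ℕ, (n.factorial : ℚ) * (1 + harmonic n) = d →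
      Module.finrank K ((dual K).obj (Fin (n + 1))) = d := fun n d hd => by
    rw [← finrank_dual K n] at hd
    exact_mod_cast hd
  simp only [List.range_succ, List.range_zero, List.nil_append, List.cons_append, List.map_cons,
    List.map_nil]
  rw [h 0 1, h 1 2, h 2 5, h 3 17, h 4 74, h 5 394, h 6 2484, h 7 18108, h 8 149904]
  all_goals simp only [harmonic, Finset.sum_range_succ, Finset.sum_range_zero, Nat.factorial]
  all_goals norm_num

end SP

end

theorem mainTheorem5 (K : Type*) [Field K] [CharZero K] :
    -- `Ope(G, R)` is a binary quadratic presentation of `SP`, so that `SP.dual K = Ope(G^∨, R^⊥)`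
    -- is the Koszul dual of `SP`
    (SP.gens K).IsBinary ∧
    IsQuadratic (SP.gens K) (SP.relations K) ∧
    Nonempty (Operad.Iso (Ope (SP.gens K) (SP.relations K)) (SP.operad K)) ∧
    -- the Hilbert series of the Koszul dual
    (∀ n : ℕ, Module.Finite K ((SP.dual K).obj (Fin n))) ∧
    (SP.dual K).hilbertSeries =
      PowerSeries.C (1 / 2 : ℚ) *
        ((1 - PowerSeries.logOf (1 - PowerSeries.X : PowerSeries ℚ)) ^ 2 - 1) ∧
    -- the dimensions
    (∀ n : ℕ, (Module.finrank K ((SP.dual K).obj (Fin (n + 1))) : ℚ) =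
      (n.factorial : ℚ) * (1 + harmonic n)) ∧
    (List.range 9).map (fun n => Module.finrank K ((SP.dual K).obj (Fin (n + 1)))) =
      [1, 2, 5, 17, 74, 394, 2484, 18108, 149904] := by
  exact ⟨SP.isBinary, SP.isQuadratic, SP.nonempty_iso K, SP.finite_dual K, SP.hilbertSeries_dual K,
    SP.finrank_dual K, SP.finrank_dual_values K⟩
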